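/- Let $n\ge 1$ and let $\mathbb{H}^n=\mathbb{R}^{2n+1}$, with coordinates $(x,y,t)\in\mathbb{R}^n\times\mathbb{R}^n\times\mathbb{R}$, be the Heisenberg group with its left-invariant vector fields $X_k=\partial_{x_k}+y_k\partial_t$, $Y_k=\partial_{y_k}-x_k\partial_t$ $(1\le k\le n)$ and $T=\partial_t$. Let $\langle\cdot,\cdot\rangle$ be the Riemannian metric for which $\{X_k,Y_k,T\}$ is orthonormal at every point; its Riemannian volume $dv$ is Lebesgue measure. Let $D$ be its Levi-Civita connection and $\operatorname{div}$ its divergence. The horizontal distribution is the span of the $X_k,Y_k$, and $V_H=V-\langle V,T\rangle T$ is the horizontal part of a vector $V$. The (sub-Riemannian) perimeter of a Borel set $\Omega\subseteq\mathbb{H}^n$ is $$\mathcal{P}(\Omega)=\sup\Big\{\int_\Omega \operatorname{div}(V)\,dv : V \text{ a horizontal } C^1 \text{ vector field with compact support and } |V|\le 1\Big\}\in[0,\infty],$$ and $\Omega$ has finite perimeter if both its volume and $\mathcal{P}(\Omega)$ are finite. Let $\Omega\subseteq\mathbb{H}^n$ be a Borel set of finite perimeter bounded by an embedded $C^2$ hypersurface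 $\Sigma=\partial\Omega$, with $\Omega$ lying locally on one side of $\Sigma$: near every point of $\Sigma$ there is a $C^2$ function $f$ without critical points such that $\Sigma=\{f=0\}$, $\{f>0\}\subseteq\Omega$ and $\{f<0\}\cap\Omega=\emptyset$. Let $N$ be the unit normal to $\Sigma$ pointing into $\Omega$, let $da$ be the Riemannian measure of $\Sigma$, let $\Sigma_0\subseteq\Sigma$ be the singular set, that is, the set of points at which the tangent hyperplane of $\Sigma$ is the horizontal one, and let $\nu_H=N_H/|N_H|$ on $\Sigma\setminus\Sigma_0$. For $p\in\Sigma\setminus\Sigma_0$ put $(\operatorname{div}_\Sigma\nu_H)(p)=\sum_{i=1}^{2n}\langle D_{e_i}\nu_H,e_i\rangle$, where $e_1,\dots,e_{2n}$ is any orthonormal basis of $T_p\Sigma$. Let $U$ be a $C^1$ vector field with compact support on $\mathbb{H}^n$ such that the closure of $\{p\in\Sigma: U(p)\ne 0\}$ is disjoint from $\Sigma_0$. Let $\{\varphi_t\}_{t\in\mathbb{R}}$ be the flow of $U$, let $\Omega_t=\varphi_t(\Omega)$ and $\mathcal{P}(t)=\mathcal{P}(\Omega_t)$, and let $u=\langle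 U,N\rangle$. Then $\Omega_t$ has finite perimeter for all $t$ close to $0$, the function $u\,\operatorname{div}_\Sigma\nu_H$ (understood as $0$ on $\Sigma_0$, where $u=0$) is integrable on $\Sigma$ with respect to $da$, the function $\mathcal{P}(t)$ is differentiable at $t=0$, and $$\mathcal{P}'(0)=\int_\Sigma u\,(\operatorname{div}_\Sigma\nu_H)\,da .$$ -/

import Mathlib

open MeasureTheory Filter Topology
open scoped ENNReal

noncomputable section

/-- The underlying manifold `ℝ²ⁿ⁺¹` of the Heisenberg group `ℍⁿ`, a point being written
`p = (x, y, t)` with `x, y ∈ ℝⁿ` and `t ∈ ℝ` (so `z = x + i y`).  Tangent vectors at any point are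
written in the same coordinates. -/
abbrev Heis (n : ℕ) : Type := (Fin n → ℝ) × (Fin n → ℝ) × ℝ

namespace Heis

variable {n : ℕ}

/-- The left-invariant vector field `X_k = ∂/∂x_k + y_k ∂/∂t`. -/
def X (k : Fin n) (p : Heis n) : Heis n := (Pi.single k 1, 0, p.2.1 k)

/-- The left-invariant vector field `Y_k = ∂/∂y_k - x_k ∂/∂t`. -/
def Y (k : Fin n) (p : Heis n) : Heis n := (0, Pi.single k 1, -p.1 k)

/-- The left-invariant vector field `T = ∂/∂t`. -/
def T (_p : Heis n) : Heis n := (0, 0, 1)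

/-- The coordinates `(a, b, c)` of a tangent vector `v` at `p` in the frame `{X_k, Y_k, T}`. -/
def coframe (p v : Heis n) : Heis n :=
  (v.1, v.2.1, v.2.2 - ∑ k, (v.1 k * p.2.1 k - v.2.1 k * p.1 k))

/-- The tangent vector at `p` with coordinates `(a, b, c)` in the frame `{X_k, Y_k, T}`. -/
def frame (p a : Heis n) : Heis n :=
  ∑ k, a.1 k • X k p + ∑ k, a.2.1 k • Y k p + a.2.2 • T p

/-- The left-invariant Riemannian metric for which `{X_k, Y_k, T}` is orthonormal. -/
def metric (p v w : Heis n) : ℝ :=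
  ∑ k, (coframe p v).1 k * (coframe p w).1 k + ∑ k, (coframe p v).2.1 k * (coframe p w).2.1 k
    + (coframe p v).2.2 * (coframe p w).2.2

/-- The Riemannian length of a tangent vector. -/
def len (p v : Heis n) : ℝ := Real.sqrt (metric p v v)

/-- The horizontal subspace at `p`, spanned by the `X_k(p)` and `Y_k(p)`. -/
def horizontal (p : Heis n) : Submodule ℝ (Heis n) :=
  Submodule.span ℝ (Set.range (fun k => X k p) ∪ Set.range (fun k => Y k p))

/-- The projection of a tangent vector onto the horizontal subspace. -/
def horProj (p v : Heis n) : Heis n := v - metric p v (T p) • T p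

/-- `D_u X_j` for the Levi-Civita connection: `D_{X_k} X_j = 0`, `D_{Y_k} X_j = δ_{kj} T`,
`D_T X_j = Y_j`. -/
def nablaX (j : Fin n) (p u : Heis n) : Heis n :=
  (coframe p u).2.1 j • T p + (coframe p u).2.2 • Y j p

/-- `D_u Y_j` for the Levi-Civita connection: `D_{X_k} Y_j = -δ_{kj} T`, `D_{Y_k} Y_j = 0`,
`D_T Y_j = -X_j`. -/
def nablaY (j : Fin n) (p u : Heis n) : Heis n :=
  -((coframe p u).1 j • T p) - (coframe p u).2.2 • X j p

/-- `D_u T` for the Levi-Civita connection: `D_{X_k} T = Y_k`, `D_{Y_k} T = -X_k`, `D_T T = 0`. -/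
def nablaT (p u : Heis n) : Heis n :=
  ∑ k, (coframe p u).1 k • Y k p - ∑ k, (coframe p u).2.1 k • X k p

/-- The Levi-Civita covariant derivative `D_u V` at `p` of a vector field `V` along a set `S`:
the derivatives in the direction `u` of the frame coordinates of `V`, plus the derivatives of the
frame (Leibniz rule).  For `S = univ` this is the covariant derivative of a vector field on `ℍⁿ`.
If `S` is a hypersurface, `V` is differentiable along `S` and `u` is tangent to `S`, then only the
values of `V` on `S` matter and the value does not depend on the within-derivative chosen. -/
def covDeriv (S : Set (Heis n)) (V : Heis n → Heis n) (p u : Heis n) : Heis n :=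
  frame p (fderivWithin ℝ (fun q => coframe q (V q)) S p u)
    + ∑ j, (coframe p (V p)).1 j • nablaX j p u
    + ∑ j, (coframe p (V p)).2.1 j • nablaY j p u
    + (coframe p (V p)).2.2 • nablaT p u

/-- The Riemannian divergence of a vector field on `ℍⁿ`. -/
def divergence (V : Heis n → Heis n) (p : Heis n) : ℝ :=
  ∑ k, metric p (covDeriv Set.univ V p (X k p)) (X k p)
    + ∑ k, metric p (covDeriv Set.univ V p (Y k p)) (Y k p)
    + metric p (covDeriv Set.univ V p (T p)) (T p)

/-- Admissible test fields for the perimeter: horizontal `C¹` vector fields with compact support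
and length at most one. -/
def IsTestField (V : Heis n → Heis n) : Prop :=
  ContDiff ℝ 1 V ∧ HasCompactSupport V ∧ (∀ p, V p ∈ horizontal p) ∧ ∀ p, len p (V p) ≤ 1

/-- The sub-Riemannian perimeter `sup {∫_Ω div V dv}`, over all test fields `V`.  (The Riemannian
volume is Lebesgue measure.  The supremum is nonnegative because `V = 0` is a test field, so it is
taken in `[0, ∞]`.) -/
def perimeter (Ω : Set (Heis n)) : ℝ≥0∞ :=
  ⨆ (V : Heis n → Heis n) (_ : IsTestField V), ENNReal.ofReal (∫ p in Ω, divergence V p)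

/-- Borel sets of finite volume and finite perimeter. -/
def HasFinitePerimeter (Ω : Set (Heis n)) : Prop :=
  MeasurableSet Ω ∧ volume Ω ≠ ∞ ∧ perimeter Ω ≠ ∞

/-- `Ω` is bounded by an embedded `C²` hypersurface: near each of its boundary points, the boundary
is the zero set of a `C²` function without critical points which is positive inside `Ω` and
negative outside. -/
def HasC2Boundary (Ω : Set (Heis n)) : Prop :=
  ∀ p ∈ frontier Ω, ∃ W : Set (Heis n), IsOpen W ∧ p ∈ W ∧ ∃ f : Heis n → ℝ,
    ContDiffOn ℝ 2 f W ∧ (∀ q ∈ W, fderiv ℝ f q ≠ 0) ∧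
    (∀ q ∈ W, 0 < f q → q ∈ Ω) ∧ (∀ q ∈ W, f q < 0 → q ∉ Ω) ∧
    frontier Ω ∩ W = {q ∈ W | f q = 0}

/-- The tangent space of a hypersurface `S` at `p`: the velocities of the curves in `S` through
`p`. -/
def tangent (S : Set (Heis n)) (p : Heis n) : Set (Heis n) :=
  {v | ∃ γ : ℝ → Heis n, γ 0 = p ∧ (∀ᶠ s in 𝓝 0, γ s ∈ S) ∧ HasDerivAt γ v 0}

/-- The singular set of a hypersurface: the points where its tangent hyperplane is the horizontal
one. -/
def singularSet (S : Set (Heis n)) : Set (Heis n) :=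
  {p ∈ S | tangent S p = (horizontal p : Set (Heis n))}

/-- `v` is the Riemannian unit normal at `p` to the boundary of `Ω` which points into `Ω`. -/
def IsInnerUnitNormal (Ω : Set (Heis n)) (p v : Heis n) : Prop :=
  len p v = 1 ∧ (∀ w ∈ tangent (frontier Ω) p, metric p v w = 0) ∧
    ∀ᶠ s : ℝ in 𝓝[>] 0, p + s • v ∈ Ω

open Classical in
/-- The inner unit normal `N` along the boundary of `Ω`. -/
def innerNormal (Ω : Set (Heis n)) (p : Heis n) : Heis n :=
  if h : ∃ v, IsInnerUnitNormal Ω p v then h.choose else 0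

/-- The horizontal unit normal `ν_H = N_H / |N_H|` along the regular part of the boundary. -/
def horNormal (Ω : Set (Heis n)) (p : Heis n) : Heis n :=
  (len p (horProj p (innerNormal Ω p)))⁻¹ • horProj p (innerNormal Ω p)

/-- `e` is an orthonormal basis of the tangent space at `p` of the hypersurface `S`. -/
def IsTangentONB (S : Set (Heis n)) (p : Heis n) (e : Fin (2 * n) → Heis n) : Prop :=
  (∀ i j, metric p (e i) (e j) = if i = j then 1 else 0) ∧
    (Submodule.span ℝ (Set.range e) : Set (Heis n)) = tangent S p

open Classical in
/-- The Riemannian divergence relative to the hypersurface `S` of a vector field `V` along `S`: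
`∑ ⟨D_{e_i} V, e_i⟩` for an orthonormal basis `e` of the tangent space. -/
def surfaceDivergence (S : Set (Heis n)) (V : Heis n → Heis n) (p : Heis n) : ℝ :=
  if h : ∃ e, IsTangentONB S p e then
    ∑ i, metric p (covDeriv S V p (h.choose i)) (h.choose i)
  else 0

/-- `φ : B → S` is a local `C¹` parametrization of the hypersurface `S`. -/
def IsPatch (S : Set (Heis n)) (φ : (Fin (2 * n) → ℝ) → Heis n) (B : Set (Fin (2 * n) → ℝ)) :
    Prop :=
  IsOpen B ∧ ContDiffOn ℝ 1 φ B ∧ Set.InjOn φ B ∧ Set.MapsTo φ B S ∧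
    ∀ x ∈ B, Function.Injective (fderiv ℝ φ x)

/-- The Riemannian area density `√det(⟨∂_i φ, ∂_j φ⟩)` of a parametrization. -/
def areaDensity (φ : (Fin (2 * n) → ℝ) → Heis n) (x : Fin (2 * n) → ℝ) : ℝ :=
  Real.sqrt (Matrix.det (Matrix.of fun i j =>
    metric (φ x) (fderiv ℝ φ x (Pi.single i 1)) (fderiv ℝ φ x (Pi.single j 1))))

/-- The Riemannian measure `da` of the hypersurface `S`, as a measure on `ℍⁿ` concentrated on `S`.
It is glued from the measures `√det(⟨∂_i φ, ∂_j φ⟩) dx` of the parametrizations `φ : B → S`: these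
are the restrictions of `da` to the images `φ(B)`, so `da` is their least upper bound in the
lattice of measures. -/
def surfaceMeasure (S : Set (Heis n)) : Measure (Heis n) :=
  ⨆ (φ : (Fin (2 * n) → ℝ) → Heis n) (B : Set (Fin (2 * n) → ℝ)) (_ : IsPatch S φ B),
    Measure.map φ ((volume.restrict B).withDensity fun x => ENNReal.ofReal (areaDensity φ x))

open Classical in
/-- The flow `φ_t(p)` of a vector field `U`: the value at time `t` of its integral curve that starts
at `p`.  (For a `C¹` field with compact support, there is exactly one, defined for all times.) -/
def flow (U : Heis n → Heis n) (t : ℝ) (p : Heis n) : Heis n :=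
  if h : ∃ γ : ℝ → Heis n, γ 0 = p ∧ ∀ s, HasDerivAt γ (U (γ s)) s then h.choose t else p

/-! Checks: the frame is orthonormal, and the connection is the Levi-Civita one. -/

theorem metric_X_X (j k : Fin n) (p : Heis n) :
    metric p (X j p) (X k p) = if j = k then 1 else 0 := by
  simp [metric, coframe, X, Pi.single_apply, eq_comm]

theorem metric_Y_Y (j k : Fin n) (p : Heis n) :
    metric p (Y j p) (Y k p) = if j = k then 1 else 0 := by
  simp [metric, coframe, Y, Pi.single_apply, eq_comm]

theorem metric_X_Y (j k : Fin n) (p : Heis n) : metric p (X j p) (Y k p) = 0 := by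
  simp [metric, coframe, X, Y, Pi.single_apply]

theorem metric_X_T (j : Fin n) (p : Heis n) : metric p (X j p) (T p) = 0 := by
  simp [metric, coframe, X, T, Pi.single_apply]

theorem metric_Y_T (j : Fin n) (p : Heis n) : metric p (Y j p) (T p) = 0 := by
  simp [metric, coframe, Y, T, Pi.single_apply]

theorem metric_T_T (p : Heis n) : metric p (T p) (T p) = 1 := by
  simp [metric, coframe, T]

theorem coframe_frame (p a : Heis n) : coframe p (frame p a) = a := by
  ext <;> simp [coframe, frame, X, Y, T, Prod.fst_sum, Prod.snd_sum, Finset.sum_apply,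
    Pi.single_apply, Finset.sum_sub_distrib]
  ring

theorem frame_coframe (p v : Heis n) : frame p (coframe p v) = v := by
  ext <;> simp [coframe, frame, X, Y, T, Prod.fst_sum, Prod.snd_sum, Finset.sum_apply,
    Pi.single_apply, Finset.sum_sub_distrib]
  ring

theorem covDeriv_eq_frame (S : Set (Heis n)) (V : Heis n → Heis n) (p u : Heis n) :
    covDeriv S V p u = frame p (fderivWithin ℝ (fun q => coframe q (V q)) S p u +
      (fun j => -((coframe p u).2.2 * (coframe p (V p)).2.1 j)
          - (coframe p (V p)).2.2 * (coframe p u).2.1 j,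
        fun j => (coframe p u).2.2 * (coframe p (V p)).1 j
          + (coframe p (V p)).2.2 * (coframe p u).1 j,
        ∑ j, ((coframe p (V p)).1 j * (coframe p u).2.1 j
          - (coframe p (V p)).2.1 j * (coframe p u).1 j))) := by
  unfold covDeriv nablaX nablaY nablaT
  generalize fderivWithin ℝ (fun q => coframe q (V q)) S p u = d
  generalize coframe p u = c
  generalize coframe p (V p) = w
  have e : ∀ a : Heis n, frame p a =
      (a.1, a.2.1, a.2.2 + ∑ k, (a.1 k * p.2.1 k - a.2.1 k * p.1 k)) := by
    intro a
    ext <;> simp [frame, X, Y, T, Prod.fst_sum, Prod.snd_sum, Finset.sum_apply,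
      Pi.single_apply, Finset.sum_sub_distrib]
    ring
  rw [e, e]
  ext <;> simp [X, Y, T, Prod.fst_sum, Prod.snd_sum, Finset.sum_apply,
    Pi.single_apply, Finset.sum_sub_distrib, Finset.sum_add_distrib, Finset.mul_sum, mul_add,
    mul_sub, sub_mul, mul_comm, mul_left_comm]
  all_goals ring_nf

theorem fderiv_coframe (V : Heis n → Heis n) (p u : Heis n) (hV : DifferentiableAt ℝ V p) :
    DifferentiableAt ℝ (fun q => coframe q (V q)) p ∧
    fderiv ℝ (fun q => coframe q (V q)) p u =
      ((fderiv ℝ V p u).1, (fderiv ℝ V p u).2.1, (fderiv ℝ V p u).2.2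
        - ∑ k, ((fderiv ℝ V p u).1 k * p.2.1 k + (V p).1 k * u.2.1 k
          - ((fderiv ℝ V p u).2.1 k * p.1 k + (V p).2.1 k * u.1 k))) := by
  have h := hV.hasFDerivAt
  have h1 := h.fst
  have h2 := h.snd.fst
  have h3 := h.snd.snd
  have a1 : ∀ k, HasFDerivAt (fun q => (V q).1 k) _ p := fun k => (hasFDerivAt_pi'.1 h1) k
  have a2 : ∀ k, HasFDerivAt (fun q => (V q).2.1 k) _ p := fun k => (hasFDerivAt_pi'.1 h2) k
  have i0 := hasFDerivAt_id (𝕜 := ℝ) p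
  have b1 : ∀ k, HasFDerivAt (fun q : Heis n => q.1 k) _ p :=
    fun k => (hasFDerivAt_pi'.1 i0.fst) k
  have b2 : ∀ k, HasFDerivAt (fun q : Heis n => q.2.1 k) _ p :=
    fun k => (hasFDerivAt_pi'.1 i0.snd.fst) k
  have key := h1.prodMk (h2.prodMk (h3.sub (HasFDerivAt.fun_sum (u := Finset.univ)
    fun k _ => ((a1 k).mul (b2 k)).sub ((a2 k).mul (b1 k)))))
  refine ⟨key.differentiableAt, ?_⟩
  change fderiv ℝ (fun q => ((V q).1, (V q).2.1, (V q).2.2 - ∑ k, ((V q).1 k * q.2.1 k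
    - (V q).2.1 k * q.1 k))) p u = _
  erw [key.fderiv]
  ext <;> simp
  simp only [Finset.sum_add_distrib, mul_comm]
  ring

theorem metric_compatible (V W : Heis n → Heis n) (p u : Heis n)
    (hV : DifferentiableAt ℝ V p) (hW : DifferentiableAt ℝ W p) :
    fderiv ℝ (fun q => metric q (V q) (W q)) p u =
      metric p (covDeriv Set.univ V p u) (W p) + metric p (V p) (covDeriv Set.univ W p u) := by
  have hA := (fderiv_coframe V p u hV).1
  have hB := (fderiv_coframe W p u hW).1
  simp only [covDeriv_eq_frame, metric, coframe_frame, fderivWithin_univ]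
  generalize hAdef : (fun q => coframe q (V q)) = A at *
  generalize hBdef : (fun q => coframe q (W q)) = B at *
  have eA : ∀ q, coframe q (V q) = A q := fun q => congrFun hAdef q
  have eB : ∀ q, coframe q (W q) = B q := fun q => congrFun hBdef q
  simp only [eA, eB]
  have h := hA.hasFDerivAt
  have g := hB.hasFDerivAt
  have a1 : ∀ k, HasFDerivAt (fun q => (A q).1 k) _ p := fun k => (hasFDerivAt_pi'.1 h.fst) k
  have a2 : ∀ k, HasFDerivAt (fun q => (A q).2.1 k) _ p :=
    fun k => (hasFDerivAt_pi'.1 h.snd.fst) k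
  have b1 : ∀ k, HasFDerivAt (fun q => (B q).1 k) _ p := fun k => (hasFDerivAt_pi'.1 g.fst) k
  have b2 : ∀ k, HasFDerivAt (fun q => (B q).2.1 k) _ p :=
    fun k => (hasFDerivAt_pi'.1 g.snd.fst) k
  have key := ((HasFDerivAt.fun_sum (u := Finset.univ) fun k _ => (a1 k).mul (b1 k)).add
    (HasFDerivAt.fun_sum (u := Finset.univ) fun k _ => (a2 k).mul (b2 k))).add
    (h.snd.snd.mul g.snd.snd)
  erw [key.fderiv]
  simp
  simp only [Finset.sum_add_distrib, Finset.sum_sub_distrib, Finset.mul_sum,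
    Finset.sum_neg_distrib, mul_add, mul_sub, mul_neg, neg_mul, mul_comm, mul_left_comm, mul_assoc]
  ring

theorem torsion_free (V W : Heis n → Heis n) (p : Heis n)
    (hV : DifferentiableAt ℝ V p) (hW : DifferentiableAt ℝ W p) :
    covDeriv Set.univ W p (V p) - covDeriv Set.univ V p (W p) =
      VectorField.lieBracket ℝ V W p := by
  rw [← frame_coframe p (VectorField.lieBracket ℝ V W p), covDeriv_eq_frame, covDeriv_eq_frame,
    fderivWithin_univ, fderivWithin_univ, (fderiv_coframe V p _ hV).2,
    (fderiv_coframe W p _ hW).2, VectorField.lieBracket]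
  rw [← sub_eq_zero]
  have e : ∀ a b c : Heis n, frame p a - frame p b - frame p c = frame p (a - b - c) := by
    intro a b c
    ext <;> simp [frame, X, Y, T, Prod.fst_sum, Prod.snd_sum, Finset.sum_apply,
      Pi.single_apply, Finset.sum_sub_distrib, sub_mul]
    all_goals ring
  have e0 : frame p (0 : Heis n) = 0 := by simp [frame]
  rw [e, ← e0]
  congr 1
  ext <;> simp [coframe]
  · ring
  · ring
  · simp only [Finset.sum_add_distrib, Finset.sum_sub_distrib, mul_sub, mul_comm]
    ring

end Heis

end

/-!
The formula is obtained without differentiating the supremum that defines the perimeter, and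
without transporting the regularity of the boundary by the flow, which is only of class `C¹`.

**Flux through the moving boundary.**  The divergence theorem on `Ω`
(`HasC2Boundary.setIntegral_trace_fderiv`) is proved in charts: a `C²` diffeomorphism that
straightens the boundary carries a field to a field on a half-space, by the Piola transform
`V ↦ |det Dφ| (Dφ)⁻¹ (V ∘ φ)`, which multiplies divergences by the Jacobian (`trace_fderiv_piola`);
the integration measure on the boundary is computed in the same chart
(`IsChart.restrict_surfaceMeasure`).  A change of variables then gives, for the flow `φ_t` of `U`,
`∫_{φ_t(Ω)} div W = -∫_Σ ⟨pull φ_t W, N⟩ da` (`HasC2Boundary.setIntegral_image_flow`), where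
`pull φ_t W` is again a Piola transform.  Since `φ_t` is only `C¹`, this is proved by mollification
(`HasC2Boundary.setIntegral_transport`).

**Two differentiable bounds.**  The field `U` may be cut off to a neighbourhood of the closure of
`{p ∈ Σ : U p ≠ 0}` without changing `φ_t(Ω)` for small `t` (`IsFlowOf.eventually_image_eq`).  In
that neighbourhood `-ν_H` extends to a test field `V` (`HasC2Boundary.exists_extension`), and any
test field may be replaced by `V` on `supp U` without decreasing its flux out of `Ω`.  Hence
`P(φ_t(Ω))` lies between
* `P(Ω) - ∫_Σ ⟨pull φ_t V - V, N⟩ da`, and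
* `P(Ω) + ∫_{Σ ∩ supp U} (m_t - m_0) da`, where `m_t` (`maxFlux`) is the largest value of
  `|⟨pull φ_t W, N⟩|` among the horizontal fields `W` with `|W| ≤ 1`; it is the length of a vector
  of `2n` fluxes, and `m_0 = |N_H|` does not vanish on `Σ ∩ supp U`.

Both bounds are differentiable at `t = 0` (`HasC2Boundary.hasDerivAt_flux`,
`HasC2Boundary.exists_hasDerivAt_maxFlux`) and both equal `P(Ω)` there, so they have the same
derivative, which is also that of the perimeter (`hasDerivAt_of_le_of_le`,
`HasC2Boundary.hasDerivAt_perimeter`).  Only the lower bound has to be differentiated explicitly.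

**The derivative.**  It is `-∫_Σ ⟨div U • V + DV U - DU V, N⟩ da`, with Euclidean derivatives.
Because `div U • V - div V • U + DV U - DU V` is divergence-free (`trace_fderiv_bracket`), its flux
vanishes (`HasC2Boundary.integral_bracket`), and the derivative becomes `-∫_Σ div V ⟨U, N⟩ da`
(`HasC2Boundary.integral_variation`).  Finally `-div V = div_Σ ν_H` where `U ≠ 0` on `Σ`
(`HasC2Boundary.surfaceDivergence_eq`): the term `⟨D_N V, N⟩` of the divergence is zero, since `V`
is horizontal and of maximal length there, and `N_H` is parallel to `V`.
-/

noncomputable section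

/-! ### The determinant, the Piola transform and the bracket of two fields -/

section Calculus
set_option linter.unusedSectionVars false
variable {E : Type*} [NormedAddCommGroup E] [NormedSpace ℝ E] [FiniteDimensional ℝ E]

/-- The trace as a continuous linear functional on the continuous endomorphisms. -/
def traceCLM (E : Type*) [NormedAddCommGroup E] [NormedSpace ℝ E] [FiniteDimensional ℝ E] :
    (E →L[ℝ] E) →L[ℝ] ℝ :=
  LinearMap.toContinuousLinearMap (LinearMap.trace ℝ E ∘ₗ ContinuousLinearMap.coeLM ℝ)

theorem traceCLM_apply (A : E →L[ℝ] E) : traceCLM E A = LinearMap.trace ℝ E A := rfl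

theorem traceCLM_mul_comm (A B : E →L[ℝ] E) : traceCLM E (A * B) = traceCLM E (B * A) :=
  LinearMap.trace_mul_comm ℝ (A : E →ₗ[ℝ] E) (B : E →ₗ[ℝ] E)

theorem traceCLM_smulRight (l : E →L[ℝ] ℝ) (v : E) : traceCLM E (l.smulRight v) = l v :=
  LinearMap.trace_smulRight (l : E →ₗ[ℝ] ℝ) v

theorem contDiff_clm_det {k : WithTop ℕ∞} :
    ContDiff ℝ k (fun M : E →L[ℝ] E => M.det) := by
  classical
  let b := Module.finBasis ℝ E
  have h : (fun M : E →L[ℝ] E => M.det) =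
      fun M : E →L[ℝ] E => ∑ σ : Equiv.Perm (Fin (Module.finrank ℝ E)),
        ((Equiv.Perm.sign σ : ℤ) : ℝ) * ∏ i, b.coord (σ i) (M (b i)) := by
    funext M
    rw [ContinuousLinearMap.det, ← LinearMap.det_toMatrix b, Matrix.det_apply']
    simp [LinearMap.toMatrix_apply]
  rw [h]
  refine ContDiff.sum fun σ _ => ?_
  refine contDiff_const.mul (contDiff_prod fun i _ => ?_)
  exact ((LinearMap.toContinuousLinearMap (b.coord (σ i))).comp
    (ContinuousLinearMap.apply ℝ E (b i))).contDiff

theorem hasFDerivAt_clm_det_one :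
    HasFDerivAt (fun M : E →L[ℝ] E => M.det) (traceCLM E) 1 := by
  classical
  have hd : DifferentiableAt ℝ (fun M : E →L[ℝ] E => M.det) 1 :=
    (contDiff_clm_det (k := 1)).differentiable (by norm_num) 1
  have e : fderiv ℝ (fun M : E →L[ℝ] E => M.det) 1 = traceCLM E := by
    ext H
    have h1 : HasDerivAt (fun t : ℝ => (1 + t • H : E →L[ℝ] E).det)
        (fderiv ℝ (fun M : E →L[ℝ] E => M.det) 1 H) 0 := by
      have hl : HasDerivAt (fun t : ℝ => (1 + t • H : E →L[ℝ] E)) H 0 := by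
        simpa using ((hasDerivAt_id (0 : ℝ)).smul_const H).const_add (1 : E →L[ℝ] E)
      have hd' : HasFDerivAt (fun M : E →L[ℝ] E => M.det)
          (fderiv ℝ (fun M : E →L[ℝ] E => M.det) 1) (1 + (0 : ℝ) • H) := by
        simpa using hd.hasFDerivAt
      exact hd'.comp_hasDerivAt 0 hl
    let b := Module.finBasis ℝ E
    let Q := LinearMap.toMatrix b b (H : E →ₗ[ℝ] E)
    have h2 : (fun t : ℝ => (1 + t • H : E →L[ℝ] E).det) = fun t : ℝ =>
        1 + Q.trace * t + ((Matrix.det (1 + (Polynomial.X : Polynomial ℝ) •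
          Q.map Polynomial.C)).divX.divX).eval t * t ^ 2 := by
      funext t
      rw [← Matrix.det_one_add_smul, ContinuousLinearMap.det, ← LinearMap.det_toMatrix b]
      congr 1
      simp [Q, LinearMap.toMatrix_one]
    rw [h2] at h1
    have h3 := (((hasDerivAt_id (0 : ℝ)).const_mul Q.trace).const_add 1).add
      ((Polynomial.hasDerivAt ((Matrix.det (1 + (Polynomial.X : Polynomial ℝ) •
          Q.map Polynomial.C)).divX.divX) (0 : ℝ)).mul (hasDerivAt_pow 2 (0 : ℝ)))
    have h4 := h1.unique h3
    rw [h4, traceCLM_apply, LinearMap.trace_eq_matrix_trace ℝ b]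
    simp [Q]
  exact e ▸ hd.hasFDerivAt

/-- **Jacobi's formula** for the derivative of the determinant at an invertible endomorphism. -/
theorem hasFDerivAt_clm_det (A : (E →L[ℝ] E)ˣ) :
    HasFDerivAt (fun M : E →L[ℝ] E => M.det)
      ((A : E →L[ℝ] E).det • (traceCLM E).comp
        (ContinuousLinearMap.mul ℝ (E →L[ℝ] E) (↑A⁻¹ : E →L[ℝ] E))) (A : E →L[ℝ] E) := by
  have h1 : HasFDerivAt (fun M : E →L[ℝ] E => M.det) (traceCLM E)
      (ContinuousLinearMap.mul ℝ (E →L[ℝ] E) (↑A⁻¹ : E →L[ℝ] E) (A : E →L[ℝ] E)) := by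
    simpa using hasFDerivAt_clm_det_one
  have h2 := (h1.comp (A : E →L[ℝ] E)
    (ContinuousLinearMap.mul ℝ (E →L[ℝ] E) (↑A⁻¹ : E →L[ℝ] E)).hasFDerivAt).const_mul
      (A : E →L[ℝ] E).det
  refine h2.congr_of_eventuallyEq (Eventually.of_forall fun M => ?_)
  have : (M : E →L[ℝ] E) = (A : E →L[ℝ] E) * ((↑A⁻¹ : E →L[ℝ] E) * M) := by
    rw [← mul_assoc]; simp
  conv_lhs => rw [this]
  exact LinearMap.det_comp _ _

theorem det_ne_zero_of_isUnit {A : E →L[ℝ] E} (hA : IsUnit A) : A.det ≠ 0 := by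
  obtain ⟨B, hB⟩ := hA.exists_right_inv
  intro h
  have := LinearMap.det_comp (A : E →ₗ[ℝ] E) (B : E →ₗ[ℝ] E)
  have e : (A : E →ₗ[ℝ] E) ∘ₗ (B : E →ₗ[ℝ] E) = LinearMap.id := by
    ext x; exact congrArg (fun C : E →L[ℝ] E => C x) hB
  rw [e, LinearMap.det_id] at this
  change LinearMap.det (A : E →ₗ[ℝ] E) = 0 at h
  simp [h] at this

/-- The linear map `|det M| M⁻¹`, through which a vector field is pulled back as a flux (the Piola
transform). -/
def piola (M : E →L[ℝ] E) : E →L[ℝ] E := |M.det| • Ring.inverse M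

@[simp] theorem piola_one : piola (1 : E →L[ℝ] E) = 1 := by
  have : (1 : E →L[ℝ] E).det = 1 := LinearMap.det_id
  simp [piola, this]

theorem contDiffAt_piola {A : E →L[ℝ] E} (hA : IsUnit A) :
    ContDiffAt ℝ 1 (piola : (E →L[ℝ] E) → E →L[ℝ] E) A := by
  obtain ⟨u, rfl⟩ := hA
  have hdet := det_ne_zero_of_isUnit u.isUnit
  have h : ContDiffAt ℝ 1 (fun M : E →L[ℝ] E => |M.det|) (u : E →L[ℝ] E) :=
    (contDiffAt_abs hdet).comp (u : E →L[ℝ] E) contDiff_clm_det.contDiffAt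
  exact h.smul (contDiffAt_ringInverse ℝ u)

/-- The derivative of the Piola factor `|det A| A⁻¹`, in the direction `H`, is
`|det A| (tr(A⁻¹ H) A⁻¹ - A⁻¹ H A⁻¹)`. -/
theorem hasFDerivAt_piola (A : (E →L[ℝ] E)ˣ) :
    ∃ D : (E →L[ℝ] E) →L[ℝ] (E →L[ℝ] E), HasFDerivAt piola D (A : E →L[ℝ] E) ∧
      ∀ H, D H = |(A : E →L[ℝ] E).det| • (traceCLM E (↑A⁻¹ * H) • (↑A⁻¹ : E →L[ℝ] E)
        - ↑A⁻¹ * H * ↑A⁻¹) := by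
  have hdet := det_ne_zero_of_isUnit A.isUnit
  have habs : HasFDerivAt (fun M : E →L[ℝ] E => |M.det|)
      (|(A : E →L[ℝ] E).det| • (traceCLM E).comp
        (ContinuousLinearMap.mul ℝ (E →L[ℝ] E) (↑A⁻¹ : E →L[ℝ] E))) (A : E →L[ℝ] E) := by
    have h := (hasDerivAt_abs hdet).comp_hasFDerivAt _ (hasFDerivAt_clm_det A)
    rw [smul_smul, sign_mul_self] at h
    exact h
  refine ⟨_, habs.smul (hasFDerivAt_ringInverse (𝕜 := ℝ) A), fun H => ?_⟩
  ext x
  simp [smul_sub, smul_smul, mul_assoc]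
  abel

/-- The **Piola identity**: the pull-back `|det Dφ| (Dφ)⁻¹ V ∘ φ` of a vector field under a `C²` map
has divergence `|det Dφ| (div V) ∘ φ`.  The second derivatives of `φ` cancel by symmetry. -/
theorem trace_fderiv_piola {φ V : E → E} {p : E} (hφ : ContDiffAt ℝ 2 φ p)
    (hA : IsUnit (fderiv ℝ φ p)) (hV : DifferentiableAt ℝ V (φ p)) :
    traceCLM E (fderiv ℝ (fun q => piola (fderiv ℝ φ q) (V (φ q))) p) =
      |(fderiv ℝ φ p).det| * traceCLM E (fderiv ℝ V (φ p)) := by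
  obtain ⟨A, hAe⟩ := hA
  obtain ⟨D, hD, hDH⟩ := hasFDerivAt_piola A
  have h2 : HasFDerivAt (fderiv ℝ φ) (fderiv ℝ (fderiv ℝ φ) p) p :=
    ((hφ.fderiv_right (m := 1) (by norm_num)).differentiableAt (by norm_num)).hasFDerivAt
  have hsymm : IsSymmSndFDerivAt ℝ φ p := hφ.isSymmSndFDerivAt (by simp)
  have h1 : HasFDerivAt φ (fderiv ℝ φ p) p :=
    (hφ.differentiableAt (by norm_num)).hasFDerivAt
  rw [hAe] at hD
  have hP := hD.comp p h2
  have hW := hP.clm_apply (hV.hasFDerivAt.comp p h1)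
  have hW' : fderiv ℝ (fun q => piola (fderiv ℝ φ q) (V (φ q))) p = _ := hW.fderiv
  rw [hW']
  simp only [Function.comp_apply]
  rw [← hAe]
  set B : E →L[ℝ] E := (↑A⁻¹ : E →L[ℝ] E) with hB
  set S := fderiv ℝ (fderiv ℝ φ) p with hS
  set v := V (φ p) with hv
  have hinv : piola (A : E →L[ℝ] E) = |(A : E →L[ℝ] E).det| • B := by simp [piola, hB]
  have key : (piola (A : E →L[ℝ] E)).comp ((fderiv ℝ V (φ p)).comp (A : E →L[ℝ] E)) +
      (D.comp S).flip v = |(A : E →L[ℝ] E).det| • (B * (fderiv ℝ V (φ p) * (A : E →L[ℝ] E)) +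
        (((traceCLM E).comp ((ContinuousLinearMap.mul ℝ (E →L[ℝ] E) B).comp S)).smulRight (B v)
          - B * S (B v))) := by
    ext h
    have hs : S h (B v) = S (B v) h := hsymm.eq h (B v)
    simp [hinv, hDH, smul_sub, hs]
  change traceCLM E ((piola (A : E →L[ℝ] E)).comp ((fderiv ℝ V (φ p)).comp (A : E →L[ℝ] E)) +
      (D.comp S).flip v) = _
  rw [key, map_smul, map_add, map_sub, traceCLM_smulRight, traceCLM_mul_comm, mul_assoc]
  have hAB : (A : E →L[ℝ] E) * B = 1 := by simp [hB]
  simp [hAB]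

/-- The field `(div U) V - (div V) U + (DV) U - (DU) V` is the divergence of the bivector field
`V ∧ U`, so it has divergence zero. -/
theorem trace_fderiv_bracket {U V : E → E} {p : E} (hU : ContDiffAt ℝ 2 U p)
    (hV : ContDiffAt ℝ 2 V p) :
    traceCLM E (fderiv ℝ (fun q => traceCLM E (fderiv ℝ U q) • V q
      - traceCLM E (fderiv ℝ V q) • U q + fderiv ℝ V q (U q) - fderiv ℝ U q (V q)) p) = 0 := by
  have u2 : HasFDerivAt (fderiv ℝ U) (fderiv ℝ (fderiv ℝ U) p) p :=
    ((hU.fderiv_right (m := 1) (by norm_num)).differentiableAt (by norm_num)).hasFDerivAt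
  have v2 : HasFDerivAt (fderiv ℝ V) (fderiv ℝ (fderiv ℝ V) p) p :=
    ((hV.fderiv_right (m := 1) (by norm_num)).differentiableAt (by norm_num)).hasFDerivAt
  have u1 : HasFDerivAt U (fderiv ℝ U p) p := (hU.differentiableAt (by norm_num)).hasFDerivAt
  have v1 : HasFDerivAt V (fderiv ℝ V p) p := (hV.differentiableAt (by norm_num)).hasFDerivAt
  have us : IsSymmSndFDerivAt ℝ U p := hU.isSymmSndFDerivAt (by simp)
  have vs : IsSymmSndFDerivAt ℝ V p := hV.isSymmSndFDerivAt (by simp)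
  set SU := fderiv ℝ (fderiv ℝ U) p
  set SV := fderiv ℝ (fderiv ℝ V) p
  have h := ((((traceCLM E).hasFDerivAt.comp p u2).smul v1).sub
    (((traceCLM E).hasFDerivAt.comp p v2).smul u1)).add (v2.clm_apply u1) |>.sub (u2.clm_apply v1)
  have h' : fderiv ℝ (fun q => traceCLM E (fderiv ℝ U q) • V q
      - traceCLM E (fderiv ℝ V q) • U q + fderiv ℝ V q (U q) - fderiv ℝ U q (V q)) p = _ := h.fderiv
  rw [h']
  have f1 : SV.flip (U p) = SV (U p) := by ext x; exact vs.eq _ _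
  have f2 : SU.flip (V p) = SU (V p) := by ext x; exact us.eq _ _
  have c1 := traceCLM_mul_comm (fderiv ℝ V p) (fderiv ℝ U p)
  simp only [ContinuousLinearMap.mul_def] at c1
  simp [traceCLM_smulRight, f1, f2, c1]
  ring

end Calculus

/-! ### The flow of a field with compact support -/

section Flow
set_option linter.unusedSectionVars false
variable {E : Type*} [NormedAddCommGroup E] [NormedSpace ℝ E] [FiniteDimensional ℝ E]

/-- `φ` is the global flow of the vector field `U`. -/
structure IsFlowOf (U : E → E) (φ : ℝ → E → E) : Prop where
  zero : ∀ p, φ 0 p = p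
  hasDerivAt : ∀ p s, HasDerivAt (fun t => φ t p) (U (φ s p)) s

theorem IsFlowOf.neg {U : E → E} {φ : ℝ → E → E} (h : IsFlowOf U φ) :
    IsFlowOf (fun p => -U p) (fun t p => φ (-t) p) where
  zero p := by simp [h.zero]
  hasDerivAt p s := by
    simpa [Function.comp_def] using! (h.hasDerivAt p (-s)).scomp s (hasDerivAt_neg s)

theorem exists_lipschitzWith_of_hasCompactSupport {U : E → E} (hU : ContDiff ℝ 1 U)
    (hc : HasCompactSupport U) : ∃ K : NNReal, 0 < K ∧ LipschitzWith K U ∧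
      ∀ p, ‖fderiv ℝ U p‖ ≤ K := by
  obtain ⟨C, hC⟩ := (hc.fderiv ℝ).exists_bound_of_continuous (hU.continuous_fderiv one_ne_zero)
  lift C to NNReal using (norm_nonneg _).trans (hC 0)
  refine ⟨C + 1, by positivity, ?_, fun p => ?_⟩
  · refine lipschitzWith_of_nnnorm_fderiv_le (hU.differentiable one_ne_zero) fun x => ?_
    rw [← NNReal.coe_le_coe, coe_nnnorm]
    push_cast
    exact (hC x).trans (by simp)
  · push_cast
    exact (hC p).trans (by simp)

theorem IsFlowOf.add {U : E → E} {φ : ℝ → E → E} (h : IsFlowOf U φ) {K : NNReal}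
    (hK : LipschitzWith K U) (s t : ℝ) (p : E) : φ (s + t) p = φ s (φ t p) := by
  have := ODE_solution_unique_univ (v := fun _ => U) (s := fun _ => Set.univ) (K := K) (t₀ := 0)
    (f := fun s => φ (s + t) p) (g := fun s => φ s (φ t p)) (fun _ => hK.lipschitzOnWith)
    (fun s => ⟨by simpa using (h.hasDerivAt p (s + t)).comp_add_const s t, trivial⟩)
    (fun s => ⟨h.hasDerivAt _ s, trivial⟩) (by simp [h.zero])
  exact congrFun this s

theorem IsFlowOf.eq_of_eq_zero {U : E → E} {φ : ℝ → E → E} (h : IsFlowOf U φ) {K : NNReal}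
    (hK : LipschitzWith K U) {p : E} (hp : U p = 0) (t : ℝ) : φ t p = p := by
  have := ODE_solution_unique_univ (v := fun _ => U) (s := fun _ => Set.univ) (K := K) (t₀ := 0)
    (f := fun s => φ s p) (g := fun _ => p) (fun _ => hK.lipschitzOnWith)
    (fun s => ⟨h.hasDerivAt _ s, trivial⟩)
    (fun s => ⟨by simpa [hp] using hasDerivAt_const s p, trivial⟩) (by simp [h.zero])
  exact congrFun this t

theorem IsFlowOf.neg_apply_apply {U : E → E} {φ : ℝ → E → E} (h : IsFlowOf U φ) {K : NNReal}
    (hK : LipschitzWith K U) (t : ℝ) (p : E) : φ (-t) (φ t p) = p := by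
  rw [← h.add hK]; simp [h.zero]

theorem IsFlowOf.apply_neg_apply {U : E → E} {φ : ℝ → E → E} (h : IsFlowOf U φ) {K : NNReal}
    (hK : LipschitzWith K U) (t : ℝ) (p : E) : φ t (φ (-t) p) = p := by
  rw [← h.add hK]; simp [h.zero]

theorem IsFlowOf.norm_sub_le {U : E → E} {φ : ℝ → E → E} (h : IsFlowOf U φ) {C : ℝ}
    (hC : ∀ p, ‖U p‖ ≤ C) (t : ℝ) (p : E) : ‖φ t p - p‖ ≤ C * |t| := by
  have := (convex_univ).norm_image_sub_le_of_norm_hasDerivWithin_le (𝕜 := ℝ)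
    (f := fun t => φ t p) (f' := fun t => U (φ t p)) (C := C) (s := Set.univ) (x := 0) (y := t)
    (fun s _ => (h.hasDerivAt p s).hasDerivWithinAt) (fun s _ => hC _) trivial trivial
  simpa [h.zero] using this

/-- A `C¹` field with compact support is differentiable uniformly in the base point. -/
theorem exists_uniform_differentiable {U : E → E} (hU : ContDiff ℝ 1 U)
    (hc : HasCompactSupport U) {ε : ℝ} (hε : 0 < ε) : ∃ δ > 0, ∀ x k : E, ‖k‖ < δ →
      ‖U (x + k) - U x - fderiv ℝ U x k‖ ≤ ε * ‖k‖ := by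
  have huc : UniformContinuous (fderiv ℝ U) :=
    (hc.fderiv ℝ).uniformContinuous_of_continuous (hU.continuous_fderiv one_ne_zero)
  obtain ⟨δ, hδ, H⟩ := Metric.uniformContinuous_iff.1 huc ε hε
  refine ⟨δ, hδ, fun x k hk => ?_⟩
  have := (convex_ball x δ).norm_image_sub_le_of_norm_fderiv_le' (𝕜 := ℝ) (f := U)
    (φ := fderiv ℝ U x) (C := ε) (x := x) (y := x + k)
    (fun y _ => hU.differentiable one_ne_zero y)
    (fun y hy => by
      have := H (Metric.mem_ball.1 hy)
      rw [dist_eq_norm] at this; exact this.le)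
    (Metric.mem_ball_self hδ) (by simpa using hk)
  simpa using this

/-- The solution of the linearised equation `M' = DU(φ_t p) M`, `M(0) = 1`, on a short interval. -/
theorem IsFlowOf.exists_variational {U : E → E} {φ : ℝ → E → E} (h : IsFlowOf U φ)
    (hU : ContDiff ℝ 1 U) {K : NNReal} (hK : ∀ p, ‖fderiv ℝ U p‖ ≤ K) {T : ℝ} (hT : 0 ≤ T)
    (hKT : 2 * K * T ≤ 1) (p : E) : ∃ M : ℝ → E →L[ℝ] E, M 0 = 1 ∧
      ∀ t ∈ Set.Icc 0 T, HasDerivWithinAt M (fderiv ℝ U (φ t p) * M t) (Set.Icc 0 T) t := by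
  have hpl : IsPicardLindelof (fun (t : ℝ) (M : E →L[ℝ] E) => fderiv ℝ U (φ t p) * M)
      (tmin := 0) (tmax := T) ⟨0, le_rfl, hT⟩ 1 1 0 (2 * K) K := by
    refine ⟨fun t _ => ?_, fun M _ => ?_, fun t _ M hM => ?_, ?_⟩
    · refine LipschitzWith.lipschitzOnWith (LipschitzWith.of_dist_le_mul fun A B => ?_)
      rw [dist_eq_norm, dist_eq_norm, ← mul_sub]
      exact (norm_mul_le _ _).trans (by gcongr; exact hK _)
    · have : Continuous fun t => φ t p :=
        continuous_iff_continuousAt.2 fun s => (h.hasDerivAt p s).continuousAt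
      exact (((hU.continuous_fderiv one_ne_zero).comp this).mul continuous_const).continuousOn
    · have hM1 : ‖M‖ ≤ 2 := by
        have h1 : ‖M - 1‖ ≤ 1 := by simpa [dist_eq_norm] using hM
        have h2 : ‖(1 : E →L[ℝ] E)‖ ≤ 1 := ContinuousLinearMap.norm_id_le
        calc ‖M‖ = ‖(M - 1) + 1‖ := by simp
          _ ≤ ‖M - 1‖ + ‖(1 : E →L[ℝ] E)‖ := norm_add_le _ _
          _ ≤ 2 := by linarith
      calc ‖fderiv ℝ U (φ t p) * M‖ ≤ ‖fderiv ℝ U (φ t p)‖ * ‖M‖ := norm_mul_le _ _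
        _ ≤ K * 2 := by gcongr; exact hK _
        _ = ((2 * K : NNReal) : ℝ) := by push_cast; ring
    · simp [hT, hKT]
  exact hpl.exists_eq_forall_mem_Icc_hasDerivWithinAt₀

/-- The flow of a `C¹` field with compact support is, for small positive times, `C¹` in the initial
point; its derivative solves the linearised equation, by Grönwall's inequality. -/
theorem IsFlowOf.forward {U : E → E} {φ : ℝ → E → E} (h : IsFlowOf U φ)
    (hU : ContDiff ℝ 1 U) (hc : HasCompactSupport U) :
    ∃ T > 0, ∃ C ≥ 0, (∀ t ∈ Set.Icc 0 T, ContDiff ℝ 1 (φ t) ∧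
      ∀ p, ‖fderiv ℝ (φ t) p - 1‖ ≤ C * t) ∧
      ∀ p, HasDerivWithinAt (fun t => fderiv ℝ (φ t) p) (fderiv ℝ U p) (Set.Ici 0) 0 := by
  obtain ⟨K, hK0, hKL, hK⟩ := exists_lipschitzWith_of_hasCompactSupport hU hc
  have hKr : (0 : ℝ) < K := hK0
  set T : ℝ := 1 / (2 * K) with hTdef
  have hT : 0 < T := by positivity
  have hKT : 2 * K * T ≤ 1 := by rw [hTdef]; field_simp; rfl
  have hKT' : K * T ≤ 1 := by nlinarith
  choose M hM0 hM using h.exists_variational hU hK hT.le hKT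
  have hMc : ∀ p, ContinuousOn (M p) (Set.Icc 0 T) := fun p t ht => (hM p t ht).continuousWithinAt
  have hMd : ∀ p, ∀ t ∈ Set.Ico 0 T,
      HasDerivWithinAt (M p) (fderiv ℝ U (φ t p) * M p t) (Set.Ici t) t := fun p t ht =>
    (hM p t ⟨ht.1, ht.2.le⟩).mono_of_mem_nhdsWithin
      (mem_of_superset (Icc_mem_nhdsGE ht.2) (Set.Icc_subset_Icc_left ht.1))
  have hφc : ∀ p, Continuous fun t => φ t p := fun p =>
    continuous_iff_continuousAt.2 fun s => (h.hasDerivAt p s).continuousAt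
  -- all Grönwall bounds below are multiples of this constant
  set c : ℝ := Real.exp 1 with hcdef
  have hc1 : 1 ≤ c := Real.one_le_exp zero_le_one
  have hexp : ∀ t ∈ Set.Icc 0 T, Real.exp (K * t) ≤ c := fun t ht =>
    Real.exp_le_exp.2 (le_trans (by gcongr; exact ht.2) hKT')
  have hgron : ∀ ε ≥ 0, ∀ t ∈ Set.Icc 0 T, gronwallBound 0 K ε (t - 0) ≤ ε * (c / K) := by
    intro ε hε t ht
    rw [gronwallBound_of_K_ne_0 hKr.ne', sub_zero]
    simp only [zero_mul, zero_add]
    rw [div_mul_eq_mul_div, mul_div_assoc]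
    gcongr
    linarith [hexp t ht]
  have hMn : ∀ p, ∀ t ∈ Set.Icc 0 T, ‖M p t‖ ≤ c := by
    intro p t ht
    have := norm_le_gronwallBound_of_norm_deriv_right_le (δ := 1) (K := K) (ε := 0) (hMc p) (hMd p)
      (by rw [hM0]; exact ContinuousLinearMap.norm_id_le)
      (fun s _ => by
        simpa using (norm_mul_le _ _).trans (mul_le_mul_of_nonneg_right (hK _) (norm_nonneg _)))
        t ht
    rw [gronwallBound_ε0, sub_zero, one_mul] at this
    exact this.trans (hexp t ht)
  have hM1 : ∀ p, ∀ t ∈ Set.Icc 0 T, ‖M p t - 1‖ ≤ K * c * t := by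
    intro p t ht
    have := (convex_Icc (0 : ℝ) T).norm_image_sub_le_of_norm_hasDerivWithin_le
      (hM p) (C := K * c) (fun s hs => (norm_mul_le _ _).trans (by
        gcongr
        · exact hK _
        · exact hMn p s hs)) ⟨le_rfl, hT.le⟩ ht
    rw [hM0, sub_zero, Real.norm_eq_abs, abs_of_nonneg ht.1] at this
    exact this
  have hLip : ∀ p q, ∀ t ∈ Set.Icc 0 T, ‖φ t p - φ t q‖ ≤ ‖p - q‖ * c := by
    intro p q t ht
    have := dist_le_of_trajectories_ODE (v := fun _ => U) (K := K) (a := 0) (b := T)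
      (f := fun t => φ t p) (g := fun t => φ t q) (δ := ‖p - q‖) (fun _ => hKL)
      (hφc p).continuousOn (fun s _ => (h.hasDerivAt p s).hasDerivWithinAt)
      (hφc q).continuousOn (fun s _ => (h.hasDerivAt q s).hasDerivWithinAt)
      (by simp [h.zero, dist_eq_norm]) t ht
    rw [dist_eq_norm, sub_zero] at this
    exact this.trans (by gcongr; exact hexp t ht)
  have hder : ∀ t ∈ Set.Icc 0 T, ∀ p, HasFDerivAt (φ t) (M p t) p := by
    intro t ht p
    rw [hasFDerivAt_iff_isLittleO_nhds_zero, Asymptotics.isLittleO_iff]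
    intro a ha
    obtain ⟨δ, hδ, H⟩ := exists_uniform_differentiable hU hc
      (show 0 < a * K / (c * c) by positivity)
    have hev : ∀ᶠ k : E in 𝓝 0, ‖k‖ < δ / c := by
      have := Metric.ball_mem_nhds (0 : E) (show 0 < δ / c by positivity)
      filter_upwards [this] with k hk
      simpa using hk
    filter_upwards [hev] with k hk
    have hMk : ∀ s ∈ Set.Icc 0 T, ‖M p s k‖ ≤ c * ‖k‖ := fun s hs =>
      (ContinuousLinearMap.le_opNorm _ _).trans (by gcongr; exact hMn p s hs)
    have hr := norm_le_gronwallBound_of_norm_deriv_right_le (a := 0) (b := T) (δ := 0) (K := K)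
      (ε := a * K / c * ‖k‖)
      (f := fun s => φ s (p + k) - φ s p - M p s k)
      (f' := fun s => U (φ s (p + k)) - U (φ s p) - fderiv ℝ U (φ s p) (M p s k))
      (((hφc _).continuousOn.sub (hφc _).continuousOn).sub
        ((hMc p).clm_apply continuousOn_const))
      (fun s hs => (((h.hasDerivAt _ s).hasDerivWithinAt.sub
        (h.hasDerivAt _ s).hasDerivWithinAt).sub (by
          simpa using (hMd p s hs).clm_apply (hasDerivWithinAt_const s _ k))))
      (by simp [h.zero, hM0])
      (fun s hs => by
        have hs' : s ∈ Set.Icc 0 T := ⟨hs.1, hs.2.le⟩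
        have h1 : ‖U (φ s (p + k)) - U (φ s p + M p s k)‖ ≤
            K * ‖φ s (p + k) - φ s p - M p s k‖ := by
          have := hKL.dist_le_mul (φ s (p + k)) (φ s p + M p s k)
          rwa [dist_eq_norm, dist_eq_norm, ← sub_sub] at this
        have h2 : ‖U (φ s p + M p s k) - U (φ s p) - fderiv ℝ U (φ s p) (M p s k)‖ ≤
            a * K / c * ‖k‖ := by
          refine (H (φ s p) (M p s k) ?_).trans ?_
          · calc ‖M p s k‖ ≤ c * ‖k‖ := hMk s hs'
              _ < c * (δ / c) := by gcongr
              _ = δ := by field_simp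
          · calc a * K / (c * c) * ‖M p s k‖ ≤ a * K / (c * c) * (c * ‖k‖) := by
                  gcongr; exact hMk s hs'
              _ = _ := by field_simp
        calc _ = ‖(U (φ s (p + k)) - U (φ s p + M p s k)) +
              (U (φ s p + M p s k) - U (φ s p) - fderiv ℝ U (φ s p) (M p s k))‖ := by
                congr 1; abel
          _ ≤ _ := (norm_add_le _ _).trans (add_le_add h1 h2)) t ht
    refine hr.trans ((hgron _ (by positivity) t ht).trans (le_of_eq ?_))
    field_simp
  have hfd : ∀ t ∈ Set.Icc 0 T, ∀ p, fderiv ℝ (φ t) p = M p t := fun t ht p =>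
    (hder t ht p).fderiv
  have hcont : ∀ t ∈ Set.Icc 0 T, Continuous fun p => M p t := by
    intro t ht
    rw [Metric.continuous_iff]
    intro p ε hε
    have huc : UniformContinuous (fderiv ℝ U) :=
      (hc.fderiv ℝ).uniformContinuous_of_continuous (hU.continuous_fderiv one_ne_zero)
    obtain ⟨δ, hδ, H⟩ := Metric.uniformContinuous_iff.1 huc (ε * K / (2 * c * c)) (by positivity)
    refine ⟨δ / c, by positivity, fun q hq => ?_⟩
    have hr := norm_le_gronwallBound_of_norm_deriv_right_le (a := 0) (b := T) (δ := 0) (K := K)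
      (ε := ε * K / (2 * c))
      (f := fun s => M q s - M p s)
      (f' := fun s => fderiv ℝ U (φ s q) * M q s - fderiv ℝ U (φ s p) * M p s)
      ((hMc q).sub (hMc p)) (fun s hs => (hMd q s hs).sub (hMd p s hs))
      (by simp [hM0])
      (fun s hs => by
        have hs' : s ∈ Set.Icc 0 T := ⟨hs.1, hs.2.le⟩
        have h2 : ‖fderiv ℝ U (φ s q) - fderiv ℝ U (φ s p)‖ ≤ ε * K / (2 * c * c) := by
          rw [← dist_eq_norm]
          refine (H ?_).le
          rw [dist_eq_norm]
          refine (hLip q p s hs').trans_lt ?_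
          rw [dist_eq_norm] at hq
          calc ‖q - p‖ * c < δ / c * c := by gcongr
            _ = δ := by field_simp
        calc _ = ‖fderiv ℝ U (φ s q) * (M q s - M p s) +
              (fderiv ℝ U (φ s q) - fderiv ℝ U (φ s p)) * M p s‖ := by
                rw [mul_sub, sub_mul]; congr 1; abel
          _ ≤ K * ‖M q s - M p s‖ + ε * K / (2 * c * c) * c := by
                refine (norm_add_le _ _).trans (add_le_add ?_ ?_)
                · exact (norm_mul_le _ _).trans (by gcongr; exact hK _)
                · exact (norm_mul_le _ _).trans (by gcongr; exact hMn p s hs')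
          _ = _ := by congr 1; field_simp) t ht
    rw [dist_eq_norm]
    refine lt_of_le_of_lt (hr.trans (hgron _ (by positivity) t ht)) ?_
    have : ε * K / (2 * c) * (c / K) = ε / 2 := by field_simp
    rw [this]; linarith
  refine ⟨T, hT, K * c, by positivity, fun t ht => ⟨?_, fun p => ?_⟩, fun p => ?_⟩
  · rw [contDiff_one_iff_fderiv]
    refine ⟨fun p => (hder t ht p).differentiableAt, ?_⟩
    simpa [funext (hfd t ht)] using hcont t ht
  · rw [hfd t ht]; exact hM1 p t ht
  · have h0 : (0 : ℝ) ∈ Set.Icc 0 T := ⟨le_rfl, hT.le⟩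
    have h1 := hMd p 0 ⟨le_rfl, hT⟩
    rw [hM0, h.zero, mul_one] at h1
    refine h1.congr_of_eventuallyEq ?_ (hfd 0 h0 p)
    filter_upwards [Icc_mem_nhdsGE hT] with t ht using hfd t ht p

/-- For small times of either sign, the flow is `C¹` in the initial point, with a derivative that
differs from the identity by `O(t)` uniformly and is differentiable in time at `0`. -/
theorem IsFlowOf.contDiff_small {U : E → E} {φ : ℝ → E → E} (h : IsFlowOf U φ)
    (hU : ContDiff ℝ 1 U) (hc : HasCompactSupport U) :
    ∃ T > 0, ∃ C ≥ 0, (∀ t, |t| ≤ T → ContDiff ℝ 1 (φ t) ∧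
      ∀ p, ‖fderiv ℝ (φ t) p - 1‖ ≤ C * |t|) ∧
      ∀ p, HasDerivAt (fun t => fderiv ℝ (φ t) p) (fderiv ℝ U p) 0 := by
  obtain ⟨T₁, hT₁, C₁, hC₁, h1, d1⟩ := h.forward hU hc
  obtain ⟨T₂, hT₂, C₂, hC₂, h2, d2⟩ := h.neg.forward hU.neg (by simpa using! hc.neg)
  refine ⟨min T₁ T₂, lt_min hT₁ hT₂, max C₁ C₂, le_max_of_le_left hC₁, fun t ht => ?_, fun p => ?_⟩
  · rcases le_total 0 t with h0 | h0
    · rw [abs_of_nonneg h0] at ht ⊢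
      obtain ⟨a, b⟩ := h1 t ⟨h0, ht.trans (min_le_left _ _)⟩
      exact ⟨a, fun p => (b p).trans (by gcongr; exact le_max_left _ _)⟩
    · rw [abs_of_nonpos h0] at ht ⊢
      obtain ⟨a, b⟩ := h2 (-t) ⟨by linarith, ht.trans (min_le_right _ _)⟩
      simp only [neg_neg] at a b
      exact ⟨a, fun p => (b p).trans (mul_le_mul_of_nonneg_right (le_max_right _ _) (by linarith))⟩
  · have d2' : HasDerivWithinAt (fun t => fderiv ℝ (φ t) p) (fderiv ℝ U p) (Set.Iic 0) 0 := by
      have hd := d2 p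
      have e : fderiv ℝ (fun p => -U p) p = -fderiv ℝ U p := fderiv_fun_neg
      rw [e] at hd
      have hd' : HasDerivWithinAt (fun t => fderiv ℝ (fun p => φ (-t) p) p) (-fderiv ℝ U p)
        (Set.Ici 0) (-0) := by simpa using hd
      have := hd'.scomp (0 : ℝ) (h := fun t => -t) (h' := -1) (s := Set.Iic 0)
        (hasDerivAt_neg (0 : ℝ)).hasDerivWithinAt
        (fun t ht => by simpa using ht)
      simpa [Function.comp_def] using! this
    have := d2'.union (d1 p)
    rwa [Set.Iic_union_Ici, hasDerivWithinAt_univ] at this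

/-- A bounded Lipschitz field has integral curves defined for all times: the local ones exist on
intervals of any length, and are glued by uniqueness. -/
theorem exists_integralCurve {U : E → E} (hU : ContDiff ℝ 1 U) (hc : HasCompactSupport U) (p : E) :
    ∃ γ : ℝ → E, γ 0 = p ∧ ∀ s, HasDerivAt γ (U (γ s)) s := by
  obtain ⟨K, -, hKL, -⟩ := exists_lipschitzWith_of_hasCompactSupport hU hc
  obtain ⟨C, hC⟩ := hc.exists_bound_of_continuous hU.continuous
  lift C to NNReal using (norm_nonneg _).trans (hC 0)
  have key : ∀ T : ℝ, 0 < T → ∃ α : ℝ → E, α 0 = p ∧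
      ∀ t ∈ Set.Ioo (-T) T, HasDerivAt α (U (α t)) t := by
    intro T hT
    lift T to NNReal using hT.le
    have hpl : IsPicardLindelof (fun (_ : ℝ) => U) (tmin := -T) (tmax := T)
        ⟨0, by linarith, hT.le⟩ p (C * T) 0 C K :=
      IsPicardLindelof.of_time_independent (fun x _ => hC x) hKL.lipschitzOnWith (by simp)
    obtain ⟨α, h0, h1⟩ := hpl.exists_eq_forall_mem_Icc_hasDerivWithinAt₀
    exact ⟨α, h0, fun t ht => (h1 t ⟨ht.1.le, ht.2.le⟩).hasDerivAt (Icc_mem_nhds ht.1 ht.2)⟩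
  choose! α h0 h1 using key
  have huniq : ∀ T S : ℝ, 0 < T → T ≤ S → Set.EqOn (α T) (α S) (Set.Ioo (-T) T) := by
    intro T S hT hTS
    exact ODE_solution_unique_of_mem_Ioo (v := fun _ => U) (s := fun _ => Set.univ) (K := K)
      (t₀ := 0) (fun _ _ => hKL.lipschitzOnWith) ⟨by linarith, hT⟩
      (fun t ht => ⟨h1 T hT t ht, trivial⟩)
      (fun t ht => ⟨h1 S (hT.trans_le hTS) t ⟨by linarith [ht.1], by linarith [ht.2]⟩, trivial⟩)
      (by rw [h0 T hT, h0 S (hT.trans_le hTS)])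
  refine ⟨fun t => α (|t| + 1) t, by simp [h0], fun s => ?_⟩
  have hs : s ∈ Set.Ioo (-(|s| + 1)) (|s| + 1) := by
    constructor <;> linarith [neg_abs_le s, le_abs_self s]
  refine (h1 (|s| + 1) (by positivity) s hs).congr_of_eventuallyEq ?_
  filter_upwards [Ioo_mem_nhds hs.1 hs.2] with t ht
  have ht' : |t| < |s| + 1 := abs_lt.2 ht
  have ht2 : t ∈ Set.Ioo (-(|t| + 1)) (|t| + 1) := by
    constructor <;> linarith [neg_abs_le t, le_abs_self t]
  rcases le_total (|t| + 1) (|s| + 1) with hle | hle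
  · exact huniq _ _ (by positivity) hle ht2
  · exact (huniq _ _ (by positivity) hle ht).symm

end Flow

theorem Heis.isFlowOf_flow {n : ℕ} {U : Heis n → Heis n} (hU : ContDiff ℝ 1 U)
    (hc : HasCompactSupport U) : IsFlowOf U (Heis.flow U) where
  zero p := by
    have h := exists_integralCurve hU hc p
    simp only [Heis.flow, h, dif_pos]
    exact h.choose_spec.1
  hasDerivAt p s := by
    have h := exists_integralCurve hU hc p
    simp only [Heis.flow, h, dif_pos]
    exact h.choose_spec.2 s

namespace Heis
variable {n : ℕ}

/-! ### Linear algebra of the metric and the frame -/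

theorem coframe_add (p v w : Heis n) : coframe p (v + w) = coframe p v + coframe p w := by
  ext <;> simp [coframe, add_mul, Finset.sum_add_distrib, Finset.sum_sub_distrib]
  ring

theorem coframe_smul (p : Heis n) (c : ℝ) (v : Heis n) : coframe p (c • v) = c • coframe p v := by
  ext <;> simp [coframe, mul_sub, Finset.mul_sum, mul_assoc]

theorem frame_eq (p a : Heis n) :
    frame p a = (a.1, a.2.1, a.2.2 + ∑ k, (a.1 k * p.2.1 k - a.2.1 k * p.1 k)) := by
  ext <;> simp [frame, X, Y, T, Prod.fst_sum, Prod.snd_sum, Finset.sum_apply,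
    Pi.single_apply, Finset.sum_sub_distrib]
  ring

/-- The isomorphism given by the coordinates in the frame `{X_k, Y_k, T}` at `p`. -/
def coframeEquiv (p : Heis n) : Heis n ≃ₗ[ℝ] Heis n where
  toFun := coframe p
  invFun := frame p
  map_add' := coframe_add p
  map_smul' := coframe_smul p
  left_inv := frame_coframe p
  right_inv := coframe_frame p

/-- The standard basis of the vector space `ℝ²ⁿ⁺¹` underlying the Heisenberg group. -/
def stdBasis (n : ℕ) : Module.Basis (Fin n ⊕ Fin n ⊕ Unit) ℝ (Heis n) :=
  (Pi.basisFun ℝ (Fin n)).prod ((Pi.basisFun ℝ (Fin n)).prod (Module.Basis.singleton Unit ℝ))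

/-- The frame coordinates at `p`, as an isomorphism onto a Euclidean space: an isometry for the
Riemannian metric. -/
def toEuclid (p : Heis n) : Heis n ≃ₗ[ℝ] EuclideanSpace ℝ (Fin n ⊕ Fin n ⊕ Unit) :=
  coframeEquiv p ≪≫ₗ (stdBasis n).equivFun ≪≫ₗ (WithLp.linearEquiv 2 ℝ _).symm

theorem stdBasis_repr (v : Heis n) (i : Fin n ⊕ Fin n ⊕ Unit) :
    (stdBasis n).repr v i = Sum.elim v.1 (Sum.elim v.2.1 fun _ => v.2.2) i := by
  rcases i with i | i | i <;> simp [stdBasis]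

theorem inner_toEuclid (p v w : Heis n) :
    inner ℝ (toEuclid p v) (toEuclid p w) = metric p v w := by
  simp [toEuclid, PiLp.inner_apply, Fintype.sum_sum_type, stdBasis_repr, metric, coframeEquiv,
    mul_comm]
  ring

theorem metric_comm (p v w : Heis n) : metric p v w = metric p w v := by
  rw [← inner_toEuclid, ← inner_toEuclid, real_inner_comm]

theorem len_eq_norm (p v : Heis n) : len p v = ‖toEuclid p v‖ := by
  rw [len, ← inner_toEuclid, real_inner_self_eq_norm_sq, Real.sqrt_sq (norm_nonneg _)]

theorem len_nonneg (p v : Heis n) : 0 ≤ len p v := Real.sqrt_nonneg _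

theorem metric_self (p v : Heis n) : metric p v v = len p v ^ 2 := by
  rw [← inner_toEuclid, real_inner_self_eq_norm_sq, len_eq_norm]

theorem abs_metric_le (p v w : Heis n) : |metric p v w| ≤ len p v * len p w := by
  rw [← inner_toEuclid, len_eq_norm, len_eq_norm]; exact abs_real_inner_le_norm _ _

theorem metric_add_left (p v w x : Heis n) :
    metric p (v + w) x = metric p v x + metric p w x := by
  simp only [← inner_toEuclid, map_add, inner_add_left]

theorem metric_sub_left (p v w x : Heis n) :
    metric p (v - w) x = metric p v x - metric p w x := by
  simp only [← inner_toEuclid, map_sub, inner_sub_left]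

theorem metric_neg_left (p v x : Heis n) : metric p (-v) x = -metric p v x := by
  simp only [← inner_toEuclid, map_neg, inner_neg_left]

theorem metric_smul_left (p : Heis n) (c : ℝ) (v x : Heis n) :
    metric p (c • v) x = c * metric p v x := by
  simp only [← inner_toEuclid, map_smul, real_inner_smul_left]

theorem metric_smul_right (p : Heis n) (c : ℝ) (v x : Heis n) :
    metric p x (c • v) = c * metric p x v := by
  rw [metric_comm, metric_smul_left, metric_comm]

theorem metric_sum_left {ι : Type*} (s : Finset ι) (p : Heis n) (v : ι → Heis n) (x : Heis n) :
    metric p (∑ i ∈ s, v i) x = ∑ i ∈ s, metric p (v i) x := by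
  simp only [← inner_toEuclid, map_sum, sum_inner]

theorem metric_zero_left (p x : Heis n) : metric p 0 x = 0 := by
  rw [← inner_toEuclid, map_zero, inner_zero_left]

theorem len_smul (p : Heis n) (c : ℝ) (v : Heis n) : len p (c • v) = |c| * len p v := by
  rw [len_eq_norm, len_eq_norm, map_smul, norm_smul, Real.norm_eq_abs]

theorem len_add_le (p v w : Heis n) : len p (v + w) ≤ len p v + len p w := by
  simp only [len_eq_norm, map_add]; exact norm_add_le _ _

theorem len_sum_le {ι : Type*} (s : Finset ι) (p : Heis n) (v : ι → Heis n) :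
    len p (∑ i ∈ s, v i) ≤ ∑ i ∈ s, len p (v i) := by
  simp only [len_eq_norm, map_sum]; exact norm_sum_le _ _

theorem len_eq_zero_iff {p v : Heis n} : len p v = 0 ↔ v = 0 := by
  rw [len_eq_norm, norm_eq_zero, map_eq_zero_iff _ (toEuclid p).injective]

theorem contDiff_metric {k : WithTop ℕ∞} :
    ContDiff ℝ k fun x : Heis n × Heis n × Heis n => metric x.1 x.2.1 x.2.2 := by
  unfold metric coframe
  fun_prop

theorem contDiff_frame {k : WithTop ℕ∞} :
    ContDiff ℝ k fun x : Heis n × Heis n => frame x.1 x.2 := by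
  simp only [frame_eq]
  fun_prop

theorem contDiff_X {k : WithTop ℕ∞} (j : Fin n) : ContDiff ℝ k (X j : Heis n → Heis n) := by
  unfold X
  fun_prop

theorem contDiff_Y {k : WithTop ℕ∞} (j : Fin n) : ContDiff ℝ k (Y j : Heis n → Heis n) := by
  unfold Y
  fun_prop

theorem metric_X (p v : Heis n) (k : Fin n) : metric p v (X k p) = (coframe p v).1 k := by
  simp [metric, coframe, X, Pi.single_apply]

theorem metric_Y (p v : Heis n) (k : Fin n) : metric p v (Y k p) = (coframe p v).2.1 k := by
  simp [metric, coframe, Y, Pi.single_apply]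

theorem metric_T (p v : Heis n) : metric p v (T p) = (coframe p v).2.2 := by
  simp [metric, coframe, T]

theorem mem_horizontal_iff {p v : Heis n} : v ∈ horizontal p ↔ (coframe p v).2.2 = 0 := by
  constructor
  · intro h
    refine Submodule.span_induction (p := fun v _ => (coframe p v).2.2 = 0) ?_ ?_ ?_ ?_ h
    · rintro x (⟨k, rfl⟩ | ⟨k, rfl⟩)
      · rw [← metric_T, metric_X_T]
      · rw [← metric_T, metric_Y_T]
    · simp [coframe]
    · intro x y _ _ hx hy; simp [coframe_add, hx, hy]
    · intro a x _ hx; simp [coframe_smul, hx]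
  · intro h
    rw [← frame_coframe p v, frame, h, zero_smul, add_zero]
    refine Submodule.add_mem _ (Submodule.sum_mem _ fun k _ => ?_)
      (Submodule.sum_mem _ fun k _ => ?_)
    · exact Submodule.smul_mem _ _ (Submodule.subset_span (Or.inl ⟨k, rfl⟩))
    · exact Submodule.smul_mem _ _ (Submodule.subset_span (Or.inr ⟨k, rfl⟩))

theorem coframe_horProj (p v : Heis n) :
    coframe p (horProj p v) = ((coframe p v).1, (coframe p v).2.1, 0) := by
  rw [horProj, sub_eq_add_neg, ← neg_smul, coframe_add, coframe_smul, metric_T]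
  ext <;> simp [coframe, T]

theorem horProj_mem (p v : Heis n) : horProj p v ∈ horizontal p := by
  rw [mem_horizontal_iff, coframe_horProj]

theorem metric_horizontal_left {p v : Heis n} (hv : v ∈ horizontal p) (w : Heis n) :
    metric p v w = metric p v (horProj p w) := by
  rw [mem_horizontal_iff] at hv
  simp [metric, coframe_horProj, hv]

theorem len_horProj_sq (p v : Heis n) : len p (horProj p v) ^ 2 =
    ∑ k, metric p (X k p) v ^ 2 + ∑ k, metric p (Y k p) v ^ 2 := by
  rw [← metric_self, metric]
  simp_rw [metric_comm p (X _ p), metric_comm p (Y _ p), metric_X, metric_Y]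
  simp [coframe_horProj, sq]

/-- The trace of an endomorphism is computed in any orthonormal basis. -/
theorem trace_eq_sum_metric {ι : Type*} [Fintype ι] [DecidableEq ι]
    (A : Heis n →ₗ[ℝ] Heis n) (p : Heis n) (e : ι → Heis n)
    (he : ∀ i j, metric p (e i) (e j) = if i = j then 1 else 0)
    (hcard : Fintype.card ι = 2 * n + 1) :
    LinearMap.trace ℝ (Heis n) A = ∑ i, metric p (A (e i)) (e i) := by
  have hon : Orthonormal ℝ fun i => toEuclid p (e i) := by
    rw [orthonormal_iff_ite]
    intro i j
    rw [inner_toEuclid, he]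
  have hfr : Fintype.card ι = Module.finrank ℝ (EuclideanSpace ℝ (Fin n ⊕ Fin n ⊕ Unit)) := by
    simp [hcard]; ring
  let b : OrthonormalBasis ι ℝ (EuclideanSpace ℝ (Fin n ⊕ Fin n ⊕ Unit)) :=
    OrthonormalBasis.mk hon (by
      rw [hon.linearIndependent.span_eq_top_of_card_eq_finrank' hfr])
  rw [← LinearMap.trace_conj' A (toEuclid p), LinearMap.trace_eq_sum_inner _ b]
  refine Finset.sum_congr rfl fun i _ => ?_
  have hb : b i = toEuclid p (e i) := by simp [b]
  rw [hb, LinearEquiv.conj_apply_apply, LinearEquiv.symm_apply_apply, inner_toEuclid, metric_comm]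

theorem frame_add (p a b : Heis n) : frame p (a + b) = frame p a + frame p b :=
  (coframeEquiv p).symm.map_add a b

theorem frame_smul (p : Heis n) (c : ℝ) (a : Heis n) : frame p (c • a) = c • frame p a :=
  (coframeEquiv p).symm.map_smul c a

/-- The covariant derivative of a vector field, as a linear map in the direction. -/
def covDerivLin (S : Set (Heis n)) (V : Heis n → Heis n) (p : Heis n) : Heis n →ₗ[ℝ] Heis n where
  toFun u := covDeriv S V p u
  map_add' u v := by
    rw [covDeriv_eq_frame, covDeriv_eq_frame, covDeriv_eq_frame, ← frame_add]
    congr 1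
    rw [map_add, add_add_add_comm]
    congr 1
    simp only [coframe_add]
    ext <;> simp [mul_add, add_mul, Finset.sum_add_distrib] <;> ring
  map_smul' c u := by
    rw [RingHom.id_apply, covDeriv_eq_frame, covDeriv_eq_frame, ← frame_smul]
    congr 1
    rw [map_smul, smul_add]
    congr 1
    simp only [coframe_smul]
    ext <;> simp [mul_sub, mul_add, Finset.mul_sum, mul_left_comm, mul_assoc]

/-- The Riemannian divergence is the Euclidean one. -/
theorem divergence_eq_trace {V : Heis n → Heis n} {p : Heis n} (hV : DifferentiableAt ℝ V p) :
    divergence V p = traceCLM (Heis n) (fderiv ℝ V p) := by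
  set A := fderiv ℝ V p with hA
  have hX : ∀ k, X k p = stdBasis n (Sum.inl k) + p.2.1 k • stdBasis n (Sum.inr (Sum.inr ())) := by
    intro k; ext <;> simp [X, stdBasis]
  have hY : ∀ k, Y k p = stdBasis n (Sum.inr (Sum.inl k))
      + (-p.1 k) • stdBasis n (Sum.inr (Sum.inr ())) := by
    intro k; ext <;> simp [Y, stdBasis]
  have hT : T p = stdBasis n (Sum.inr (Sum.inr ())) := by
    ext <;> simp [T, stdBasis]
  rw [traceCLM_apply, LinearMap.trace_eq_matrix_trace ℝ (stdBasis n), Matrix.trace,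
    Fintype.sum_sum_type, Fintype.sum_sum_type]
  simp only [Matrix.diag_apply, LinearMap.toMatrix_apply, stdBasis_repr, Sum.elim_inl,
    Sum.elim_inr, ContinuousLinearMap.coe_coe, Finset.univ_unique, Finset.sum_singleton]
  simp only [divergence, metric_X, metric_Y, metric_T, covDeriv_eq_frame, coframe_frame,
    fderivWithin_univ, (fderiv_coframe V p _ hV).2, ← hA]
  have cX : ∀ k, coframe p (X k p) = (Pi.single k 1, 0, 0) := by
    intro k; ext <;> simp [coframe, X, Pi.single_apply]
  have cY : ∀ k, coframe p (Y k p) = (0, Pi.single k 1, 0) := by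
    intro k; ext <;> simp [coframe, Y, Pi.single_apply]
  have cT : coframe p (T p) = (0, 0, 1) := by
    ext <;> simp [coframe, T]
  simp only [cX, cY, cT]
  simp only [hX, hY, map_add, map_smul, ← hT]
  simp [T, Finset.sum_add_distrib, Finset.sum_sub_distrib]
  simp only [mul_comm]
  ring

/-! ### Volume in linear coordinates -/

/-- The standard basis of `ℝ × ℝ²ⁿ`. -/
def prodBasis (n : ℕ) : Module.Basis (Unit ⊕ Fin (2 * n)) ℝ (ℝ × (Fin (2 * n) → ℝ)) :=
  (Module.Basis.singleton Unit ℝ).prod (Pi.basisFun ℝ (Fin (2 * n)))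

/-- The standard basis of `ℍⁿ`, indexed in the same way as the one of `ℝ × ℝ²ⁿ`. -/
def stdBasis' (n : ℕ) : Module.Basis (Unit ⊕ Fin (2 * n)) ℝ (Heis n) :=
  (stdBasis n).reindex (Fintype.equivOfCardEq (by simp; ring))

theorem basisSingleton_addHaar : (Module.Basis.singleton Unit ℝ).addHaar = volume := by
  have := (OrthonormalBasis.singleton Unit ℝ).addHaar_eq_volume
  rwa [OrthonormalBasis.toBasis_singleton] at this

theorem basisFun_addHaar (ι : Type*) [Fintype ι] : (Pi.basisFun ℝ ι).addHaar = volume := by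
  rw [Module.Basis.addHaar_def, Module.Basis.parallelepiped_basisFun, addHaarMeasure_eq_volume_pi]

theorem prodBasis_addHaar : (prodBasis n).addHaar = volume := by
  rw [prodBasis, Module.Basis.prod_addHaar, Measure.volume_eq_prod,
    basisSingleton_addHaar, basisFun_addHaar]

theorem stdBasis'_addHaar : (stdBasis' n).addHaar = volume := by
  rw [stdBasis', Module.Basis.addHaar_reindex, stdBasis, Module.Basis.prod_addHaar,
    Module.Basis.prod_addHaar, Measure.volume_eq_prod, Measure.volume_eq_prod,
    basisSingleton_addHaar, basisFun_addHaar]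

instance : (volume : Measure (Heis n)).IsAddHaarMeasure := by
  rw [← stdBasis'_addHaar]
  infer_instance

/-- The factor by which a linear map `ℝ × ℝ²ⁿ → ℍⁿ` scales volume. -/
def volScale (L : (ℝ × (Fin (2 * n) → ℝ)) →ₗ[ℝ] Heis n) : ℝ :=
  |(LinearMap.toMatrix (prodBasis n) (stdBasis' n) L).det|

theorem volScale_comp (A : Heis n →ₗ[ℝ] Heis n) (L : (ℝ × (Fin (2 * n) → ℝ)) →ₗ[ℝ] Heis n) :
    volScale (A ∘ₗ L) = |LinearMap.det A| * volScale L := by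
  rw [volScale, LinearMap.toMatrix_comp (prodBasis n) (stdBasis' n) (stdBasis' n), Matrix.det_mul,
    LinearMap.det_toMatrix, abs_mul, volScale]

theorem det_coframeEquiv (p : Heis n) :
    LinearMap.det (coframeEquiv p : Heis n →ₗ[ℝ] Heis n) = 1 := by
  let l : Module.Dual ℝ (Heis n) := -∑ k, (p.2.1 k • (LinearMap.proj k ∘ₗ LinearMap.fst ℝ _ _)
    - p.1 k • (LinearMap.proj k ∘ₗ LinearMap.fst ℝ _ _ ∘ₗ LinearMap.snd ℝ _ _))
  have : (coframeEquiv p : Heis n →ₗ[ℝ] Heis n) = LinearMap.transvection l (T p) := by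
    apply LinearMap.ext
    intro v
    ext <;> simp [coframeEquiv, coframe, LinearMap.transvection, T, l, mul_comm]
    ring
  rw [this, LinearMap.transvection.det]
  simp [l, T]

/-- The Gram determinant of the columns of a linear map `ℝ × ℝ²ⁿ → ℍⁿ` is the square of its
determinant, because the change to the orthonormal frame is unimodular. -/
theorem det_gram (p : Heis n) (B : (ℝ × (Fin (2 * n) → ℝ)) →ₗ[ℝ] Heis n) :
    (Matrix.of fun i j => metric p (B (prodBasis n i)) (B (prodBasis n j))).det =
      volScale B ^ 2 := by
  set M := LinearMap.toMatrix (prodBasis n) (stdBasis' n)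
    ((coframeEquiv p : Heis n →ₗ[ℝ] Heis n) ∘ₗ B) with hM
  have h1 : (Matrix.of fun i j => metric p (B (prodBasis n i)) (B (prodBasis n j))) =
      M.transpose * M := by
    ext i j
    rw [Matrix.of_apply, ← inner_toEuclid, Matrix.mul_apply, PiLp.inner_apply,
      ← (Fintype.equivOfCardEq (by simp; ring) :
        (Fin n ⊕ Fin n ⊕ Unit) ≃ (Unit ⊕ Fin (2 * n))).sum_comp]
    refine Finset.sum_congr rfl fun k _ => ?_
    simp [toEuclid, hM, LinearMap.toMatrix_apply, stdBasis', mul_comm]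
  have h2 := volScale_comp (coframeEquiv p : Heis n →ₗ[ℝ] Heis n) B
  rw [det_coframeEquiv, abs_one, one_mul] at h2
  rw [h1, Matrix.det_mul, Matrix.det_transpose, ← h2, volScale, sq_abs, sq]

theorem volScale_ne_zero (L : (ℝ × (Fin (2 * n) → ℝ)) ≃ₗ[ℝ] Heis n) :
    volScale (L : (ℝ × (Fin (2 * n) → ℝ)) →ₗ[ℝ] Heis n) ≠ 0 := by
  rw [volScale, abs_ne_zero]
  exact (LinearEquiv.isUnit_det L (prodBasis n) (stdBasis' n)).ne_zero

/-- Lebesgue measure on `ℍⁿ` in linear coordinates. -/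
theorem volume_eq_smul_map (L : (ℝ × (Fin (2 * n) → ℝ)) ≃L[ℝ] Heis n) :
    (volume : Measure (Heis n)) =
      ENNReal.ofReal (volScale (L : (ℝ × (Fin (2 * n) → ℝ)) →ₗ[ℝ] Heis n)) •
        Measure.map L volume := by
  let A : (ℝ × (Fin (2 * n) → ℝ)) ≃L[ℝ] Heis n :=
    ((prodBasis n).equiv (stdBasis' n) (Equiv.refl _)).toContinuousLinearEquiv
  have hA : Measure.map A volume = volume := by
    rw [← prodBasis_addHaar, Module.Basis.map_addHaar, ← stdBasis'_addHaar]
    congr 1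
    ext i : 1
    simp [A]
  let B : Heis n →ₗ[ℝ] Heis n := (L : (ℝ × (Fin (2 * n) → ℝ)) →ₗ[ℝ] Heis n) ∘ₗ A.symm
  have hBA : (L : (ℝ × (Fin (2 * n) → ℝ)) →ₗ[ℝ] Heis n) =
      B ∘ₗ (A : (ℝ × (Fin (2 * n) → ℝ)) →ₗ[ℝ] Heis n) := by
    ext <;> simp [B]
  have hAs : volScale (A : (ℝ × (Fin (2 * n) → ℝ)) →ₗ[ℝ] Heis n) = 1 := by
    have : LinearMap.toMatrix (prodBasis n) (stdBasis' n)
        (A : (ℝ × (Fin (2 * n) → ℝ)) →ₗ[ℝ] Heis n) = 1 := by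
      ext i j
      simp [LinearMap.toMatrix_apply, A, Matrix.one_apply, Finsupp.single_apply, eq_comm]
    rw [volScale, this, Matrix.det_one, abs_one]
  have hs : volScale (L : (ℝ × (Fin (2 * n) → ℝ)) →ₗ[ℝ] Heis n) = |LinearMap.det B| := by
    conv_lhs => rw [hBA]
    rw [volScale_comp, hAs, mul_one]
  have hne : LinearMap.det B ≠ 0 := by
    intro h
    exact volScale_ne_zero L.toLinearEquiv (hs.trans (by rw [h, abs_zero]))
  have hm : Measure.map L volume = ENNReal.ofReal |(LinearMap.det B)⁻¹| • volume := by
    have : (L : (ℝ × (Fin (2 * n) → ℝ)) → Heis n) = B ∘ A := by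
      funext x; simp [B]
    rw [this, ← Measure.map_map (LinearMap.continuous_of_finiteDimensional B).measurable
      A.continuous.measurable, hA, Measure.map_linearMap_addHaar_eq_smul_addHaar _ hne]
  rw [hm, hs, smul_smul, ← ENNReal.ofReal_mul (abs_nonneg _), ← abs_mul, mul_inv_cancel₀ hne]
  simp

end Heis

namespace Heis
variable {n : ℕ}

/-! ### Straightening charts of the boundary -/

/-- A straightening chart of the boundary of `Ω`: with `f` a local defining function, the
diffeomorphism `Φ(q) = q + (f(q) - ℓ(q)) e`, where `ℓ(e) = 1`, moves points along the direction
`e` only, and turns `f` into the linear functional `ℓ`. -/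
structure IsChart (Ω : Set (Heis n)) (f : Heis n → ℝ)
    (Φ : OpenPartialHomeomorph (Heis n) (Heis n)) (l : Heis n →L[ℝ] ℝ) (e : Heis n) : Prop where
  apply_e : l e = 1
  coe : ∀ q ∈ Φ.source, Φ q = q + (f q - l q) • e
  contDiffOn : ContDiffOn ℝ 2 f Φ.source
  contDiffOn_symm : ContDiffOn ℝ 2 Φ.symm Φ.target
  fderiv_ne : ∀ q ∈ Φ.source, fderiv ℝ f q ≠ 0
  mem_of_pos : ∀ q ∈ Φ.source, 0 < f q → q ∈ Ω
  notMem_of_neg : ∀ q ∈ Φ.source, f q < 0 → q ∉ Ω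
  mem_frontier_iff : ∀ q ∈ Φ.source, q ∈ frontier Ω ↔ f q = 0

/-- Every boundary point lies in the domain of a straightening chart: with `ℓ = Df(p)`, the
differential of `q ↦ q + (f(q) - ℓ(q)) e` at `p` is the identity, so that the inverse function
theorem applies. -/
theorem HasC2Boundary.exists_isChart {Ω : Set (Heis n)} (h : HasC2Boundary Ω) {p : Heis n}
    (hp : p ∈ frontier Ω) : ∃ f Φ l e, IsChart Ω f Φ l e ∧ p ∈ Φ.source := by
  obtain ⟨W, hW, hpW, f, hf, hdf, hpos, hneg, hfr⟩ := h p hp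
  obtain ⟨e₀, he₀⟩ : ∃ e, fderiv ℝ f p e ≠ 0 := by
    by_contra! hc
    exact hdf p hpW (ContinuousLinearMap.ext hc)
  set l := fderiv ℝ f p with hl
  set e := (l e₀)⁻¹ • e₀ with he
  have hle : l e = 1 := by simp [he, he₀]
  set Φ₀ : Heis n → Heis n := fun q => q + (f q - l q) • e with hΦ₀
  have hΦc : ContDiffOn ℝ 2 Φ₀ W :=
    contDiffOn_id.add ((hf.sub l.contDiff.contDiffOn).smul contDiffOn_const)
  have hfat : ∀ q ∈ W, ContDiffAt ℝ 2 f q := fun q hq => hf.contDiffAt (hW.mem_nhds hq)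
  have hΦat : ∀ q ∈ W, ContDiffAt ℝ 2 Φ₀ q := fun q hq => hΦc.contDiffAt (hW.mem_nhds hq)
  have hΦp : HasFDerivAt Φ₀ ((ContinuousLinearEquiv.refl ℝ (Heis n) : Heis n →L[ℝ] Heis n)) p := by
    have h1 := (hasFDerivAt_id (𝕜 := ℝ) p).add
      ((((hfat p hpW).differentiableAt (by norm_num)).hasFDerivAt.sub l.hasFDerivAt).smul_const e)
    refine h1.congr_fderiv ?_
    ext v <;> simp [← hl]
  have h2 : ContDiffAt ℝ 2 Φ₀ p := hΦat p hpW
  set G := h2.toOpenPartialHomeomorph Φ₀ hΦp (by norm_num) with hG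
  have hGc : (G : Heis n → Heis n) = Φ₀ := h2.toOpenPartialHomeomorph_coe hΦp (by norm_num)
  have hpG : p ∈ G.source := h2.mem_toOpenPartialHomeomorph_source hΦp (by norm_num)
  set O : Set (Heis n) := W ∩ (fderiv ℝ Φ₀) ⁻¹' {A | IsUnit A} with hO
  have hOo : IsOpen O :=
    (hΦc.continuousOn_fderiv_of_isOpen hW (by norm_num)).isOpen_inter_preimage hW Units.isOpen
  have hpO : p ∈ O := by
    refine ⟨hpW, ?_⟩
    simp only [Set.mem_preimage, Set.mem_ofPred_eq, hΦp.fderiv]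
    exact isUnit_one
  refine ⟨f, G.restrOpen O hOo, l, e, ⟨hle, ?_, ?_, ?_, ?_, ?_, ?_, ?_⟩, ?_⟩
  · intro q hq
    change G q = _
    rw [hGc]
  · exact hf.mono fun q hq => hq.2.1
  · intro y hy
    apply ContDiffAt.contDiffWithinAt
    have hs : (G.restrOpen O hOo).symm y ∈ (G.restrOpen O hOo).source :=
      (G.restrOpen O hOo).map_target hy
    obtain ⟨u, hu⟩ := hs.2.2
    refine (G.restrOpen O hOo).contDiffAt_symm (f₀' := ContinuousLinearEquiv.ofUnit u) hy ?_ ?_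
    · have := ((hΦat _ hs.2.1).differentiableAt (by norm_num)).hasFDerivAt
      rw [← hu] at this
      change HasFDerivAt G _ _
      rw [hGc]
      exact this
    · change ContDiffAt ℝ 2 G _
      rw [hGc]
      exact hΦat _ hs.2.1
  · exact fun q hq => hdf q hq.2.1
  · exact fun q hq => hpos q hq.2.1
  · exact fun q hq => hneg q hq.2.1
  · intro q hq
    have : q ∈ frontier Ω ∩ W ↔ q ∈ {q ∈ W | f q = 0} := by rw [hfr]
    simpa [hq.2.1] using this
  · exact ⟨hpG, hpO⟩

namespace IsChart

variable {Ω : Set (Heis n)} {f : Heis n → ℝ} {Φ : OpenPartialHomeomorph (Heis n) (Heis n)}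
  {l : Heis n →L[ℝ] ℝ} {e : Heis n} (h : IsChart Ω f Φ l e) {q : Heis n}

include h

theorem contDiffAt (hq : q ∈ Φ.source) : ContDiffAt ℝ 2 f q :=
  h.contDiffOn.contDiffAt (Φ.open_source.mem_nhds hq)

theorem hasFDerivAt (hq : q ∈ Φ.source) : HasFDerivAt f (fderiv ℝ f q) q :=
  ((h.contDiffAt hq).differentiableAt (by norm_num)).hasFDerivAt

theorem hasFDerivAt_coe (hq : q ∈ Φ.source) :
    HasFDerivAt Φ (1 + (fderiv ℝ f q - l).smulRight e) q := by
  have h1 := (hasFDerivAt_id (𝕜 := ℝ) q).add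
      (((h.hasFDerivAt hq).sub l.hasFDerivAt).smul_const e)
  refine h1.congr_of_eventuallyEq ?_
  filter_upwards [Φ.open_source.mem_nhds hq] with x hx using h.coe x hx

theorem apply_coe (hq : q ∈ Φ.source) : l (Φ q) = f q := by
  rw [h.coe q hq, map_add, map_smul, h.apply_e]; simp

theorem contDiffAt_symm {y : Heis n} (hy : y ∈ Φ.target) : ContDiffAt ℝ 2 Φ.symm y :=
  h.contDiffOn_symm.contDiffAt (Φ.open_target.mem_nhds hy)

theorem hasFDerivAt_symm {y : Heis n} (hy : y ∈ Φ.target) :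
    HasFDerivAt Φ.symm (fderiv ℝ Φ.symm y) y :=
  ((h.contDiffAt_symm hy).differentiableAt (by norm_num)).hasFDerivAt

theorem fderiv_symm_mul (hq : q ∈ Φ.source) :
    fderiv ℝ Φ.symm (Φ q) * (1 + (fderiv ℝ f q - l).smulRight e) = 1 := by
  have h1 := (h.hasFDerivAt_symm (Φ.map_source hq)).comp q (h.hasFDerivAt_coe hq)
  have h2 : HasFDerivAt (Φ.symm ∘ Φ) (1 : Heis n →L[ℝ] Heis n) q := by
    refine (hasFDerivAt_id q).congr_of_eventuallyEq ?_
    filter_upwards [Φ.open_source.mem_nhds hq] with x hx using Φ.left_inv hx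
  exact h1.unique h2

theorem mul_fderiv_symm (hq : q ∈ Φ.source) :
    (1 + (fderiv ℝ f q - l).smulRight e) * fderiv ℝ Φ.symm (Φ q) = 1 := by
  have h0 : HasFDerivAt Φ (1 + (fderiv ℝ f q - l).smulRight e) (Φ.symm (Φ q)) := by
    rw [Φ.left_inv hq]; exact h.hasFDerivAt_coe hq
  have h1 := h0.comp (Φ q) (h.hasFDerivAt_symm (Φ.map_source hq))
  have h2 : HasFDerivAt (Φ ∘ Φ.symm) (1 : Heis n →L[ℝ] Heis n) (Φ q) := by
    refine (hasFDerivAt_id _).congr_of_eventuallyEq ?_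
    filter_upwards [Φ.open_target.mem_nhds (Φ.map_source hq)] with x hx using Φ.right_inv hx
  exact h1.unique h2

theorem tangent_eq (hq : q ∈ Φ.source) (hqf : q ∈ frontier Ω) :
    tangent (frontier Ω) q = {v | fderiv ℝ f q v = 0} := by
  have hf0 : f q = 0 := (h.mem_frontier_iff q hq).1 hqf
  ext v
  constructor
  · rintro ⟨γ, h0, hγ, hd⟩
    have hfd : HasFDerivAt f (fderiv ℝ f q) (γ 0) := by rw [h0]; exact h.hasFDerivAt hq
    have h1 := hfd.comp_hasDerivAt 0 hd
    have hs : ∀ᶠ s in 𝓝 (0 : ℝ), γ s ∈ Φ.source :=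
      hd.continuousAt.eventually_mem (Φ.open_source.mem_nhds (by rwa [h0]))
    have h2 : HasDerivAt (f ∘ γ) 0 0 := by
      refine (hasDerivAt_const (0 : ℝ) (0 : ℝ)).congr_of_eventuallyEq ?_
      filter_upwards [hs, hγ] with s hs1 hs2 using (h.mem_frontier_iff _ hs1).1 hs2
    exact h1.unique h2
  · intro hv
    have hv : fderiv ℝ f q v = 0 := hv
    set D : Heis n →L[ℝ] Heis n := 1 + (fderiv ℝ f q - l).smulRight e with hD
    have hlin : HasDerivAt (fun s : ℝ => Φ q + s • D v) (D v) 0 := by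
      simpa using ((hasDerivAt_id (0 : ℝ)).smul_const (D v)).const_add (Φ q)
    have hmem : ∀ᶠ s in 𝓝 (0 : ℝ), Φ q + s • D v ∈ Φ.target :=
      hlin.continuousAt.eventually_mem (Φ.open_target.mem_nhds (by simpa using Φ.map_source hq))
    refine ⟨fun s => Φ.symm (Φ q + s • D v), by simp [Φ.left_inv hq], ?_, ?_⟩
    · filter_upwards [hmem] with s hs
      have hs' := Φ.map_target hs
      rw [h.mem_frontier_iff _ hs', ← h.apply_coe hs', Φ.right_inv hs, map_add, h.apply_coe hq, hf0]
      simp [hD, hv, h.apply_e]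
    · have h1 : HasFDerivAt Φ.symm (fderiv ℝ Φ.symm (Φ q)) (Φ q + (0 : ℝ) • D v) := by
        simpa using h.hasFDerivAt_symm (Φ.map_source hq)
      have h2 := h1.comp_hasDerivAt 0 hlin
      have h3 : fderiv ℝ Φ.symm (Φ q) (D v) = v :=
        congrArg (fun A : Heis n →L[ℝ] Heis n => A v) (h.fderiv_symm_mul hq)
      rw [h3] at h2
      exact h2

end IsChart

/-! ### Gradients and the inner unit normal -/

/-- The Riemannian gradient of a function. -/
def grad (f : Heis n → ℝ) (q : Heis n) : Heis n :=
  frame q (fun k => fderiv ℝ f q (X k q), fun k => fderiv ℝ f q (Y k q), fderiv ℝ f q (T q))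

theorem metric_grad (f : Heis n → ℝ) (q v : Heis n) : metric q v (grad f q) = fderiv ℝ f q v := by
  simp only [grad, metric, coframe_frame]
  conv_rhs => rw [← frame_coframe q v]
  simp [frame]

theorem grad_ne_zero {f : Heis n → ℝ} {q : Heis n} (h : fderiv ℝ f q ≠ 0) : grad f q ≠ 0 := by
  intro h0
  refine h (ContinuousLinearMap.ext fun v => ?_)
  have := metric_grad f q v
  rw [h0, metric_comm, metric_zero_left] at this
  exact this.symm

/-- The horizontal gradient of a function. -/
def horGrad (f : Heis n → ℝ) (q : Heis n) : Heis n :=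
  frame q (fun k => fderiv ℝ f q (X k q), fun k => fderiv ℝ f q (Y k q), 0)

theorem horProj_grad (f : Heis n → ℝ) (q : Heis n) : horProj q (grad f q) = horGrad f q := by
  rw [← frame_coframe q (horProj q (grad f q)), coframe_horProj, horGrad, grad, coframe_frame]

theorem horProj_smul (p : Heis n) (c : ℝ) (v : Heis n) :
    horProj p (c • v) = c • horProj p v := by
  rw [horProj, horProj, metric_smul_left, smul_sub, smul_smul]

theorem horGrad_mem (f : Heis n → ℝ) (q : Heis n) : horGrad f q ∈ horizontal q := by
  rw [← horProj_grad]; exact horProj_mem _ _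

/-- A function that vanishes at `q` has, on a short segment issuing from `q`, the sign of its
derivative along the segment. -/
theorem eventually_pos_of_fderiv_pos {f : Heis n → ℝ} {q v : Heis n} {A : Heis n →L[ℝ] ℝ}
    (hf : HasFDerivAt f A q) (h0 : f q = 0) (hv : 0 < A v) :
    ∀ᶠ s : ℝ in 𝓝[>] 0, 0 < f (q + s • v) := by
  have h1 : HasDerivAt (fun s : ℝ => f (q + s • v)) (A v) 0 := by
    have hl : HasDerivAt (fun s : ℝ => q + s • v) v 0 := by
      simpa using ((hasDerivAt_id (0 : ℝ)).smul_const v).const_add q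
    have hf' : HasFDerivAt f A (q + (0 : ℝ) • v) := by simpa using hf
    exact hf'.comp_hasDerivAt 0 hl
  have h2 := (hasDerivAt_iff_tendsto_slope.1 h1).eventually (lt_mem_nhds hv)
  have h3 : 𝓝[>] (0 : ℝ) ≤ 𝓝[≠] 0 := nhdsWithin_mono _ fun x hx => (ne_of_gt hx)
  filter_upwards [h3 h2, self_mem_nhdsWithin] with s hs hs0
  have hs0 : 0 < s := hs0
  simp only [slope, vsub_eq_sub, sub_zero, zero_smul, add_zero, h0, smul_eq_mul] at hs
  exact (mul_pos_iff_of_pos_left (inv_pos.2 hs0)).1 hs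

namespace IsChart

variable {Ω : Set (Heis n)} {f : Heis n → ℝ} {Φ : OpenPartialHomeomorph (Heis n) (Heis n)}
  {l : Heis n →L[ℝ] ℝ} {e : Heis n} (h : IsChart Ω f Φ l e) {q : Heis n}

include h

theorem len_grad_pos (hq : q ∈ Φ.source) : 0 < len q (grad f q) :=
  (len_nonneg _ _).lt_of_ne fun h0 => grad_ne_zero (h.fderiv_ne q hq) (len_eq_zero_iff.1 h0.symm)

/-- In a chart, the inner unit normal is the normalized gradient of the defining function. -/
theorem isInnerUnitNormal_iff (hq : q ∈ Φ.source) (hqf : q ∈ frontier Ω) (v : Heis n) :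
    IsInnerUnitNormal Ω q v ↔ v = (len q (grad f q))⁻¹ • grad f q := by
  have hf0 : f q = 0 := (h.mem_frontier_iff q hq).1 hqf
  have hg := h.len_grad_pos hq
  set g := grad f q with hgdef
  have hgg : fderiv ℝ f q g = len q g ^ 2 := by rw [← metric_grad, metric_self]
  have hline : ∀ v : Heis n, ∀ᶠ s : ℝ in 𝓝[>] 0, q + s • v ∈ Φ.source := by
    intro v
    have hl : ContinuousAt (fun s : ℝ => q + s • v) 0 := by fun_prop
    exact (hl.eventually_mem (Φ.open_source.mem_nhds (by simpa using hq))).filter_mono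
      nhdsWithin_le_nhds
  rw [IsInnerUnitNormal, h.tangent_eq hq hqf]
  constructor
  · rintro ⟨h1, h2, h3⟩
    set c := fderiv ℝ f q v / len q g ^ 2 with hc
    have hw : fderiv ℝ f q (v - c • g) = 0 := by
      rw [map_sub, map_smul, hgg, smul_eq_mul, hc]; field_simp; ring
    have hw2 : metric q (v - c • g) (v - c • g) = 0 := by
      rw [metric_sub_left, h2 _ hw, metric_smul_left, metric_comm q g, metric_grad, hw]
      ring
    have hv : v = c • g := by
      rw [metric_self] at hw2
      exact sub_eq_zero.1 (len_eq_zero_iff.1 (pow_eq_zero_iff two_ne_zero |>.1 hw2))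
    have hcpos : 0 ≤ c := by
      by_contra hcn
      have hd : 0 < (-fderiv ℝ f q) v := by
        rw [hv, neg_apply, map_smul, hgg, smul_eq_mul]
        nlinarith [pow_pos hg 2]
      have hev := eventually_pos_of_fderiv_pos (h.hasFDerivAt hq).neg (by simp [hf0]) hd
      obtain ⟨s, hs1, hs2, hs3⟩ := (hev.and (h3.and (hline v))).exists
      exact h.notMem_of_neg _ hs3 (by simpa using hs1) hs2
    rw [hv, len_smul, abs_of_nonneg hcpos] at h1
    rw [hv, eq_inv_of_mul_eq_one_left h1]
  · intro hv
    refine ⟨?_, fun w hw => ?_, ?_⟩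
    · rw [hv, len_smul, abs_of_pos (inv_pos.2 hg), inv_mul_cancel₀ hg.ne']
    · rw [hv, metric_smul_left, metric_comm, metric_grad, hw, mul_zero]
    · have hd : 0 < fderiv ℝ f q v := by
        rw [hv, map_smul, hgg, smul_eq_mul]; positivity
      filter_upwards [eventually_pos_of_fderiv_pos (h.hasFDerivAt hq) hf0 hd, hline v] with s h1 h2
      exact h.mem_of_pos _ h2 h1

theorem innerNormal_eq (hq : q ∈ Φ.source) (hqf : q ∈ frontier Ω) :
    innerNormal Ω q = (len q (grad f q))⁻¹ • grad f q := by
  have hex : ∃ v, IsInnerUnitNormal Ω q v := ⟨_, (h.isInnerUnitNormal_iff hq hqf _).2 rfl⟩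
  rw [innerNormal, dif_pos hex]
  exact (h.isInnerUnitNormal_iff hq hqf _).1 hex.choose_spec

theorem metric_innerNormal (hq : q ∈ Φ.source) (hqf : q ∈ frontier Ω) (v : Heis n) :
    metric q v (innerNormal Ω q) = (len q (grad f q))⁻¹ * fderiv ℝ f q v := by
  rw [h.innerNormal_eq hq hqf, metric_smul_right, metric_grad]

theorem horProj_innerNormal (hq : q ∈ Φ.source) (hqf : q ∈ frontier Ω) :
    horProj q (innerNormal Ω q) = (len q (grad f q))⁻¹ • horGrad f q := by
  rw [h.innerNormal_eq hq hqf, horProj_smul, horProj_grad]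

theorem horNormal_eq (hq : q ∈ Φ.source) (hqf : q ∈ frontier Ω) :
    horNormal Ω q = (len q (horGrad f q))⁻¹ • horGrad f q := by
  have hg := h.len_grad_pos hq
  rw [horNormal, h.horProj_innerNormal hq hqf, len_smul, smul_smul, abs_of_pos (inv_pos.2 hg)]
  congr 1
  field_simp

theorem len_horGrad_pos (hq : q ∈ Φ.source) (hqf : q ∈ frontier Ω)
    (hs : q ∉ singularSet (frontier Ω)) : 0 < len q (horGrad f q) := by
  refine (len_nonneg _ _).lt_of_ne fun h0 => hs ⟨hqf, ?_⟩
  have h0 := len_eq_zero_iff.1 h0.symm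
  have hc : coframe q (horGrad f q) = 0 := by rw [h0]; simp [coframe]
  rw [horGrad, coframe_frame] at hc
  have hX : ∀ k, fderiv ℝ f q (X k q) = 0 := fun k => congrFun (congrArg Prod.fst hc) k
  have hY : ∀ k, fderiv ℝ f q (Y k q) = 0 :=
    fun k => congrFun (congrArg (fun x => x.2.1) hc) k
  have hfd : ∀ v, fderiv ℝ f q v = (coframe q v).2.2 * fderiv ℝ f q (T q) := by
    intro v
    conv_lhs => rw [← frame_coframe q v]
    simp [frame, hX, hY]
  have hT : fderiv ℝ f q (T q) ≠ 0 := by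
    intro h0
    refine h.fderiv_ne q hq (ContinuousLinearMap.ext fun v => ?_)
    rw [hfd, h0, mul_zero]; rfl
  rw [h.tangent_eq hq hqf]
  ext v
  rw [Set.mem_ofPred_eq, SetLike.mem_coe, mem_horizontal_iff, hfd, mul_eq_zero, or_iff_left hT]

theorem contDiffOn_fderiv : ContDiffOn ℝ 1 (fderiv ℝ f) Φ.source :=
  h.contDiffOn.fderiv_of_isOpen Φ.open_source (by norm_num)

theorem contDiffOn_fderiv_X : ContDiffOn ℝ 1 (fun q k => fderiv ℝ f q (X k q)) Φ.source :=
  contDiffOn_pi.2 fun k => h.contDiffOn_fderiv.clm_apply (contDiff_X k).contDiffOn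

theorem contDiffOn_fderiv_Y : ContDiffOn ℝ 1 (fun q k => fderiv ℝ f q (Y k q)) Φ.source :=
  contDiffOn_pi.2 fun k => h.contDiffOn_fderiv.clm_apply (contDiff_Y k).contDiffOn

theorem contDiffOn_grad : ContDiffOn ℝ 1 (grad f) Φ.source := by
  have hT : ContDiffOn ℝ 1 (fun q => fderiv ℝ f q (T q)) Φ.source :=
    h.contDiffOn_fderiv.clm_apply contDiffOn_const
  have ha : ContDiffOn ℝ 1 (fun q => ((q, (fun k => fderiv ℝ f q (X k q)),
      (fun k => fderiv ℝ f q (Y k q)), fderiv ℝ f q (T q)) : Heis n × Heis n)) Φ.source :=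
    contDiffOn_id.prodMk (h.contDiffOn_fderiv_X.prodMk (h.contDiffOn_fderiv_Y.prodMk hT))
  have hf : ContDiff ℝ 1 fun x : Heis n × Heis n => frame x.1 x.2 := contDiff_frame
  refine (hf.comp_contDiffOn ha).congr fun q _ => ?_
  simp only [grad, Function.comp_apply]

theorem contDiffOn_horGrad : ContDiffOn ℝ 1 (horGrad f) Φ.source := by
  have ha : ContDiffOn ℝ 1 (fun q => ((q, (fun k => fderiv ℝ f q (X k q)),
      (fun k => fderiv ℝ f q (Y k q)), 0) : Heis n × Heis n)) Φ.source :=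
    contDiffOn_id.prodMk (h.contDiffOn_fderiv_X.prodMk (h.contDiffOn_fderiv_Y.prodMk
      contDiffOn_const))
  have hf : ContDiff ℝ 1 fun x : Heis n × Heis n => frame x.1 x.2 := contDiff_frame
  refine (hf.comp_contDiffOn ha).congr fun q _ => ?_
  simp only [horGrad, Function.comp_apply]

end IsChart

theorem continuous_len : Continuous fun x : Heis n × Heis n => len x.1 x.2 := by
  have : Continuous fun x : Heis n × Heis n × Heis n => metric x.1 x.2.1 x.2.2 :=
    (contDiff_metric (k := 1)).continuous
  unfold len
  exact Real.continuous_sqrt.comp (this.comp (by fun_prop :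
    Continuous fun x : Heis n × Heis n => (x.1, x.2, x.2)))

/-- The inner unit normal is continuous along a boundary of class `C²`. -/
theorem HasC2Boundary.continuousOn_innerNormal {Ω : Set (Heis n)} (hΩ : HasC2Boundary Ω) :
    ContinuousOn (innerNormal Ω) (frontier Ω) := by
  intro p hp
  obtain ⟨f, Φ, l, e, h, hpΦ⟩ := hΩ.exists_isChart hp
  have hnhds := Φ.open_source.mem_nhds hpΦ
  have hc : ContinuousAt (fun q => (len q (grad f q))⁻¹ • grad f q) p := by
    have hg : ContinuousAt (grad f) p := h.contDiffOn_grad.continuousOn.continuousAt hnhds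
    have hl : ContinuousAt (fun q => len q (grad f q)) p :=
      (continuous_len.continuousAt (x := (p, grad f p))).comp
        (f := fun q => (q, grad f q)) (continuousAt_id.prodMk hg)
    exact (hl.inv₀ (h.len_grad_pos hpΦ).ne').smul hg
  refine hc.continuousWithinAt.congr_of_eventuallyEq ?_ (h.innerNormal_eq hpΦ hp)
  filter_upwards [mem_nhdsWithin_of_mem_nhds hnhds, self_mem_nhdsWithin] with q h1 h2
  exact h.innerNormal_eq h1 h2

theorem HasC2Boundary.len_innerNormal {Ω : Set (Heis n)} (hΩ : HasC2Boundary Ω) {p : Heis n}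
    (hp : p ∈ frontier Ω) : len p (innerNormal Ω p) = 1 := by
  obtain ⟨f, Φ, l, e, h, hpΦ⟩ := hΩ.exists_isChart hp
  exact ((h.isInnerUnitNormal_iff hpΦ hp _).2 (h.innerNormal_eq hpΦ hp)).1

end Heis

namespace Heis
variable {n : ℕ}

/-! ### The surface measure in a chart -/

/-- Linear coordinates on `ℍⁿ` whose first one is `ℓ` and whose first coordinate axis is directed by
`e`. -/
theorem exists_adapted (l : Heis n →L[ℝ] ℝ) (e : Heis n) (hle : l e = 1) :
    ∃ L : (ℝ × (Fin (2 * n) → ℝ)) ≃L[ℝ] Heis n, (∀ s x, l (L (s, x)) = s) ∧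
      ∀ s x, L (s, x) = s • e + L (0, x) := by
  have hne : (l : Heis n →ₗ[ℝ] ℝ) ≠ 0 := by
    intro h0
    have := congrArg (fun m : Heis n →ₗ[ℝ] ℝ => m e) h0
    simp [hle] at this
  have hdim : Module.finrank ℝ (LinearMap.ker (l : Heis n →ₗ[ℝ] ℝ)) = 2 * n := by
    have h1 := Module.Dual.finrank_ker_add_one_of_ne_zero hne
    have h2 : Module.finrank ℝ (Heis n) = 2 * n + 1 := by
      rw [Module.finrank_eq_card_basis (stdBasis' n)]; simp; ring
    omega
  let b := Module.finBasisOfFinrankEq ℝ _ hdim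
  let i : (Fin (2 * n) → ℝ) ≃ₗ[ℝ] LinearMap.ker (l : Heis n →ₗ[ℝ] ℝ) := b.equivFun.symm
  have hi : ∀ x, l (i x) = 0 := fun x => (i x).2
  let L : (ℝ × (Fin (2 * n) → ℝ)) ≃ₗ[ℝ] Heis n :=
    { toFun := fun y => y.1 • e + (i y.2 : Heis n)
      invFun := fun v => (l v, i.symm ⟨v - l v • e, by simp [hle]⟩)
      map_add' := fun y z => by simp [add_smul]; abel
      map_smul' := fun c y => by simp [smul_smul]
      left_inv := fun y => by
        ext1
        · simp [hle, hi]
        · simp only [map_add, map_smul, hle, hi, smul_eq_mul, mul_one, add_zero]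
          rw [LinearEquiv.symm_apply_eq]
          ext1
          simp
      right_inv := fun v => by simp }
  refine ⟨L.toContinuousLinearEquiv, fun s x => ?_, fun s x => ?_⟩
  · change l (s • e + (i x : Heis n)) = s
    simp [hle, hi]
  · change s • e + (i x : Heis n) = s • e + ((0 : ℝ) • e + (i x : Heis n))
    simp

/-- The parametrization of the boundary given by a straightening chart and linear coordinates on
the hyperplane `ℓ = 0`. -/
def chartPatch (Φ : OpenPartialHomeomorph (Heis n) (Heis n))
    (L : (ℝ × (Fin (2 * n) → ℝ)) ≃L[ℝ] Heis n) (x : Fin (2 * n) → ℝ) : Heis n :=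
  Φ.symm (L (0, x))

/-- The domain of `chartPatch`. -/
def chartDomain (Φ : OpenPartialHomeomorph (Heis n) (Heis n))
    (L : (ℝ × (Fin (2 * n) → ℝ)) ≃L[ℝ] Heis n) : Set (Fin (2 * n) → ℝ) :=
  {x | L (0, x) ∈ Φ.target}

theorem isOpen_chartDomain (Φ : OpenPartialHomeomorph (Heis n) (Heis n))
    (L : (ℝ × (Fin (2 * n) → ℝ)) ≃L[ℝ] Heis n) : IsOpen (chartDomain Φ L) :=
  Φ.open_target.preimage (by fun_prop : Continuous fun x => L (0, x))

/-- The area density under a change of parameters. -/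
theorem areaDensity_comp {φ ψ : (Fin (2 * n) → ℝ) → Heis n}
    {τ : (Fin (2 * n) → ℝ) → Fin (2 * n) → ℝ} {x : Fin (2 * n) → ℝ}
    {A : (Fin (2 * n) → ℝ) →L[ℝ] (Fin (2 * n) → ℝ)} (hx : φ x = ψ (τ x))
    (h : fderiv ℝ φ x = (fderiv ℝ ψ (τ x)).comp A) :
    areaDensity φ x = |A.det| * areaDensity ψ (τ x) := by
  set M := LinearMap.toMatrix' (A : (Fin (2 * n) → ℝ) →ₗ[ℝ] (Fin (2 * n) → ℝ)) with hM
  set G := (Matrix.of fun i j => metric (ψ (τ x)) (fderiv ℝ ψ (τ x) (Pi.single i 1))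
    (fderiv ℝ ψ (τ x) (Pi.single j 1))) with hG
  have hA : ∀ i, A (Pi.single i 1) = ∑ k, M k i • Pi.single k (1 : ℝ) := by
    intro i
    ext m
    simp [hM, LinearMap.toMatrix'_apply, Finset.sum_apply, Pi.single_apply]
  have key : (Matrix.of fun i j => metric (φ x) (fderiv ℝ φ x (Pi.single i 1))
      (fderiv ℝ φ x (Pi.single j 1))) = M.transpose * G * M := by
    ext i j
    rw [Matrix.of_apply, h, hx, ContinuousLinearMap.comp_apply, ContinuousLinearMap.comp_apply,
      hA, hA, map_sum, map_sum, metric_sum_left, Matrix.mul_apply]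
    simp_rw [Matrix.mul_apply, Finset.sum_mul]
    rw [Finset.sum_comm]
    refine Finset.sum_congr rfl fun k _ => ?_
    rw [metric_comm, metric_sum_left]
    refine Finset.sum_congr rfl fun m _ => ?_
    rw [map_smul, map_smul, metric_smul_left, metric_smul_right, metric_comm]
    simp [hG]
    ring
  have hdet : A.det = M.det := by
    rw [ContinuousLinearMap.det, ← LinearMap.det_toMatrix']
  rw [areaDensity, areaDensity, key, Matrix.det_mul, Matrix.det_mul, Matrix.det_transpose, hdet,
    mul_comm, ← mul_assoc, ← sq, Real.sqrt_mul (sq_nonneg _), Real.sqrt_sq_eq_abs]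

namespace IsChart

variable {Ω : Set (Heis n)} {f : Heis n → ℝ} {Φ : OpenPartialHomeomorph (Heis n) (Heis n)}
  {l : Heis n →L[ℝ] ℝ} {e : Heis n} (h : IsChart Ω f Φ l e)
  {L : (ℝ × (Fin (2 * n) → ℝ)) ≃L[ℝ] Heis n} (hl : ∀ s x, l (L (s, x)) = s)
  (hL : ∀ s x, L (s, x) = s • e + L (0, x))

include hl in
theorem symm_fst (q : Heis n) : (L.symm q).1 = l q := by
  conv_rhs => rw [← L.apply_symm_apply q]
  exact (hl (L.symm q).1 (L.symm q).2).symm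

include hL in
theorem symm_add_smul (q : Heis n) (c : ℝ) : (L.symm (q + c • e)).2 = (L.symm q).2 := by
  have : L.symm e = (1, 0) := by
    rw [ContinuousLinearEquiv.symm_apply_eq, hL]
    have h0 : L ((0 : ℝ), (0 : Fin (2 * n) → ℝ)) = 0 := L.map_zero
    rw [h0]; simp
  rw [map_add, map_smul, this]
  simp

include h hl

theorem chartPatch_mem {x : Fin (2 * n) → ℝ} (hx : x ∈ chartDomain Φ L) :
    chartPatch Φ L x ∈ Φ.source ∧ chartPatch Φ L x ∈ frontier Ω := by
  have h1 : chartPatch Φ L x ∈ Φ.source := Φ.map_target hx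
  refine ⟨h1, ?_⟩
  rw [h.mem_frontier_iff _ h1, ← h.apply_coe h1, chartPatch, Φ.right_inv hx, hl]

include hL

theorem chartPatch_left_inv {x : Fin (2 * n) → ℝ} (hx : x ∈ chartDomain Φ L) :
    (L.symm (chartPatch Φ L x)).2 = x := by
  have h1 := (h.chartPatch_mem hl hx).1
  have h2 : Φ (chartPatch Φ L x) = L (0, x) := Φ.right_inv hx
  rw [h.coe _ h1] at h2
  rw [← symm_add_smul hL _ (f (chartPatch Φ L x) - l (chartPatch Φ L x)), h2]
  simp

theorem coe_eq {q : Heis n} (hq : q ∈ Φ.source) (hqf : q ∈ frontier Ω) :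
    Φ q = L (0, (L.symm q).2) := by
  rw [← symm_add_smul hL q (f q - l q), ← h.coe q hq]
  have : l (Φ q) = 0 := by rw [h.apply_coe hq, (h.mem_frontier_iff q hq).1 hqf]
  rw [← symm_fst hl] at this
  rw [← this, Prod.mk.eta, L.apply_symm_apply]

theorem mem_chartDomain {q : Heis n} (hq : q ∈ Φ.source) (hqf : q ∈ frontier Ω) :
    (L.symm q).2 ∈ chartDomain Φ L := by
  change L (0, (L.symm q).2) ∈ Φ.target
  rw [← h.coe_eq hl hL hq hqf]
  exact Φ.map_source hq

theorem chartPatch_right_inv {q : Heis n} (hq : q ∈ Φ.source) (hqf : q ∈ frontier Ω) :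
    chartPatch Φ L (L.symm q).2 = q := by
  rw [chartPatch, ← h.coe_eq hl hL hq hqf, Φ.left_inv hq]

omit hL hl in
theorem fderiv_chartPatch {x : Fin (2 * n) → ℝ} (hx : x ∈ chartDomain Φ L) :
    HasFDerivAt (chartPatch Φ L) ((fderiv ℝ Φ.symm (L (0, x))).comp
      ((L : (ℝ × (Fin (2 * n) → ℝ)) →L[ℝ] Heis n).comp
        (ContinuousLinearMap.inr ℝ ℝ (Fin (2 * n) → ℝ)))) x :=
  (h.hasFDerivAt_symm hx).comp x
    ((L : (ℝ × (Fin (2 * n) → ℝ)) →L[ℝ] Heis n).comp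
        (ContinuousLinearMap.inr ℝ ℝ (Fin (2 * n) → ℝ))).hasFDerivAt

omit hl hL in
theorem fderiv_fderiv_symm {y : Heis n} (hy : y ∈ Φ.target) (v : Heis n) :
    fderiv ℝ f (Φ.symm y) (fderiv ℝ Φ.symm y v) = l v := by
  have h1 := congrArg (fun A : Heis n →L[ℝ] Heis n => l (A v)) (h.mul_fderiv_symm (Φ.map_target hy))
  rw [Φ.right_inv hy] at h1
  simpa [h.apply_e] using h1

/-- The area density of the chart parametrization, in terms of the Jacobian of the chart: the Gram
determinant of the tangent vectors does not change when the unit normal is added to them, and then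
it is the square of a full Jacobian determinant. -/
theorem areaDensity_chartPatch {x : Fin (2 * n) → ℝ} (hx : x ∈ chartDomain Φ L) :
    areaDensity (chartPatch Φ L) x =
      volScale (L : (ℝ × (Fin (2 * n) → ℝ)) →ₗ[ℝ] Heis n) *
        |(fderiv ℝ Φ.symm (L (0, x))).det| *
        len (chartPatch Φ L x) (grad f (chartPatch Φ L x)) := by
  obtain ⟨hqs, hqf⟩ := h.chartPatch_mem hl hx
  set q := chartPatch Φ L x with hq
  set N := innerNormal Ω q with hN
  set D := fderiv ℝ Φ.symm (L (0, x)) with hD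
  have hΦq : Φ q = L (0, x) := Φ.right_inv hx
  have hNN : metric q N N = 1 := by
    rw [metric_self, ((h.isInnerUnitNormal_iff hqs hqf N).2 (h.innerNormal_eq hqs hqf)).1, one_pow]
  have horth : ∀ v, metric q (D (L (0, v))) N = 0 := by
    intro v
    rw [hN, h.metric_innerNormal hqs hqf, hq, chartPatch, h.fderiv_fderiv_symm hx, hl, mul_zero]
  have hdfN : fderiv ℝ f q N = len q (grad f q) := by
    have hg := h.len_grad_pos hqs
    rw [hN, h.innerNormal_eq hqs hqf, map_smul, ← metric_grad, metric_self, smul_eq_mul]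
    field_simp
  set A : Heis n →L[ℝ] Heis n := 1 + (fderiv ℝ f q - l).smulRight e with hA
  have hDA : ∀ v, D (A v) = v := fun v => by
    have := congrArg (fun C : Heis n →L[ℝ] Heis n => C v) (h.fderiv_symm_mul hqs)
    rw [hΦq] at this
    exact this
  set B : (ℝ × (Fin (2 * n) → ℝ)) →ₗ[ℝ] Heis n :=
    (D : Heis n →ₗ[ℝ] Heis n) ∘ₗ (LinearMap.transvection (l : Heis n →ₗ[ℝ] ℝ) (A N - e) ∘ₗ
      (L : (ℝ × (Fin (2 * n) → ℝ)) →ₗ[ℝ] Heis n)) with hB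
  have hBapp : ∀ s v, B (s, v) = s • N + D (L (0, v)) := by
    intro s v
    have : B (s, v) = D (L (s, v) + l (L (s, v)) • (A N - e)) := rfl
    rw [this, hl, hL]
    have e1 : s • e + L (0, v) + s • (A N - e) = s • A N + L (0, v) := by
      rw [smul_sub]; abel
    rw [e1, map_add, map_smul, hDA]
  have hvB : volScale B = |D.det| * (len q (grad f q) *
      volScale (L : (ℝ × (Fin (2 * n) → ℝ)) →ₗ[ℝ] Heis n)) := by
    rw [hB, volScale_comp, volScale_comp, LinearMap.transvection.det]
    have hlA : (1 : ℝ) + (l : Heis n →ₗ[ℝ] ℝ) (A N - e) = len q (grad f q) := by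
      rw [← hdfN]
      simp [hA, h.apply_e]
    rw [hlA, abs_of_nonneg (len_nonneg _ _)]
  have hgram := det_gram q B
  have hblock : (Matrix.of fun i j => metric q (B (prodBasis n i)) (B (prodBasis n j))) =
      Matrix.fromBlocks (1 : Matrix Unit Unit ℝ) 0 0
        (Matrix.of fun i j => metric q (fderiv ℝ (chartPatch Φ L) x (Pi.single i 1))
          (fderiv ℝ (chartPatch Φ L) x (Pi.single j 1))) := by
    have hL0 : L ((0 : ℝ), (0 : Fin (2 * n) → ℝ)) = 0 := L.map_zero
    have b1 : ∀ u, B (prodBasis n (Sum.inl u)) = N := by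
      intro u
      have : prodBasis n (Sum.inl u) = (1, 0) := by simp [prodBasis]
      rw [this, hBapp, hL0]; simp
    have b2 : ∀ i, B (prodBasis n (Sum.inr i)) =
        fderiv ℝ (chartPatch Φ L) x (Pi.single i 1) := by
      intro i
      have : prodBasis n (Sum.inr i) = (0, Pi.single i 1) := by simp [prodBasis]
      rw [this, hBapp, (h.fderiv_chartPatch hx).fderiv]
      simp [hD]
    have b3 : ∀ i, metric q (fderiv ℝ (chartPatch Φ L) x (Pi.single i 1)) N = 0 := by
      intro i
      rw [(h.fderiv_chartPatch hx).fderiv]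
      exact horth _
    ext (i | i) (j | j)
    · simp [b1, hNN]
    · simp [b1, b2, metric_comm q N, b3]
    · simp [b1, b2, b3]
    · simp [b2]
  rw [hblock, Matrix.det_fromBlocks_zero₂₁, Matrix.det_one, one_mul] at hgram
  rw [areaDensity, hgram, Real.sqrt_sq (show 0 ≤ volScale B from abs_nonneg _), hvB]
  ring

theorem isPatch : IsPatch (frontier Ω) (chartPatch Φ L) (chartDomain Φ L) := by
  refine ⟨isOpen_chartDomain Φ L, ?_, ?_, fun x hx => (h.chartPatch_mem hl hx).2, ?_⟩
  · exact (h.contDiffOn_symm.of_le (by norm_num)).comp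
      (by fun_prop : ContDiff ℝ 1 fun x => L (0, x)).contDiffOn (fun x hx => hx)
  · intro x hx y hy hxy
    rw [← h.chartPatch_left_inv hl hL hx, hxy, h.chartPatch_left_inv hl hL hy]
  · intro x hx v w hvw
    have key : ∀ v, (L.symm (fderiv ℝ (chartPatch Φ L) x v)).2 = v := by
      intro v
      have h1 := (h.fderiv_chartPatch hx)
      have h2 := ((ContinuousLinearMap.snd ℝ ℝ (Fin (2 * n) → ℝ)).comp
        (L.symm : Heis n →L[ℝ] (ℝ × (Fin (2 * n) → ℝ)))).hasFDerivAt.comp x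
          h1.differentiableAt.hasFDerivAt
      have h3 : HasFDerivAt (((ContinuousLinearMap.snd ℝ ℝ (Fin (2 * n) → ℝ)).comp
        (L.symm : Heis n →L[ℝ] (ℝ × (Fin (2 * n) → ℝ)))) ∘ chartPatch Φ L)
          (ContinuousLinearMap.id ℝ (Fin (2 * n) → ℝ)) x := by
        refine (hasFDerivAt_id x).congr_of_eventuallyEq ?_
        filter_upwards [(isOpen_chartDomain Φ L).mem_nhds hx] with y hy
        exact h.chartPatch_left_inv hl hL hy
      exact congrArg (fun A : (Fin (2 * n) → ℝ) →L[ℝ] (Fin (2 * n) → ℝ) => A v) (h2.unique h3)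
    rw [← key v, hvw, key w]

end IsChart

/-- The measure on `ℍⁿ` induced by a parametrization: the image of Lebesgue measure on the domain,
weighted by the area density. -/
def patchMeasure (φ : (Fin (2 * n) → ℝ) → Heis n) (B : Set (Fin (2 * n) → ℝ)) :
    Measure (Heis n) :=
  Measure.map φ ((volume.restrict B).withDensity fun x => ENNReal.ofReal (areaDensity φ x))

theorem measurableSet_inter_preimage {φ : (Fin (2 * n) → ℝ) → Heis n} {B : Set (Fin (2 * n) → ℝ)}
    (hB : IsOpen B) (hφ : ContinuousOn φ B) {C : Set (Heis n)} (hC : MeasurableSet C) :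
    MeasurableSet (B ∩ φ ⁻¹' C) := by
  have h1 : Measurable (B.domRestrict φ) :=
    (continuousOn_iff_continuous_domRestrict.1 hφ).measurable
  have h2 : B ∩ φ ⁻¹' C = Subtype.val '' ((B.domRestrict φ) ⁻¹' C) := by
    ext x; simp [Set.domRestrict, and_comm]
  rw [h2]
  exact hB.measurableSet.subtype_image (h1 hC)

theorem aemeasurable_patch {φ : (Fin (2 * n) → ℝ) → Heis n} {B : Set (Fin (2 * n) → ℝ)}
    (hB : IsOpen B) (hφ : ContinuousOn φ B) (g : (Fin (2 * n) → ℝ) → ℝ≥0∞) :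
    AEMeasurable φ ((volume.restrict B).withDensity g) :=
  (hφ.aemeasurable hB.measurableSet).mono_ac (withDensity_absolutelyContinuous _ _)

theorem patchMeasure_apply {φ : (Fin (2 * n) → ℝ) → Heis n} {B : Set (Fin (2 * n) → ℝ)}
    (hB : IsOpen B) (hφ : ContinuousOn φ B) {C : Set (Heis n)} (hC : MeasurableSet C) :
    patchMeasure φ B C = ∫⁻ x in B ∩ φ ⁻¹' C, ENNReal.ofReal (areaDensity φ x) := by
  have hm := measurableSet_inter_preimage hB hφ hC
  rw [patchMeasure, Measure.map_apply_of_aemeasurable (aemeasurable_patch hB hφ _) hC]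
  have hnull : (volume.restrict B).withDensity
      (fun x => ENNReal.ofReal (areaDensity φ x)) Bᶜ = 0 :=
    withDensity_absolutelyContinuous _ _ (by simp [Measure.restrict_apply hB.measurableSet.compl])
  have hae : (φ ⁻¹' C : Set (Fin (2 * n) → ℝ)) =ᵐ[(volume.restrict B).withDensity
      (fun x => ENNReal.ofReal (areaDensity φ x))] (B ∩ φ ⁻¹' C : Set (Fin (2 * n) → ℝ)) := by
    have : ∀ᵐ x ∂(volume.restrict B).withDensity
      (fun x => ENNReal.ofReal (areaDensity φ x)), x ∈ B := hnull
    filter_upwards [this] with x hx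
    exact propext ⟨fun h => ⟨hx, h⟩, fun h => h.2⟩
  rw [measure_congr hae, withDensity_apply _ hm, Measure.restrict_restrict hm]
  congr 2
  rw [Set.inter_right_comm, Set.inter_self]

theorem patchMeasure_le {S : Set (Heis n)} {φ : (Fin (2 * n) → ℝ) → Heis n}
    {B : Set (Fin (2 * n) → ℝ)} (h : IsPatch S φ B) : patchMeasure φ B ≤ surfaceMeasure S :=
  le_iSup_of_le φ (le_iSup_of_le B (le_iSup_of_le h le_rfl))

theorem surfaceMeasure_compl {S : Set (Heis n)} (hS : MeasurableSet S) :
    surfaceMeasure S Sᶜ = 0 := by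
  have : surfaceMeasure S ≤ (⊤ : Measure (Heis n)).restrict S := by
    refine iSup_le fun φ => iSup_le fun B => iSup_le fun h => ?_
    refine Measure.le_iff.2 fun A hA => ?_
    change patchMeasure φ B A ≤ _
    have hc : ContinuousOn φ B := h.2.1.continuousOn
    rw [patchMeasure_apply h.1 hc hA, Measure.restrict_apply hA]
    have : B ∩ φ ⁻¹' A = B ∩ φ ⁻¹' (A ∩ S) := by
      ext x
      simp only [Set.mem_inter_iff, Set.mem_preimage]
      exact ⟨fun hx => ⟨hx.1, hx.2, h.2.2.2.1 hx.1⟩, fun hx => ⟨hx.1, hx.2.1⟩⟩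
    rw [this, ← patchMeasure_apply h.1 hc (hA.inter hS)]
    exact (le_top : patchMeasure φ B ≤ ⊤) _
  refine le_antisymm ((this _).trans ?_) bot_le
  rw [Measure.restrict_apply hS.compl]
  simp

/-- In a chart, the surface measure is the one induced by the chart parametrization: any other
parametrization factors through it by a `C¹` change of variables. -/
theorem IsChart.restrict_surfaceMeasure {Ω : Set (Heis n)} {f : Heis n → ℝ}
    {Φ : OpenPartialHomeomorph (Heis n) (Heis n)} {l : Heis n →L[ℝ] ℝ} {e : Heis n}
    (h : IsChart Ω f Φ l e) {L : (ℝ × (Fin (2 * n) → ℝ)) ≃L[ℝ] Heis n}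
    (hl : ∀ s x, l (L (s, x)) = s) (hL : ∀ s x, L (s, x) = s • e + L (0, x)) :
    (surfaceMeasure (frontier Ω)).restrict Φ.source =
      patchMeasure (chartPatch Φ L) (chartDomain Φ L) := by
  have hP := h.isPatch hl hL
  have hPc : ContinuousOn (chartPatch Φ L) (chartDomain Φ L) := hP.2.1.continuousOn
  have hOm : MeasurableSet Φ.source := Φ.open_source.measurableSet
  refine le_antisymm ?_ ?_
  · have hle : surfaceMeasure (frontier Ω) ≤
        patchMeasure (chartPatch Φ L) (chartDomain Φ L) +
          (⊤ : Measure (Heis n)).restrict Φ.sourceᶜ := by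
      refine iSup_le fun φ => iSup_le fun B => iSup_le fun hφ => ?_
      refine Measure.le_iff.2 fun A hA => ?_
      change patchMeasure φ B A ≤ _
      have hφc : ContinuousOn φ B := hφ.2.1.continuousOn
      rw [← measure_inter_add_sdiff A hOm, Measure.add_apply]
      refine add_le_add ?_ ?_
      · set C := A ∩ Φ.source with hC
        have hCm : MeasurableSet C := hA.inter hOm
        set τ : (Fin (2 * n) → ℝ) → Fin (2 * n) → ℝ := fun x => (L.symm (φ x)).2 with hτ
        set R := B ∩ φ ⁻¹' C with hR
        have hRm : MeasurableSet R := measurableSet_inter_preimage hφ.1 hφc hCm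
        have hφd : ∀ x ∈ B, HasFDerivAt φ (fderiv ℝ φ x) x := fun x hx =>
          ((hφ.2.1.contDiffAt (hφ.1.mem_nhds hx)).differentiableAt (by norm_num)).hasFDerivAt
        have hτd : ∀ x ∈ B, HasFDerivAt τ (fderiv ℝ τ x) x := fun x hx =>
          (((ContinuousLinearMap.snd ℝ ℝ (Fin (2 * n) → ℝ)).comp
            (L.symm : Heis n →L[ℝ] (ℝ × (Fin (2 * n) → ℝ)))).hasFDerivAt.comp x
              (hφd x hx)).differentiableAt.hasFDerivAt
        have hmem : ∀ x ∈ R, φ x ∈ Φ.source ∧ φ x ∈ frontier Ω := fun x hx =>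
          ⟨hx.2.2, hφ.2.2.2.1 hx.1⟩
        have hψτ : ∀ x ∈ B, φ x ∈ Φ.source → chartPatch Φ L (τ x) = φ x := fun x hx hs =>
          h.chartPatch_right_inv hl hL hs (hφ.2.2.2.1 hx)
        have hinj : Set.InjOn τ R := by
          intro x hx y hy hxy
          apply hφ.2.2.1 hx.1 hy.1
          rw [← hψτ x hx.1 hx.2.2, hxy, hψτ y hy.1 hy.2.2]
        have hdens : ∀ x ∈ R, areaDensity φ x =
            |(fderiv ℝ τ x).det| * areaDensity (chartPatch Φ L) (τ x) := by
          intro x hx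
          refine areaDensity_comp (hψτ x hx.1 hx.2.2).symm ?_
          have hτx : τ x ∈ chartDomain Φ L :=
            h.mem_chartDomain hl hL (hmem x hx).1 (hmem x hx).2
          have h1 := (h.fderiv_chartPatch hτx).differentiableAt.hasFDerivAt.comp x (hτd x hx.1)
          have h2 : φ =ᶠ[𝓝 x] chartPatch Φ L ∘ τ := by
            have ho : IsOpen (B ∩ φ ⁻¹' Φ.source) := hφc.isOpen_inter_preimage hφ.1 Φ.open_source
            filter_upwards [ho.mem_nhds ⟨hx.1, hx.2.2⟩] with y hy using (hψτ y hy.1 hy.2).symm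
          exact (h1.congr_of_eventuallyEq h2).fderiv
        refine le_trans ?_ (measure_mono (Set.inter_subset_left : C ⊆ A))
        rw [patchMeasure_apply hφ.1 hφc hCm, patchMeasure_apply hP.1 hPc hCm]
        calc ∫⁻ x in R, ENNReal.ofReal (areaDensity φ x)
            = ∫⁻ x in R, ENNReal.ofReal |(fderiv ℝ τ x).det| *
                ENNReal.ofReal (areaDensity (chartPatch Φ L) (τ x)) := by
              refine setLIntegral_congr_fun hRm fun x hx => ?_
              rw [hdens x hx, ENNReal.ofReal_mul (abs_nonneg _)]
          _ = ∫⁻ x in τ '' R, ENNReal.ofReal (areaDensity (chartPatch Φ L) x) :=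
              (lintegral_image_eq_lintegral_abs_det_fderiv_mul volume hRm
                (fun x hx => (hτd x hx.1).hasFDerivWithinAt) hinj
                (fun x => ENNReal.ofReal (areaDensity (chartPatch Φ L) x))).symm
          _ ≤ _ := by
              refine lintegral_mono_set ?_
              rintro _ ⟨x, hx, rfl⟩
              refine ⟨h.mem_chartDomain hl hL (hmem x hx).1 (hmem x hx).2, ?_⟩
              rw [Set.mem_preimage, hψτ x hx.1 hx.2.2]
              exact hx.2
      · rw [Measure.restrict_apply hA, ← Set.sdiff_eq]
        exact (le_top : patchMeasure φ B ≤ ⊤) _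
    refine (Measure.restrict_mono_measure hle _).trans ?_
    rw [Measure.restrict_add, Measure.restrict_restrict hOm, Set.inter_compl_self,
      Measure.restrict_empty, add_zero]
    exact Measure.restrict_le_self
  · refine Measure.le_iff.2 fun A hA => ?_
    rw [Measure.restrict_apply hA]
    refine le_trans (le_of_eq ?_) ((patchMeasure_le hP) _)
    rw [patchMeasure_apply hP.1 hPc hA, patchMeasure_apply hP.1 hPc (hA.inter hOm)]
    congr 2
    ext x
    simp only [Set.mem_inter_iff, Set.mem_preimage]
    exact ⟨fun hx => ⟨hx.1, hx.2, (h.chartPatch_mem hl hx.1).1⟩, fun hx => ⟨hx.1, hx.2.1⟩⟩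

end Heis

/-! ### Integration by parts and partitions of unity -/

section Parts
set_option linter.unusedSectionVars false
variable {E : Type*} [NormedAddCommGroup E] [NormedSpace ℝ E] [FiniteDimensional ℝ E]
  [MeasurableSpace E] [BorelSpace E]

/-- The integral of a derivative in the direction `v`, over a set invariant under the translations
in this direction, vanishes. -/
theorem setIntegral_fderiv_eq_zero {μ : Measure E} [μ.IsAddHaarMeasure] {S : Set E}
    (hS : MeasurableSet S) {v : E} (hv : ∀ (x : E) (t : ℝ), x + t • v ∈ S ↔ x ∈ S) {g : E → ℝ}
    (hg : ContDiff ℝ 1 g) (hc : HasCompactSupport g) : ∫ x in S, fderiv ℝ g x v ∂μ = 0 := by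
  have hg' : Continuous fun x => fderiv ℝ g x v :=
    (hg.continuous_fderiv one_ne_zero).clm_apply continuous_const
  have hgc' : HasCompactSupport fun x => fderiv ℝ g x v := by
    exact (hc.fderiv ℝ).comp_left (g := fun A : E →L[ℝ] ℝ => A v) rfl
  have hind : ∀ h : E → ℝ, (fun x => ContinuousLinearMap.mul ℝ ℝ (S.indicator (fun _ => (1 : ℝ)) x)
      (h x)) = S.indicator h := by
    intro h; ext x; by_cases hx : x ∈ S <;> simp [hx]
  have key := integral_bilinear_hasLineDerivAt_right_eq_neg_left_of_integrable (μ := μ)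
    (B := ContinuousLinearMap.mul ℝ ℝ) (v := v)
    (f := S.indicator fun _ => (1 : ℝ)) (f' := fun _ => 0) (g := g)
    (g' := fun x => fderiv ℝ g x v) (by simp)
    (by rw [hind]; exact (hg'.integrable_of_hasCompactSupport hgc').indicator hS)
    (by rw [hind]; exact (hg.continuous.integrable_of_hasCompactSupport hc).indicator hS)
    (fun x _ => by
      have : (fun t : ℝ => S.indicator (fun _ => (1 : ℝ)) (x + t • v)) =
          fun _ => S.indicator (fun _ => (1 : ℝ)) x := by
        funext t
        by_cases hx : x ∈ S
        · rw [Set.indicator_of_mem hx, Set.indicator_of_mem ((hv x t).2 hx)]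
        · rw [Set.indicator_of_notMem hx, Set.indicator_of_notMem (fun h => hx ((hv x t).1 h))]
      rw [HasLineDerivAt, this]
      exact hasDerivAt_const _ _)
    (fun x _ => (hg.differentiable one_ne_zero x).hasFDerivAt.hasLineDerivAt v)
  rw [hind] at key
  simpa [integral_indicator hS] using key

/-- A finite smooth partition of unity near a compact set, subordinate to given neighbourhoods. -/
theorem exists_finite_partition {K : Set E} (hK : IsCompact K) (O : E → Set E)
    (hO : ∀ p ∈ K, IsOpen (O p) ∧ p ∈ O p) :
    ∃ (s : Finset E) (ρ : E → E → ℝ), (∀ i ∈ s, i ∈ K) ∧ (∀ i, ContDiff ℝ 1 (ρ i)) ∧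
      (∀ i, HasCompactSupport (ρ i)) ∧ (∀ i ∈ s, tsupport (ρ i) ⊆ O i) ∧ (∀ i q, 0 ≤ ρ i q) ∧
      (∀ q, ∑ i ∈ s, ρ i q ≤ 1) ∧ ∀ᶠ q in 𝓝ˢ K, ∑ i ∈ s, ρ i q = 1 := by
  classical
  obtain ⟨s, hsK, hs⟩ := hK.elim_nhds_subcover O fun p hp => (hO p hp).1.mem_nhds (hO p hp).2
  have hopen : IsOpen (⋃ i ∈ s, O i) := isOpen_biUnion fun i hi => (hO i (hsK i hi)).1
  obtain ⟨K', hK', hKK', hK'O⟩ := exists_compact_between hK hopen hs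
  obtain ⟨R, hR⟩ := hK'.isBounded.subset_ball (0 : E)
  obtain ⟨F, hF⟩ := SmoothPartitionOfUnity.exists_isSubordinate (modelWithCornersSelf ℝ E)
    hK'.isClosed (fun i : s => O i ∩ Metric.ball 0 R)
    (fun i => (hO i (hsK i i.2)).1.inter Metric.isOpen_ball) (fun x hx => by
      obtain ⟨i, hi, hxi⟩ := Set.mem_iUnion₂.1 (hK'O hx)
      exact Set.mem_iUnion.2 ⟨⟨i, hi⟩, hxi, hR hx⟩)
  have hsum : ∀ q, ∑ i ∈ s, (if h : i ∈ s then F ⟨i, h⟩ q else 0) = ∑ᶠ i, F i q := by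
    intro q
    rw [finsum_eq_sum_of_fintype, ← Finset.sum_coe_sort s]
    exact Finset.sum_congr rfl fun i _ => by simp
  refine ⟨s, fun i q => if h : i ∈ s then F ⟨i, h⟩ q else 0, hsK, fun i => ?_, fun i => ?_,
    fun i hi => ?_, fun i q => ?_, fun q => ?_, ?_⟩
  · by_cases h : i ∈ s
    · simp only [h, dif_pos]
      exact ((F ⟨i, h⟩).contMDiff.contDiff).of_le (by exact_mod_cast le_top)
    · simp only [h, dif_neg, not_false_eq_true]; exact contDiff_const
  · by_cases h : i ∈ s
    · simp only [h, dif_pos]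
      refine (isCompact_closedBall (0 : E) R).of_isClosed_subset (isClosed_tsupport _) ?_
      exact (hF ⟨i, h⟩).trans (Set.inter_subset_right.trans Metric.ball_subset_closedBall)
    · simp only [h, dif_neg, not_false_eq_true]; exact HasCompactSupport.zero
  · simp only [hi, dif_pos]
    exact (hF ⟨i, hi⟩).trans Set.inter_subset_left
  · by_cases h : i ∈ s
    · simp only [h, dif_pos]; exact F.nonneg _ _
    · simp [h]
  · rw [hsum]; exact F.sum_le_one q
  · have : interior K' ∈ 𝓝ˢ K := isOpen_interior.mem_nhdsSet.2 hKK'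
    filter_upwards [this] with q hq
    rw [hsum]
    exact F.sum_eq_one (interior_subset hq)

end Parts

namespace Heis
variable {n : ℕ}

/-! ### The divergence theorem on a half-space -/

theorem traceCLM_eq_sum (A : Heis n →L[ℝ] Heis n) {ι : Type*} [Fintype ι]
    (b : Module.Basis ι ℝ (Heis n)) : traceCLM (Heis n) A = ∑ i, b.repr (A (b i)) i := by
  classical
  rw [traceCLM_apply, LinearMap.trace_eq_matrix_trace ℝ b, Matrix.trace]
  exact Finset.sum_congr rfl fun i _ => by simp [LinearMap.toMatrix_apply]

/-- A continuous linear functional of a `C¹` field with compact support, differentiated in a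
direction of invariance of the domain of integration. -/
theorem setIntegral_clm_fderiv_eq_zero {S : Set (Heis n)} (hS : MeasurableSet S) {v : Heis n}
    (hv : ∀ (x : Heis n) (t : ℝ), x + t • v ∈ S ↔ x ∈ S) {W : Heis n → Heis n}
    (hW : ContDiff ℝ 1 W) (hc : HasCompactSupport W) (m : Heis n →L[ℝ] ℝ) :
    ∫ x in S, m (fderiv ℝ W x v) = 0 := by
  have h1 := setIntegral_fderiv_eq_zero (μ := (volume : Measure (Heis n))) hS hv
    (g := fun x => m (W x)) (m.contDiff.comp hW) (hc.comp_left (map_zero m))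
  rw [← h1]
  congr 1
  funext x
  have := (m.hasFDerivAt.comp x (hW.differentiable one_ne_zero x).hasFDerivAt).fderiv
  change _ = fderiv ℝ (m ∘ W) x v
  rw [this]; rfl

theorem continuous_trace_fderiv {W : Heis n → Heis n} (hW : ContDiff ℝ 1 W) :
    Continuous fun x => traceCLM (Heis n) (fderiv ℝ W x) :=
  (traceCLM (Heis n)).continuous.comp (hW.continuous_fderiv one_ne_zero)

theorem hasCompactSupport_trace_fderiv {W : Heis n → Heis n} (hc : HasCompactSupport W) :
    HasCompactSupport fun x => traceCLM (Heis n) (fderiv ℝ W x) :=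
  (hc.fderiv ℝ).comp_left (map_zero _)

theorem integral_trace_fderiv {W : Heis n → Heis n} (hW : ContDiff ℝ 1 W)
    (hc : HasCompactSupport W) : ∫ x, traceCLM (Heis n) (fderiv ℝ W x) = 0 := by
  simp_rw [traceCLM_eq_sum _ (stdBasis n)]
  have hint : ∀ i, Integrable (fun x => (stdBasis n).repr (fderiv ℝ W x (stdBasis n i)) i) := by
    intro i
    let m : Heis n →L[ℝ] ℝ := LinearMap.toContinuousLinearMap ((stdBasis n).coord i)
    refine Continuous.integrable_of_hasCompactSupport
      (f := fun x => m (fderiv ℝ W x (stdBasis n i)))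
      (m.continuous.comp ((hW.continuous_fderiv one_ne_zero).clm_apply continuous_const)) ?_
    exact (hc.fderiv ℝ).comp_left (g := fun A : Heis n →L[ℝ] Heis n => m (A (stdBasis n i)))
      (by simp)
  rw [integral_finsetSum _ fun i _ => hint i]
  refine Finset.sum_eq_zero fun i _ => ?_
  have := setIntegral_clm_fderiv_eq_zero MeasurableSet.univ (v := stdBasis n i) (by simp) hW hc
    (LinearMap.toContinuousLinearMap ((stdBasis n).coord i))
  rw [setIntegral_univ] at this
  exact this

/-- The divergence theorem on a half-space. -/
theorem setIntegral_halfspace {l : Heis n →L[ℝ] ℝ} {e : Heis n}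
    {L : (ℝ × (Fin (2 * n) → ℝ)) ≃L[ℝ] Heis n} (hl : ∀ s x, l (L (s, x)) = s)
    (hL : ∀ s x, L (s, x) = s • e + L (0, x)) {W : Heis n → Heis n} (hW : ContDiff ℝ 1 W)
    (hc : HasCompactSupport W) :
    ∫ y in {y | 0 < l y}, traceCLM (Heis n) (fderiv ℝ W y) =
      -(volScale (L : (ℝ × (Fin (2 * n) → ℝ)) →ₗ[ℝ] Heis n) * ∫ x, l (W (L (0, x)))) := by
  have hS : MeasurableSet {y | 0 < l y} := measurableSet_lt measurable_const l.measurable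
  have hL0 : L ((0 : ℝ), (0 : Fin (2 * n) → ℝ)) = 0 := L.map_zero
  have hLe : L ((1 : ℝ), (0 : Fin (2 * n) → ℝ)) = e := by rw [hL, hL0]; simp
  let b : Module.Basis (Unit ⊕ Fin (2 * n)) ℝ (Heis n) := (prodBasis n).map L.toLinearEquiv
  have hb1 : ∀ u, b (Sum.inl u) = e := by intro u; simp [b, prodBasis, hLe]
  have hb2 : ∀ i, l (b (Sum.inr i)) = 0 := by intro i; simp [b, prodBasis, hl]
  let m : (Unit ⊕ Fin (2 * n)) → Heis n →L[ℝ] ℝ := fun i =>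
    LinearMap.toContinuousLinearMap (b.coord i)
  have hm1 : ∀ u, m (Sum.inl u) = l := by
    intro u
    refine ContinuousLinearMap.ext fun v => ?_
    have : m (Sum.inl u) v = (L.symm v).1 := by simp [m, b, prodBasis]
    rw [this, IsChart.symm_fst hl]
  have hint : ∀ i, IntegrableOn (fun x => m i (fderiv ℝ W x (b i))) {y | 0 < l y} := by
    intro i
    refine (Continuous.integrable_of_hasCompactSupport
      ((m i).continuous.comp ((hW.continuous_fderiv one_ne_zero).clm_apply continuous_const))
      ?_).integrableOn
    exact (hc.fderiv ℝ).comp_left (g := fun A : Heis n →L[ℝ] Heis n => m i (A (b i))) (by simp)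
  have htr : ∀ y, traceCLM (Heis n) (fderiv ℝ W y) = ∑ i, m i (fderiv ℝ W y (b i)) := fun y =>
    traceCLM_eq_sum _ b
  simp_rw [htr]
  rw [integral_finsetSum _ fun i _ => hint i, Fintype.sum_sum_type]
  have hzero : ∀ i : Fin (2 * n), ∫ y in {y | 0 < l y},
      m (Sum.inr i) (fderiv ℝ W y (b (Sum.inr i))) = 0 := fun i =>
    setIntegral_clm_fderiv_eq_zero hS (fun x t => by simp [hb2]) hW hc _
  rw [Finset.sum_eq_zero (fun i _ => hzero i), add_zero]
  simp only [Finset.univ_unique, Finset.sum_singleton, hb1, hm1]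
  -- the remaining direction is integrated first, by the fundamental theorem of calculus
  set g : ℝ × (Fin (2 * n) → ℝ) → ℝ := fun z => l (fderiv ℝ W (L z) e) with hg
  have hgc : Continuous g := l.continuous.comp
    (((hW.continuous_fderiv one_ne_zero).comp L.continuous).clm_apply continuous_const)
  have hgs : HasCompactSupport g := by
    have h1 : HasCompactSupport fun y => l (fderiv ℝ W y e) :=
      (hc.fderiv ℝ).comp_left (g := fun A : Heis n →L[ℝ] Heis n => l (A e)) (by simp)
    exact h1.comp_homeomorph L.toHomeomorph
  have h1 : ∫ y in {y | 0 < l y}, l (fderiv ℝ W y e) =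
      volScale (L : (ℝ × (Fin (2 * n) → ℝ)) →ₗ[ℝ] Heis n) *
        ∫ z in Set.Ioi (0 : ℝ) ×ˢ Set.univ, g z := by
    conv_lhs => rw [volume_eq_smul_map L]
    rw [Measure.restrict_smul, integral_smul_measure,
      ENNReal.toReal_ofReal (show 0 ≤ volScale _ from abs_nonneg _), smul_eq_mul,
      (show MeasurableEmbedding L from L.toHomeomorph.measurableEmbedding).setIntegral_map]
    rw [show L ⁻¹' {y | 0 < l y} = Set.Ioi (0 : ℝ) ×ˢ Set.univ by
      ext ⟨s, x⟩
      simp [hl]]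
  rw [h1, ← mul_neg, ← integral_neg]
  congr 1
  have hgi : Integrable g ((volume.restrict (Set.Ioi (0 : ℝ))).prod
      (volume : Measure (Fin (2 * n) → ℝ))) := by
    have : Integrable g (volume : Measure (ℝ × (Fin (2 * n) → ℝ))) :=
      hgc.integrable_of_hasCompactSupport hgs
    have h2 := this.integrableOn (s := Set.Ioi (0 : ℝ) ×ˢ Set.univ)
    rwa [IntegrableOn, Measure.volume_eq_prod, ← Measure.prod_restrict,
      Measure.restrict_univ] at h2
  rw [Measure.volume_eq_prod, ← Measure.prod_restrict, Measure.restrict_univ,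
    integral_prod_symm _ hgi]
  congr 1
  funext x
  have hcurve : ∀ s : ℝ, HasDerivAt (fun s : ℝ => L (s, x)) e s := by
    intro s
    have : (fun s : ℝ => L (s, x)) = fun s => s • e + L (0, x) := funext fun s => hL s x
    rw [this]
    simpa using ((hasDerivAt_id s).smul_const e).add_const (L (0, x))
  have hder : ∀ s : ℝ, HasDerivAt (fun s => l (W (L (s, x)))) (g (s, x)) s := by
    intro s
    exact l.hasFDerivAt.comp_hasDerivAt s
      ((hW.differentiable one_ne_zero (L (s, x))).hasFDerivAt.comp_hasDerivAt s (hcurve s))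
  have hgx : Continuous fun s : ℝ => g (s, x) := hgc.comp (by fun_prop)
  have hsupp : HasCompactSupport fun s : ℝ => l (W (L (s, x))) := by
    refine HasCompactSupport.intro (hc.image (continuous_fst.comp L.symm.continuous))
      fun s hs => ?_
    by_contra hne
    refine hs ⟨L (s, x), subset_tsupport W fun h => hne (by rw [h, map_zero]), by simp⟩
  have hgsx : HasCompactSupport fun s : ℝ => g (s, x) := by
    have := hsupp.deriv
    rwa [show deriv (fun s : ℝ => l (W (L (s, x)))) = fun s => g (s, x) from
      funext fun s => (hder s).deriv] at this
  have := integral_Ioi_of_hasDerivAt_of_tendsto (a := (0 : ℝ)) (m := 0)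
    (hder 0).continuousAt.continuousWithinAt (fun s _ => hder s)
    (hgx.integrable_of_hasCompactSupport hgsx).integrableOn
    (hsupp.is_zero_at_infty.mono_left atTop_le_cocompact)
  rw [this, zero_sub]

end Heis

namespace Heis
variable {n : ℕ}

/-! ### Integration along the boundary -/

theorem continuousOn_metric {α : Type*} [TopologicalSpace α] {s : Set α} {p v w : α → Heis n}
    (hp : ContinuousOn p s) (hv : ContinuousOn v s) (hw : ContinuousOn w s) :
    ContinuousOn (fun x => metric (p x) (v x) (w x)) s := by
  have h := (contDiff_metric (n := n) (k := 0)).continuous.comp_continuousOn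
    (hp.prodMk (hv.prodMk hw))
  refine h.congr fun x _ => ?_
  simp only [Function.comp_apply]

theorem IsPatch.continuousOn_areaDensity {S : Set (Heis n)} {φ : (Fin (2 * n) → ℝ) → Heis n}
    {B : Set (Fin (2 * n) → ℝ)} (h : IsPatch S φ B) : ContinuousOn (areaDensity φ) B := by
  have hd : ContinuousOn (fderiv ℝ φ) B := h.2.1.continuousOn_fderiv_of_isOpen h.1 le_rfl
  have hm : ContinuousOn (fun x => Matrix.of fun i j : Fin (2 * n) =>
      metric (φ x) (fderiv ℝ φ x (Pi.single i 1)) (fderiv ℝ φ x (Pi.single j 1))) B := by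
    refine continuousOn_pi.2 fun i => continuousOn_pi.2 fun j => ?_
    exact continuousOn_metric h.2.1.continuousOn (hd.clm_apply continuousOn_const)
      (hd.clm_apply continuousOn_const)
  have h2 := (Continuous.matrix_det (n := Fin (2 * n)) (R := ℝ) continuous_id).comp_continuousOn hm
  exact h2.sqrt

theorem HasC2Boundary.isLocallyFiniteMeasure {Ω : Set (Heis n)} (hΩ : HasC2Boundary Ω) :
    IsLocallyFiniteMeasure (surfaceMeasure (frontier Ω)) := by
  refine ⟨fun p => ?_⟩
  by_cases hp : p ∈ frontier Ω
  · obtain ⟨f, Φ, l, e, h, hpΦ⟩ := hΩ.exists_isChart hp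
    obtain ⟨L, hl, hL⟩ := exists_adapted l e h.apply_e
    obtain ⟨K, hKp, hKs, hK⟩ := local_compact_nhds (Φ.open_source.mem_nhds hpΦ)
    refine ⟨K, hKp, ?_⟩
    have hP := h.isPatch hl hL
    have e1 : surfaceMeasure (frontier Ω) K =
        (surfaceMeasure (frontier Ω)).restrict Φ.source K := by
      rw [Measure.restrict_apply hK.measurableSet, Set.inter_eq_left.2 hKs]
    rw [e1, h.restrict_surfaceMeasure hl hL, patchMeasure_apply hP.1 hP.2.1.continuousOn
      hK.measurableSet]
    set C := (fun q => (L.symm q).2) '' (K ∩ frontier Ω) with hC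
    have hCc : IsCompact C := (hK.inter_right isClosed_frontier).image (by fun_prop)
    have hCB : C ⊆ chartDomain Φ L := by
      rintro _ ⟨q, ⟨hq, hqf⟩, rfl⟩
      exact h.mem_chartDomain hl hL (hKs hq) hqf
    have hsub : chartDomain Φ L ∩ chartPatch Φ L ⁻¹' K ⊆ C := fun x hx =>
      ⟨chartPatch Φ L x, ⟨hx.2, (h.chartPatch_mem hl hx.1).2⟩, h.chartPatch_left_inv hl hL hx.1⟩
    refine (lintegral_mono_set hsub).trans_lt ?_
    exact ((hP.continuousOn_areaDensity.mono hCB).integrableOn_compact hCc).lintegral_lt_top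
  · refine ⟨(frontier Ω)ᶜ, isClosed_frontier.isOpen_compl.mem_nhds hp, ?_⟩
    rw [surfaceMeasure_compl isClosed_frontier.measurableSet]
    exact ENNReal.zero_lt_top

theorem surfaceMeasure_restrict_self {S : Set (Heis n)} (hS : MeasurableSet S) :
    (surfaceMeasure S).restrict S = surfaceMeasure S :=
  Measure.restrict_eq_self_of_ae_mem (by
    rw [ae_iff]; exact surfaceMeasure_compl hS)

theorem ae_mem_surfaceMeasure {S : Set (Heis n)} (hS : MeasurableSet S) :
    ∀ᵐ q ∂(surfaceMeasure S), q ∈ S := by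
  rw [ae_iff]; exact surfaceMeasure_compl hS

theorem aestronglyMeasurable_surfaceMeasure {S : Set (Heis n)} (hS : MeasurableSet S)
    {g : Heis n → ℝ} (hg : ContinuousOn g S) : AEStronglyMeasurable g (surfaceMeasure S) := by
  rw [← surfaceMeasure_restrict_self hS]
  exact hg.aestronglyMeasurable hS

theorem HasC2Boundary.integrable {Ω : Set (Heis n)} (hΩ : HasC2Boundary Ω) {g : Heis n → ℝ}
    (hg : ContinuousOn g (frontier Ω)) {K : Set (Heis n)} (hK : IsCompact K)
    (hgK : ∀ q ∈ frontier Ω, q ∉ K → g q = 0) : Integrable g (surfaceMeasure (frontier Ω)) := by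
  have := hΩ.isLocallyFiniteMeasure
  have hm : MeasurableSet (frontier Ω) := isClosed_frontier.measurableSet
  rw [← surfaceMeasure_restrict_self hm]
  have h1 : IntegrableOn g (frontier Ω ∩ K) (surfaceMeasure (frontier Ω)) :=
    (hg.mono Set.inter_subset_left).integrableOn_compact (hK.inter_left isClosed_frontier)
  exact h1.of_forall_sdiff_eq_zero hm fun q hq => hgK q hq.1 fun h => hq.2 ⟨hq.1, h⟩

theorem HasC2Boundary.continuousOn_metric_innerNormal {Ω : Set (Heis n)} (hΩ : HasC2Boundary Ω)
    {V : Heis n → Heis n} (hV : ContinuousOn V (frontier Ω)) :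
    ContinuousOn (fun q => metric q (V q) (innerNormal Ω q)) (frontier Ω) :=
  continuousOn_metric continuousOn_id hV hΩ.continuousOn_innerNormal

theorem HasC2Boundary.integrable_metric {Ω : Set (Heis n)} (hΩ : HasC2Boundary Ω)
    {V : Heis n → Heis n} (hV : Continuous V) (hc : HasCompactSupport V) :
    Integrable (fun q => metric q (V q) (innerNormal Ω q)) (surfaceMeasure (frontier Ω)) :=
  hΩ.integrable (hΩ.continuousOn_metric_innerNormal hV.continuousOn) hc fun q _ hq => by
    rw [image_eq_zero_of_notMem_tsupport hq, metric_zero_left]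

namespace IsChart
variable {Ω : Set (Heis n)} {f : Heis n → ℝ} {Φ : OpenPartialHomeomorph (Heis n) (Heis n)}
  {l : Heis n →L[ℝ] ℝ} {e : Heis n} {L : (ℝ × (Fin (2 * n) → ℝ)) ≃L[ℝ] Heis n}
  (h : IsChart Ω f Φ l e) (hl : ∀ s x, l (L (s, x)) = s)
  (hL : ∀ s x, L (s, x) = s • e + L (0, x))
include h

theorem isUnit_fderiv_symm {y : Heis n} (hy : y ∈ Φ.target) : IsUnit (fderiv ℝ Φ.symm y) := by
  have h1 := h.fderiv_symm_mul (Φ.map_target hy)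
  have h2 := h.mul_fderiv_symm (Φ.map_target hy)
  rw [Φ.right_inv hy] at h1 h2
  exact ⟨⟨_, _, h1, h2⟩, rfl⟩

theorem apply_symm {y : Heis n} (hy : y ∈ Φ.target) : f (Φ.symm y) = l y := by
  rw [← h.apply_coe (Φ.map_target hy), Φ.right_inv hy]

theorem symm_image (s : Set ℝ) :
    Φ.symm '' (Φ.target ∩ {y | l y ∈ s}) = Φ.source ∩ {q | f q ∈ s} := by
  ext q
  constructor
  · rintro ⟨y, ⟨hy, hys⟩, rfl⟩
    exact ⟨Φ.map_target hy, by simpa [h.apply_symm hy] using hys⟩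
  · rintro ⟨hq, hqs⟩
    exact ⟨Φ q, ⟨Φ.map_source hq, by simpa [h.apply_coe hq] using hqs⟩, Φ.left_inv hq⟩

theorem volume_source_inter_frontier : volume (Φ.source ∩ frontier Ω) = 0 := by
  have e1 : Φ.source ∩ frontier Ω = Φ.symm '' (Φ.target ∩ {y | l y ∈ ({0} : Set ℝ)}) := by
    rw [h.symm_image]
    ext q
    exact and_congr_right fun hq => h.mem_frontier_iff q hq
  rw [e1]
  refine addHaar_image_eq_zero_of_differentiableOn_of_addHaar_eq_zero volume
    ((h.contDiffOn_symm.differentiableOn (by norm_num)).mono Set.inter_subset_left) ?_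
  refine measure_mono_null Set.inter_subset_right ?_
  have hne : LinearMap.ker (l : Heis n →ₗ[ℝ] ℝ) ≠ ⊤ := fun ht => by
    have : e ∈ LinearMap.ker (l : Heis n →ₗ[ℝ] ℝ) := ht ▸ Submodule.mem_top
    have h0 : l e = 0 := this
    exact one_ne_zero (h.apply_e.symm.trans h0)
  exact Measure.addHaar_submodule volume _ hne

/-- Integrals along the boundary of functions supported in a chart. -/
theorem integral_surfaceMeasure {g : Heis n → ℝ} (hg : ContinuousOn g (frontier Ω))
    (hs : ∀ q, q ∉ Φ.source → g q = 0) (hl : ∀ s x, l (L (s, x)) = s)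
    (hL : ∀ s x, L (s, x) = s • e + L (0, x)) :
    ∫ q, g q ∂(surfaceMeasure (frontier Ω)) =
      ∫ x in chartDomain Φ L, areaDensity (chartPatch Φ L) x * g (chartPatch Φ L x) := by
  have hP := h.isPatch hl hL
  have hgm : AEStronglyMeasurable g (patchMeasure (chartPatch Φ L) (chartDomain Φ L)) :=
    (aestronglyMeasurable_surfaceMeasure isClosed_frontier.measurableSet hg).mono_measure
      (patchMeasure_le hP)
  rw [← setIntegral_eq_integral_of_forall_compl_eq_zero hs, h.restrict_surfaceMeasure hl hL]
  rw [patchMeasure] at hgm ⊢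
  rw [integral_map (aemeasurable_patch hP.1 hP.2.1.continuousOn _) hgm,
    integral_withDensity_eq_integral_toReal_smul₀
      (hP.continuousOn_areaDensity.aemeasurable hP.1.measurableSet).ennreal_ofReal
      (Eventually.of_forall fun _ => ENNReal.ofReal_lt_top)]
  refine integral_congr_ae (Eventually.of_forall fun x => ?_)
  simp only [smul_eq_mul]
  rw [ENNReal.toReal_ofReal (show 0 ≤ areaDensity _ _ from Real.sqrt_nonneg _)]

/-! ### The divergence theorem -/

/-- The divergence theorem for fields supported in a chart, by the Piola transform to a
half-space. -/
theorem setIntegral_trace_fderiv (hΩ : HasC2Boundary Ω) (hm : MeasurableSet Ω) {V : Heis n → Heis n}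
    (hV : ContDiff ℝ 1 V) (hc : HasCompactSupport V) (hs : tsupport V ⊆ Φ.source) :
    ∫ p in Ω, traceCLM (Heis n) (fderiv ℝ V p) =
      -∫ q, metric q (V q) (innerNormal Ω q) ∂(surfaceMeasure (frontier Ω)) := by
  classical
  obtain ⟨L, hl, hL⟩ := exists_adapted l e h.apply_e
  have hzero : ∀ q, q ∉ Φ.source → V q = 0 := fun q hq =>
    image_eq_zero_of_notMem_tsupport fun h' => hq (hs h')
  have hzero' : ∀ q, q ∉ tsupport V → traceCLM (Heis n) (fderiv ℝ V q) = 0 := fun q hq => by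
    rw [image_eq_zero_of_notMem_tsupport (f := fderiv ℝ V)
      (fun h' => hq (tsupport_fderiv_subset ℝ h')), map_zero]
  set W : Heis n → Heis n := fun y => if y ∈ Φ.target then
    piola (fderiv ℝ Φ.symm y) (V (Φ.symm y)) else 0 with hWdef
  have hWt : ∀ y ∈ Φ.target, W y = piola (fderiv ℝ Φ.symm y) (V (Φ.symm y)) := fun y hy =>
    if_pos hy
  have hKc : IsCompact (Φ '' tsupport V) := hc.image_of_continuousOn (Φ.continuousOn.mono hs)
  have hW0 : ∀ y ∉ Φ '' tsupport V, W y = 0 := by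
    intro y hy
    by_cases hyt : y ∈ Φ.target
    · rw [hWt y hyt, image_eq_zero_of_notMem_tsupport (f := V) (x := Φ.symm y), map_zero]
      exact fun h' => hy ⟨_, h', Φ.right_inv hyt⟩
    · exact if_neg hyt
  have hWc : HasCompactSupport W := HasCompactSupport.intro hKc hW0
  have hWev : ∀ y ∈ Φ.target, W =ᶠ[𝓝 y] fun y => piola (fderiv ℝ Φ.symm y) (V (Φ.symm y)) :=
    fun y hy => by filter_upwards [Φ.open_target.mem_nhds hy] with z hz using hWt z hz
  have hW : ContDiff ℝ 1 W := by
    rw [contDiff_iff_contDiffAt]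
    intro y
    by_cases hy : y ∈ Φ.target
    · refine ContDiffAt.congr_of_eventuallyEq ?_ (hWev y hy)
      have h1 : ContDiffAt ℝ 1 (fderiv ℝ Φ.symm) y :=
        (h.contDiffAt_symm hy).fderiv_right (by norm_num)
      exact ((contDiffAt_piola (h.isUnit_fderiv_symm hy)).comp y h1).clm_apply
        (hV.contDiffAt.comp y ((h.contDiffAt_symm hy).of_le (by norm_num)))
    · have : W =ᶠ[𝓝 y] fun _ => 0 := by
        have hyK : y ∉ Φ '' tsupport V := by
          rintro ⟨q, hq, rfl⟩; exact hy (Φ.map_source (hs hq))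
        filter_upwards [hKc.isClosed.isOpen_compl.mem_nhds hyK] with z hz using hW0 z hz
      exact contDiffAt_const.congr_of_eventuallyEq this
  have hdiv : ∀ y ∈ Φ.target, traceCLM (Heis n) (fderiv ℝ W y) =
      |(fderiv ℝ Φ.symm y).det| * traceCLM (Heis n) (fderiv ℝ V (Φ.symm y)) := by
    intro y hy
    rw [(hWev y hy).fderiv_eq]
    exact trace_fderiv_piola (h.contDiffAt_symm hy) (h.isUnit_fderiv_symm hy)
      (hV.differentiable one_ne_zero _)
  have hhalf : MeasurableSet {y : Heis n | 0 < l y} :=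
    measurableSet_lt measurable_const l.measurable
  -- reduce to `{f > 0}`, transport to the half-space
  have e1 : ∫ p in Ω, traceCLM (Heis n) (fderiv ℝ V p) =
      ∫ p in Φ.source ∩ {q | f q ∈ Set.Ioi (0 : ℝ)}, traceCLM (Heis n) (fderiv ℝ V p) := by
    rw [setIntegral_eq_of_subset_of_forall_sdiff_eq_zero hm
      (Set.inter_subset_left : Ω ∩ Φ.source ⊆ Ω)
      fun q hq => hzero' q fun h' => hq.2 ⟨hq.1, hs h'⟩]
    refine setIntegral_congr_set ?_
    have hnull := h.volume_source_inter_frontier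
    have : ∀ᵐ q : Heis n, q ∉ Φ.source ∩ frontier Ω := by
      rw [ae_iff]; simpa using hnull
    filter_upwards [this] with q hq
    refine propext ⟨fun hqΩ => ⟨hqΩ.2, ?_⟩, fun hq' => ⟨h.mem_of_pos q hq'.1 hq'.2, hq'.1⟩⟩
    by_contra hf
    rcases (not_lt.1 (show ¬ 0 < f q from hf)).lt_or_eq with h' | h'
    · exact h.notMem_of_neg q hqΩ.2 h' hqΩ.1
    · exact hq ⟨hqΩ.2, (h.mem_frontier_iff q hqΩ.2).2 h'⟩
  have e3 : ∫ p in Φ.source ∩ {q | f q ∈ Set.Ioi (0 : ℝ)}, traceCLM (Heis n) (fderiv ℝ V p) =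
      ∫ y in {y | 0 < l y}, traceCLM (Heis n) (fderiv ℝ W y) := by
    rw [← h.symm_image]
    change ∫ p in Φ.symm '' (Φ.target ∩ {y | 0 < l y}), _ = _
    rw [integral_image_eq_integral_abs_det_fderiv_smul volume
      (Φ.open_target.measurableSet.inter hhalf)
      (fun y hy => (h.hasFDerivAt_symm hy.1).hasFDerivWithinAt)
      (Φ.symm.injOn.mono Set.inter_subset_left)]
    rw [setIntegral_eq_of_subset_of_forall_sdiff_eq_zero (t := {y | 0 < l y})
      (s := Φ.target ∩ {y | 0 < l y}) hhalf Set.inter_subset_right]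
    · refine setIntegral_congr_fun (Φ.open_target.measurableSet.inter hhalf) fun y hy => ?_
      simp only [smul_eq_mul]
      exact (hdiv y hy.1).symm
    · intro y hy
      have : y ∉ tsupport (fderiv ℝ W) := by
        intro h'
        have h2 : y ∈ Φ '' tsupport V :=
          closure_minimal (fun z hz => by_contra fun h3 =>
            (Function.mem_support.1 hz) (hW0 z h3)) hKc.isClosed
            (tsupport_fderiv_subset ℝ h')
        obtain ⟨q, hq, rfl⟩ := h2
        exact hy.2 ⟨Φ.map_source (hs hq), hy.1⟩
      rw [image_eq_zero_of_notMem_tsupport this, map_zero]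
  rw [e1, e3, setIntegral_halfspace hl hL hW hWc,
    h.integral_surfaceMeasure (hΩ.continuousOn_metric_innerNormal hV.continuous.continuousOn)
      (fun q hq => by rw [hzero q hq, metric_zero_left])
      hl hL]
  congr 1
  rw [← setIntegral_eq_integral_of_forall_compl_eq_zero (s := chartDomain Φ L) (f := fun x =>
    l (W (L (0, x)))) (fun x hx => by rw [show W (L (0, x)) = 0 from if_neg hx, map_zero]),
    ← integral_const_mul]
  refine setIntegral_congr_fun (isOpen_chartDomain Φ L).measurableSet fun x hx => ?_
  have hx' : L (0, x) ∈ Φ.target := hx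
  have hmem := h.chartPatch_mem hl hx
  rw [h.areaDensity_chartPatch hl hL hx, h.metric_innerNormal hmem.1 hmem.2, hWt _ hx']
  have hg := (h.len_grad_pos hmem.1).ne'
  have hu := h.isUnit_fderiv_symm hx'
  have h4 : l (piola (fderiv ℝ Φ.symm (L (0, x))) (V (chartPatch Φ L x))) =
      |(fderiv ℝ Φ.symm (L (0, x))).det| *
        fderiv ℝ f (chartPatch Φ L x) (V (chartPatch Φ L x)) := by
    have h5 := h.fderiv_fderiv_symm hx'
      (Ring.inverse (fderiv ℝ Φ.symm (L (0, x))) (V (chartPatch Φ L x)))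
    have h6 : fderiv ℝ Φ.symm (L (0, x))
        (Ring.inverse (fderiv ℝ Φ.symm (L (0, x))) (V (chartPatch Φ L x))) =
        V (chartPatch Φ L x) := by
      have := Ring.mul_inverse_cancel _ hu
      exact congrArg (fun A : Heis n →L[ℝ] Heis n => A (V (chartPatch Φ L x))) this
    rw [h6] at h5
    rw [piola, smul_apply, map_smul, smul_eq_mul, ← h5]
    rfl
  rw [show V (Φ.symm (L (0, x))) = V (chartPatch Φ L x) from rfl, h4]
  field_simp

end IsChart

/-- The divergence theorem on `Ω`; the normal points inwards, which is where the sign comes from. -/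
theorem HasC2Boundary.setIntegral_trace_fderiv {Ω : Set (Heis n)} (hΩ : HasC2Boundary Ω)
    (hm : MeasurableSet Ω) {V : Heis n → Heis n} (hV : ContDiff ℝ 1 V)
    (hc : HasCompactSupport V) :
    ∫ p in Ω, traceCLM (Heis n) (fderiv ℝ V p) =
      -∫ q, metric q (V q) (innerNormal Ω q) ∂(surfaceMeasure (frontier Ω)) := by
  classical
  -- the fields supported in one of these neighbourhoods satisfy the theorem
  have hloc : ∀ p, ∃ O : Set (Heis n), IsOpen O ∧ p ∈ O ∧ ∀ V : Heis n → Heis n, ContDiff ℝ 1 V →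
      HasCompactSupport V → tsupport V ⊆ O → ∫ p in Ω, traceCLM (Heis n) (fderiv ℝ V p) =
        -∫ q, metric q (V q) (innerNormal Ω q) ∂(surfaceMeasure (frontier Ω)) := by
    intro p
    by_cases hp : p ∈ frontier Ω
    · obtain ⟨f, Φ, l, e, h, hpΦ⟩ := hΩ.exists_isChart hp
      exact ⟨Φ.source, Φ.open_source, hpΦ, fun V hV hc hs =>
        h.setIntegral_trace_fderiv hΩ hm hV hc hs⟩
    have hbd : ∀ V : Heis n → Heis n, Disjoint (tsupport V) (frontier Ω) →
        ∫ q, metric q (V q) (innerNormal Ω q) ∂(surfaceMeasure (frontier Ω)) = 0 := by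
      intro V hd
      refine integral_eq_zero_of_ae ?_
      filter_upwards [ae_mem_surfaceMeasure (isClosed_frontier (s := Ω)).measurableSet] with q hq
      rw [image_eq_zero_of_notMem_tsupport fun h => Set.disjoint_left.1 hd h hq, metric_zero_left]
      rfl
    have hz : ∀ V : Heis n → Heis n, ∀ q, q ∉ tsupport V →
        traceCLM (Heis n) (fderiv ℝ V q) = 0 := fun V q hq => by
      rw [image_eq_zero_of_notMem_tsupport (f := fderiv ℝ V)
        (fun h' => hq (tsupport_fderiv_subset ℝ h')), map_zero]
    by_cases hpi : p ∈ interior Ω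
    · refine ⟨interior Ω, isOpen_interior, hpi, fun V hV hc hs => ?_⟩
      rw [hbd V (Set.disjoint_left.2 fun q hq hqf => hqf.2 (hs hq)), neg_zero,
        setIntegral_eq_integral_of_forall_compl_eq_zero fun q hq => hz V q fun h' =>
          hq (interior_subset (hs h')), integral_trace_fderiv hV hc]
    · refine ⟨(closure Ω)ᶜ, isClosed_closure.isOpen_compl, fun h' => hp ⟨h', hpi⟩,
        fun V hV hc hs => ?_⟩
      rw [hbd V (Set.disjoint_left.2 fun q hq hqf => hs hq hqf.1), neg_zero]
      exact setIntegral_eq_zero_of_forall_eq_zero fun q hq => hz V q fun h' =>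
        hs h' (subset_closure hq)
  choose O hO hpO hOV using hloc
  obtain ⟨s, ρ, -, hρ, hρc, hρs, -, -, hρ1⟩ := exists_finite_partition hc O
    fun p _ => ⟨hO p, hpO p⟩
  have hsum : V = fun q => ∑ i ∈ s, ρ i q • V q := by
    funext q
    rw [← Finset.sum_smul]
    by_cases hq : q ∈ tsupport V
    · rw [hρ1.self_of_nhdsSet q hq, one_smul]
    · rw [image_eq_zero_of_notMem_tsupport hq, smul_zero]
  have hVi : ∀ i, ContDiff ℝ 1 fun q => ρ i q • V q := fun i => (hρ i).smul hV
  have hVc : ∀ i, HasCompactSupport fun q => ρ i q • V q := fun i => (hρc i).smul_right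
  have h1 : ∀ p, traceCLM (Heis n) (fderiv ℝ V p) =
      ∑ i ∈ s, traceCLM (Heis n) (fderiv ℝ (fun q => ρ i q • V q) p) := by
    intro p
    conv_lhs => rw [hsum]
    rw [fderiv_fun_sum fun i _ => (hVi i).differentiable one_ne_zero p, map_sum]
  have h2 : ∀ q, metric q (V q) (innerNormal Ω q) =
      ∑ i ∈ s, metric q (ρ i q • V q) (innerNormal Ω q) := by
    intro q
    conv_lhs => rw [hsum]
    exact metric_sum_left _ _ _ _
  simp_rw [h1, h2]
  rw [integral_finsetSum _ fun i _ => hΩ.integrable_metric (hVi i).continuous (hVc i),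
    integral_finsetSum _ fun i _ =>
      ((continuous_trace_fderiv (hVi i)).integrable_of_hasCompactSupport
      (hasCompactSupport_trace_fderiv (hVc i))).integrableOn, ← Finset.sum_neg_distrib]
  exact Finset.sum_congr rfl fun i hi => hOV i _ (hVi i) (hVc i)
    ((tsupport_smul_subset_left _ _).trans (hρs i hi))

end Heis

/-! ### Mollification -/

section Mollification
variable {E : Type*} [NormedAddCommGroup E] [NormedSpace ℝ E] [FiniteDimensional ℝ E]
open scoped Convolution

/-- `C¹` maps with compact support are limits of `C²` maps in the `C¹` topology, with supports in a
common compact set. -/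
theorem exists_contDiff_two_approx {ψ : E → E} (hψ : ContDiff ℝ 1 ψ) (hc : HasCompactSupport ψ)
    {ε : ℝ} (hε : 0 < ε) :
    ∃ g : E → E, ContDiff ℝ 2 g ∧ (∀ x ∉ Metric.cthickening 1 (tsupport ψ), g x = 0) ∧
      (∀ x, ‖g x - ψ x‖ ≤ ε) ∧ ∀ x, ‖fderiv ℝ g x - fderiv ℝ ψ x‖ ≤ ε := by
  borelize E
  let μ : Measure E := Measure.addHaar
  have hd : Continuous (fderiv ℝ ψ) := hψ.continuous_fderiv one_ne_zero
  obtain ⟨δ₁, hδ₁, h₁⟩ := Metric.uniformContinuous_iff.1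
    (hc.uniformContinuous_of_continuous hψ.continuous) ε hε
  obtain ⟨δ₂, hδ₂, h₂⟩ := Metric.uniformContinuous_iff.1
    ((hc.fderiv ℝ).uniformContinuous_of_continuous hd) ε hε
  obtain ⟨r, hr, hr1⟩ : ∃ r : ℝ, 0 < r ∧ r ≤ δ₁ ∧ r ≤ δ₂ ∧ r ≤ 1 :=
    ⟨min δ₁ (min δ₂ 1), by positivity, min_le_left _ _,
      (min_le_right _ _).trans (min_le_left _ _), (min_le_right _ _).trans (min_le_right _ _)⟩
  let φ : ContDiffBump (0 : E) := ⟨r / 2, r, half_pos hr, half_lt_self hr⟩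
  have hφi : LocallyIntegrable (φ.normed μ) μ := φ.continuous_normed.locallyIntegrable
  have hψi : LocallyIntegrable ψ μ := hψ.continuous.locallyIntegrable
  have hder : ∀ x, fderiv ℝ (φ.normed μ ⋆[ContinuousLinearMap.lsmul ℝ ℝ, μ] ψ) x =
      (φ.normed μ ⋆[ContinuousLinearMap.lsmul ℝ ℝ, μ] fderiv ℝ ψ) x := by
    intro x
    rw [(hc.hasFDerivAt_convolution_right (ContinuousLinearMap.lsmul ℝ ℝ) hφi hψ x).fderiv]
    rfl
  refine ⟨φ.normed μ ⋆[ContinuousLinearMap.lsmul ℝ ℝ, μ] ψ, ?_, fun x hx => ?_, fun x => ?_,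
    fun x => ?_⟩
  · exact φ.hasCompactSupport_normed.contDiff_convolution_left _ φ.contDiff_normed hψi
  · have h0 : ∀ y ∈ Metric.ball x φ.rOut, dist (ψ y) (ψ x) ≤ 0 := by
      intro y hy
      have hz : ∀ z ∈ Metric.ball x r, ψ z = 0 := fun z hz =>
        image_eq_zero_of_notMem_tsupport fun hzs => hx
          (Metric.mem_cthickening_of_dist_le x z 1 _ hzs
            (by rw [dist_comm]; exact (Metric.mem_ball.1 hz).le.trans hr1.2.2))
      rw [hz y hy, hz x (Metric.mem_ball_self hr), dist_self]
    have := φ.dist_normed_convolution_le (μ := μ) hψi.aestronglyMeasurable h0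
    rw [dist_le_zero.1 this]
    exact image_eq_zero_of_notMem_tsupport fun h => hx (Metric.self_subset_cthickening _ h)
  · rw [← dist_eq_norm]
    exact φ.dist_normed_convolution_le hψi.aestronglyMeasurable fun y hy =>
      (h₁ ((Metric.mem_ball.1 hy).trans_le hr1.1)).le
  · rw [hder, ← dist_eq_norm]
    exact φ.dist_normed_convolution_le hd.aestronglyMeasurable fun y hy =>
      (h₂ ((Metric.mem_ball.1 hy).trans_le hr1.2.1)).le

theorem exists_seq_contDiff_two {ψ : E → E} (hψ : ContDiff ℝ 1 ψ) (hc : HasCompactSupport ψ) :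
    ∃ (K : Set E) (g : ℕ → E → E), IsCompact K ∧ tsupport ψ ⊆ K ∧ (∀ k, ContDiff ℝ 2 (g k)) ∧
      (∀ k, ∀ x ∉ K, g k x = 0) ∧ (∀ k x, ‖g k x - ψ x‖ ≤ 1 / ((k : ℝ) + 1)) ∧
      ∀ k x, ‖fderiv ℝ (g k) x - fderiv ℝ ψ x‖ ≤ 1 / ((k : ℝ) + 1) := by
  choose g h1 h2 h3 h4 using fun k : ℕ =>
    exists_contDiff_two_approx hψ hc (Nat.one_div_pos_of_nat (α := ℝ) (n := k))
  exact ⟨Metric.cthickening 1 (tsupport ψ), g, hc.cthickening,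
    Metric.self_subset_cthickening _, h1, h2, h3, h4⟩

theorem tendsto_of_norm_sub_le_one_div {F : Type*} [NormedAddCommGroup F] {a : ℕ → F} {b : F}
    (h : ∀ k, ‖a k - b‖ ≤ 1 / ((k : ℝ) + 1)) : Tendsto a atTop (𝓝 b) :=
  tendsto_iff_norm_sub_tendsto_zero.2
    (squeeze_zero (fun _ => norm_nonneg _) h tendsto_one_div_add_atTop_nhds_zero_nat)

theorem tendsto_clm_apply {F G : Type*} [NormedAddCommGroup F] [NormedSpace ℝ F]
    [NormedAddCommGroup G] [NormedSpace ℝ G] {ι : Type*} {f : Filter ι} {A : ι → F →L[ℝ] G}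
    {A' : F →L[ℝ] G} {v : ι → F} {v' : F} (hA : Tendsto A f (𝓝 A')) (hv : Tendsto v f (𝓝 v')) :
    Tendsto (fun k => A k (v k)) f (𝓝 (A' v')) :=
  ((isBoundedBilinearMap_apply (𝕜 := ℝ) (E := F) (F := G)).continuous.tendsto (A', v')).comp
    (hA.prodMk_nhds hv)

/-- Maps close to the identity are invertible, with bounds on the determinant and on the Piola
transform. -/
theorem exists_bound_piola : ∃ C : ℝ, 0 ≤ C ∧ ∀ A : E →L[ℝ] E, ‖A - 1‖ ≤ 3 / 4 →
    IsUnit A ∧ |A.det| ≤ C ∧ ‖piola A‖ ≤ C := by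
  have hunit : ∀ A : E →L[ℝ] E, ‖A - 1‖ ≤ 3 / 4 → IsUnit A := by
    intro A hA
    have : IsUnit (1 - (1 - A)) := isUnit_one_sub_of_norm_lt_one (by
      rw [norm_sub_rev]; linarith)
    simpa using this
  have hK : IsCompact (Metric.closedBall (1 : E →L[ℝ] E) (3 / 4)) := isCompact_closedBall _ _
  have hmem : ∀ A : E →L[ℝ] E, A ∈ Metric.closedBall (1 : E →L[ℝ] E) (3 / 4) ↔
      ‖A - 1‖ ≤ 3 / 4 := fun A => by rw [Metric.mem_closedBall, dist_eq_norm]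
  obtain ⟨C₁, hC₁⟩ := hK.exists_bound_of_continuousOn (f := fun A : E →L[ℝ] E => A.det)
    (contDiff_clm_det (E := E) (k := 0)).continuous.continuousOn
  obtain ⟨C₂, hC₂⟩ := hK.exists_bound_of_continuousOn (f := (piola : (E →L[ℝ] E) → _))
    fun A hA => (contDiffAt_piola (hunit A ((hmem A).1 hA))).continuousAt.continuousWithinAt
  refine ⟨max 0 (max C₁ C₂), le_max_left _ _, fun A hA => ⟨hunit A hA, ?_, ?_⟩⟩
  · exact (hC₁ A ((hmem A).2 hA)).trans ((le_max_left _ _).trans (le_max_right _ _))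
  · exact (hC₂ A ((hmem A).2 hA)).trans ((le_max_right _ _).trans (le_max_right _ _))

end Mollification

namespace Heis
variable {n : ℕ}

/-! ### Fluxes of fields of class `C¹` -/

theorem exists_len_le {K : Set (Heis n)} (hK : IsCompact K) :
    ∃ C : ℝ, 0 ≤ C ∧ ∀ q ∈ K, ∀ v, len q v ≤ C * ‖v‖ := by
  obtain ⟨C, hC⟩ := (hK.prod (isCompact_closedBall (0 : Heis n) 1)).exists_bound_of_continuousOn
    (continuous_len (n := n)).continuousOn
  refine ⟨max C 0, le_max_right _ _, fun q hq v => ?_⟩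
  rcases eq_or_ne v 0 with rfl | hv
  · rw [len_eq_zero_iff.2 rfl, norm_zero, mul_zero]
  · have h1 := hC (q, ‖v‖⁻¹ • v) ⟨hq, by
      rw [mem_closedBall_zero_iff, norm_smul, norm_inv, norm_norm, inv_mul_cancel₀
        (norm_ne_zero_iff.2 hv)]⟩
    simp only at h1
    rw [len_smul, Real.norm_eq_abs, abs_mul, abs_abs, abs_of_nonneg (len_nonneg _ _),
      abs_of_nonneg (inv_nonneg.2 (norm_nonneg _)), inv_mul_le_iff₀ (norm_pos_iff.2 hv)] at h1
    calc len q v ≤ ‖v‖ * C := h1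
      _ ≤ max C 0 * ‖v‖ := by
        rw [mul_comm]; exact mul_le_mul_of_nonneg_right (le_max_left _ _) (norm_nonneg _)

theorem HasC2Boundary.abs_metric_innerNormal_le {Ω : Set (Heis n)} (hΩ : HasC2Boundary Ω)
    {q : Heis n} (hq : q ∈ frontier Ω) (v : Heis n) :
    |metric q v (innerNormal Ω q)| ≤ len q v := by
  simpa [hΩ.len_innerNormal hq] using abs_metric_le q v (innerNormal Ω q)

/-- Dominated convergence for flux integrals. -/
theorem HasC2Boundary.tendsto_integral_metric {Ω : Set (Heis n)} (hΩ : HasC2Boundary Ω)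
    {Z : ℕ → Heis n → Heis n} {Z' : Heis n → Heis n} (hZ : ∀ k, Continuous (Z k))
    {K : Set (Heis n)} (hK : IsCompact K) (h0 : ∀ k, ∀ q ∉ K, Z k q = 0) {C : ℝ}
    (hC : ∀ k, ∀ q ∈ K, ‖Z k q‖ ≤ C) (hlim : ∀ q, Tendsto (fun k => Z k q) atTop (𝓝 (Z' q))) :
    Tendsto (fun k => ∫ q, metric q (Z k q) (innerNormal Ω q) ∂(surfaceMeasure (frontier Ω))) atTop
      (𝓝 (∫ q, metric q (Z' q) (innerNormal Ω q) ∂(surfaceMeasure (frontier Ω)))) := by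
  have := hΩ.isLocallyFiniteMeasure
  have hm : MeasurableSet (frontier Ω) := isClosed_frontier.measurableSet
  obtain ⟨C', hC', hlen⟩ := exists_len_le hK
  refine tendsto_integral_of_dominated_convergence (K.indicator fun _ => C' * C)
    (fun k => aestronglyMeasurable_surfaceMeasure hm
      (hΩ.continuousOn_metric_innerNormal (hZ k).continuousOn)) ?_ (fun k => ?_) ?_
  · rw [integrable_indicator_iff hK.measurableSet]
    exact integrableOn_const hK.measure_lt_top.ne
  · filter_upwards [ae_mem_surfaceMeasure hm] with q hq
    by_cases hqK : q ∈ K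
    · rw [Set.indicator_of_mem hqK, Real.norm_eq_abs]
      exact (hΩ.abs_metric_innerNormal_le hq _).trans ((hlen q hqK _).trans
        (mul_le_mul_of_nonneg_left (hC k q hqK) hC'))
    · rw [Set.indicator_of_notMem hqK, h0 k q hqK, metric_zero_left, norm_zero]
  · refine Eventually.of_forall fun q => ?_
    have hc : Continuous fun v : Heis n => metric q v (innerNormal Ω q) := by
      rw [← continuousOn_univ]
      exact continuousOn_metric continuousOn_const continuousOn_id continuousOn_const
    exact (hc.tendsto _).comp (hlim q)

/-- The flux of the Piola transform of a field: both sides are the integral of `div V` over the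
image of `Ω` under `φ`. -/
theorem HasC2Boundary.setIntegral_transport {Ω : Set (Heis n)} (hΩ : HasC2Boundary Ω)
    (hm : MeasurableSet Ω) {φ : Heis n → Heis n} (hφ : ContDiff ℝ 1 φ)
    (hφc : HasCompactSupport fun q => φ q - q) (hφ1 : ∀ q, ‖fderiv ℝ φ q - 1‖ ≤ 1 / 2)
    {V : Heis n → Heis n} (hV : ContDiff ℝ 1 V) (hc : HasCompactSupport V) :
    ∫ p in Ω, |(fderiv ℝ φ p).det| * traceCLM (Heis n) (fderiv ℝ V (φ p)) =
      -∫ q, metric q (piola (fderiv ℝ φ q) (V (φ q))) (innerNormal Ω q)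
        ∂(surfaceMeasure (frontier Ω)) := by
  obtain ⟨C, hC0, hC⟩ := exists_bound_piola (E := Heis n)
  have hψ : ContDiff ℝ 1 fun q => φ q - q := hφ.sub contDiff_id
  obtain ⟨K, g, hK, hψK, hg2, hgK, hg, hg'⟩ := exists_seq_contDiff_two hψ hφc
  have hdψ : ∀ q, fderiv ℝ (fun q => φ q - q) q = fderiv ℝ φ q - 1 := by
    intro q
    exact ((hφ.differentiable one_ne_zero q).hasFDerivAt.sub (hasFDerivAt_id q)).fderiv
  -- the smooth approximations of `φ`
  set Φ : ℕ → Heis n → Heis n := fun k q => q + g (k + 3) q with hΦ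
  have hΦ2 : ∀ k, ContDiff ℝ 2 (Φ k) := fun k => contDiff_id.add (hg2 _)
  have hdΦ : ∀ k q, fderiv ℝ (Φ k) q = 1 + fderiv ℝ (g (k + 3)) q := by
    intro k q
    exact ((hasFDerivAt_id q).add ((hg2 _).differentiable (by norm_num) q).hasFDerivAt).fderiv
  have hΦlim : ∀ q, Tendsto (fun k => Φ k q) atTop (𝓝 (φ q)) := by
    intro q
    have := (tendsto_of_norm_sub_le_one_div fun k => hg k q).comp (tendsto_add_atTop_nat 3)
    simpa using this.const_add q
  have hdΦlim : ∀ q, Tendsto (fun k => fderiv ℝ (Φ k) q) atTop (𝓝 (fderiv ℝ φ q)) := by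
    intro q
    have := (tendsto_of_norm_sub_le_one_div fun k => hg' k q).comp (tendsto_add_atTop_nat 3)
    rw [hdψ] at this
    simp_rw [hdΦ]
    simpa using this.const_add 1
  have hdΦ1 : ∀ k q, ‖fderiv ℝ (Φ k) q - 1‖ ≤ 3 / 4 := by
    intro k q
    have h1 := hg' (k + 3) q
    rw [hdψ] at h1
    have h2 : (1 : ℝ) / (((k + 3 : ℕ) : ℝ) + 1) ≤ 1 / 4 := by
      apply one_div_le_one_div_of_le (by norm_num)
      push_cast
      linarith [(Nat.cast_nonneg k : (0 : ℝ) ≤ k)]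
    rw [hdΦ, add_sub_cancel_left]
    calc ‖fderiv ℝ (g (k + 3)) q‖ = ‖(fderiv ℝ (g (k + 3)) q - (fderiv ℝ φ q - 1)) +
          (fderiv ℝ φ q - 1)‖ := by rw [sub_add_cancel]
      _ ≤ 1 / 4 + 1 / 2 := (norm_add_le _ _).trans (add_le_add (h1.trans h2) (hφ1 q))
      _ = 3 / 4 := by norm_num
  have hKV : IsCompact (K ∪ tsupport V) := hK.union hc
  have hΦid : ∀ k, ∀ q ∉ K ∪ tsupport V, V (Φ k q) = 0 ∧ fderiv ℝ V (Φ k q) = 0 := by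
    intro k q hq
    have : Φ k q = q := by rw [hΦ]; simp [hgK _ q fun h => hq (Or.inl h)]
    rw [this]
    exact ⟨image_eq_zero_of_notMem_tsupport fun h => hq (Or.inr h),
      image_eq_zero_of_notMem_tsupport fun h => hq (Or.inr (tsupport_fderiv_subset ℝ h))⟩
  have hZ1 : ∀ k, ContDiff ℝ 1 fun q => piola (fderiv ℝ (Φ k) q) (V (Φ k q)) := by
    intro k
    refine ContDiff.clm_apply (contDiff_iff_contDiffAt.2 fun q => ?_)
      (hV.comp ((hΦ2 k).of_le (by norm_num)))
    exact (contDiffAt_piola (hC _ (hdΦ1 k q)).1).comp q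
      ((hΦ2 k).contDiffAt.fderiv_right (by norm_num))
  have hZ0 : ∀ k, ∀ q ∉ K ∪ tsupport V, piola (fderiv ℝ (Φ k) q) (V (Φ k q)) = 0 :=
    fun k q hq => by rw [(hΦid k q hq).1, map_zero]
  obtain ⟨CV, hCV⟩ := hV.continuous.bounded_above_of_compact_support hc
  obtain ⟨CD, hCD⟩ := (continuous_trace_fderiv hV).bounded_above_of_compact_support
    (hasCompactSupport_trace_fderiv hc)
  -- the identity for the approximations
  have hk : ∀ k, ∫ p in Ω, |(fderiv ℝ (Φ k) p).det| * traceCLM (Heis n) (fderiv ℝ V (Φ k p)) =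
      -∫ q, metric q (piola (fderiv ℝ (Φ k) q) (V (Φ k q))) (innerNormal Ω q)
        ∂(surfaceMeasure (frontier Ω)) := by
    intro k
    rw [← hΩ.setIntegral_trace_fderiv hm (hZ1 k) (HasCompactSupport.intro hKV (hZ0 k))]
    refine integral_congr_ae (Eventually.of_forall fun p => ?_)
    exact (trace_fderiv_piola (hΦ2 k).contDiffAt (hC _ (hdΦ1 k p)).1
      (hV.differentiable one_ne_zero _)).symm
  have hR := (hΩ.tendsto_integral_metric (fun k => (hZ1 k).continuous) hKV hZ0
    (C := C * CV) (fun k q _ => ((piola (fderiv ℝ (Φ k) q)).le_opNorm _).trans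
      (mul_le_mul (hC _ (hdΦ1 k q)).2.2 (hCV _) (norm_nonneg _) hC0))
    (Z' := fun q => piola (fderiv ℝ φ q) (V (φ q))) fun q => by
      have h1 : Tendsto (fun k => piola (fderiv ℝ (Φ k) q)) atTop (𝓝 (piola (fderiv ℝ φ q))) :=
        ((contDiffAt_piola (hC _ ((hφ1 q).trans (by norm_num))).1).continuousAt.tendsto).comp
          (hdΦlim q)
      exact tendsto_clm_apply h1 ((hV.continuous.tendsto _).comp (hΦlim q))).neg
  have hLt : Tendsto (fun k => ∫ p in Ω, |(fderiv ℝ (Φ k) p).det| *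
      traceCLM (Heis n) (fderiv ℝ V (Φ k p))) atTop
      (𝓝 (∫ p in Ω, |(fderiv ℝ φ p).det| * traceCLM (Heis n) (fderiv ℝ V (φ p)))) := by
    refine tendsto_integral_of_dominated_convergence
      ((K ∪ tsupport V).indicator fun _ => C * CD) (fun k => ?_) ?_ (fun k => ?_) ?_
    · refine Continuous.aestronglyMeasurable (Continuous.mul ?_ ?_)
      · exact ((contDiff_clm_det (E := Heis n) (k := 0)).continuous.comp
          ((hΦ2 k).continuous_fderiv (by norm_num))).abs
      · exact (continuous_trace_fderiv hV).comp (hΦ2 k).continuous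
    · refine Integrable.integrableOn ?_
      rw [integrable_indicator_iff hKV.measurableSet]
      exact integrableOn_const hKV.measure_lt_top.ne
    · refine Eventually.of_forall fun q => ?_
      by_cases hq : q ∈ K ∪ tsupport V
      · rw [Set.indicator_of_mem hq, norm_mul, Real.norm_eq_abs, abs_abs]
        exact mul_le_mul (hC _ (hdΦ1 k q)).2.1 (hCD _) (norm_nonneg _) hC0
      · rw [Set.indicator_of_notMem hq, (hΦid k q hq).2, map_zero, mul_zero, norm_zero]
    · refine Eventually.of_forall fun q => ?_
      exact ((((contDiff_clm_det (E := Heis n) (k := 0)).continuous.tendsto _).comp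
        (hdΦlim q)).abs).mul
        (((continuous_trace_fderiv hV).tendsto _).comp (hΦlim q))
  exact tendsto_nhds_unique (hLt.congr hk) hR

/-- The flux of the divergence-free field `div U • V - div V • U + [U, V]` vanishes (all terms taken
in coordinates). -/
theorem HasC2Boundary.integral_bracket {Ω : Set (Heis n)} (hΩ : HasC2Boundary Ω)
    (hm : MeasurableSet Ω) {U V : Heis n → Heis n} (hU : ContDiff ℝ 1 U)
    (hUc : HasCompactSupport U) (hV : ContDiff ℝ 1 V) (hVc : HasCompactSupport V) :
    ∫ q, metric q (traceCLM (Heis n) (fderiv ℝ U q) • V q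
      - traceCLM (Heis n) (fderiv ℝ V q) • U q + fderiv ℝ V q (U q) - fderiv ℝ U q (V q))
        (innerNormal Ω q) ∂(surfaceMeasure (frontier Ω)) = 0 := by
  obtain ⟨K, u, hK, -, hu2, huK, hu, hu'⟩ := exists_seq_contDiff_two hU hUc
  obtain ⟨K', v, hK', -, hv2, hvK, hv, hv'⟩ := exists_seq_contDiff_two hV hVc
  have hd : ∀ {w : Heis n → Heis n}, ContDiff ℝ 2 w → ContDiff ℝ 1 (fderiv ℝ w) := fun h =>
    h.fderiv_right (by norm_num)
  set Z : ℕ → Heis n → Heis n := fun k q => traceCLM (Heis n) (fderiv ℝ (u k) q) • v k q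
      - traceCLM (Heis n) (fderiv ℝ (v k) q) • u k q + fderiv ℝ (v k) q (u k q)
      - fderiv ℝ (u k) q (v k q) with hZ
  have hle : ∀ {w : Heis n → Heis n}, ContDiff ℝ 2 w → ContDiff ℝ 1 w := fun h =>
    h.of_le (by norm_num)
  have hZ1 : ∀ k, ContDiff ℝ 1 (Z k) := fun k =>
    (((((traceCLM (Heis n)).contDiff.comp (hd (hu2 k))).smul (hle (hv2 k))).sub
      (((traceCLM (Heis n)).contDiff.comp (hd (hv2 k))).smul (hle (hu2 k)))).add
      ((hd (hv2 k)).clm_apply (hle (hu2 k)))).sub ((hd (hu2 k)).clm_apply (hle (hv2 k)))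
  have hZ0 : ∀ k, ∀ q ∉ K ∪ K', Z k q = 0 := by
    intro k q hq
    simp [hZ, huK k q fun h => hq (Or.inl h), hvK k q fun h => hq (Or.inr h)]
  have hk : ∀ k, ∫ q, metric q (Z k q) (innerNormal Ω q) ∂(surfaceMeasure (frontier Ω)) = 0 := by
    intro k
    have h1 := hΩ.setIntegral_trace_fderiv hm (hZ1 k) (HasCompactSupport.intro (hK.union hK')
      (hZ0 k))
    have h2 : ∀ p, traceCLM (Heis n) (fderiv ℝ (Z k) p) = 0 := fun p =>
      trace_fderiv_bracket (hu2 k).contDiffAt (hv2 k).contDiffAt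
    simp_rw [h2] at h1
    rw [integral_zero] at h1
    linarith
  -- uniform bounds for the approximations
  have hone : ∀ k : ℕ, 1 / ((k : ℝ) + 1) ≤ 1 := fun k => by
    rw [div_le_one (by positivity)]; linarith [(Nat.cast_nonneg k : (0 : ℝ) ≤ k)]
  have hbd : ∀ {F : Type} [NormedAddCommGroup F] {a : ℕ → Heis n → F} {b : Heis n → F} {C : ℝ},
      (∀ k x, ‖a k x - b x‖ ≤ 1 / ((k : ℝ) + 1)) → (∀ x, ‖b x‖ ≤ C) →
      ∀ k x, ‖a k x‖ ≤ C + 1 := by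
    intro F _ a b C h1 h2 k x
    calc ‖a k x‖ = ‖b x + (a k x - b x)‖ := by rw [add_sub_cancel]
      _ ≤ C + 1 := (norm_add_le _ _).trans (add_le_add (h2 x) ((h1 k x).trans (hone k)))
  obtain ⟨C₁, hC₁⟩ := hU.continuous.bounded_above_of_compact_support hUc
  obtain ⟨C₂, hC₂⟩ := hV.continuous.bounded_above_of_compact_support hVc
  obtain ⟨C₃, hC₃⟩ := (hU.continuous_fderiv one_ne_zero).bounded_above_of_compact_support
    (hUc.fderiv ℝ)
  obtain ⟨C₄, hC₄⟩ := (hV.continuous_fderiv one_ne_zero).bounded_above_of_compact_support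
    (hVc.fderiv ℝ)
  have b1 := hbd hu hC₁
  have b2 := hbd hv hC₂
  have b3 := hbd hu' hC₃
  have b4 := hbd hv' hC₄
  set t := ‖traceCLM (Heis n)‖
  have hlim := hΩ.tendsto_integral_metric (fun k => (hZ1 k).continuous) (hK.union hK') hZ0
    (C := t * (C₃ + 1) * (C₂ + 1) + t * (C₄ + 1) * (C₁ + 1) + (C₄ + 1) * (C₁ + 1)
      + (C₃ + 1) * (C₂ + 1)) (fun k q _ => by
        have p1 : 0 ≤ C₁ + 1 := (norm_nonneg _).trans (b1 k q)
        have p2 : 0 ≤ C₂ + 1 := (norm_nonneg _).trans (b2 k q)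
        have p3 : 0 ≤ C₃ + 1 := (norm_nonneg _).trans (b3 k q)
        have p4 : 0 ≤ C₄ + 1 := (norm_nonneg _).trans (b4 k q)
        have ht : ∀ {A : Heis n →L[ℝ] Heis n} {w : Heis n} {a b : ℝ}, ‖A‖ ≤ a → ‖w‖ ≤ b → 0 ≤ a →
            ‖traceCLM (Heis n) A • w‖ ≤ t * a * b := by
          intro A w a b h1 h2 h3
          rw [norm_smul]
          refine mul_le_mul (((traceCLM (Heis n)).le_opNorm A).trans
            (mul_le_mul_of_nonneg_left h1 (norm_nonneg _))) h2 (norm_nonneg _)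
            (mul_nonneg (norm_nonneg (traceCLM (Heis n))) h3)
        have ha : ∀ {A : Heis n →L[ℝ] Heis n} {w : Heis n} {a b : ℝ}, ‖A‖ ≤ a → ‖w‖ ≤ b → 0 ≤ a →
            ‖A w‖ ≤ a * b := fun h1 h2 h3 =>
          (ContinuousLinearMap.le_opNorm _ _).trans (mul_le_mul h1 h2 (norm_nonneg _) h3)
        refine (norm_sub_le _ _).trans (add_le_add ((norm_add_le _ _).trans (add_le_add
          ((norm_sub_le _ _).trans (add_le_add ?_ ?_)) ?_)) ?_)
        · exact ht (b3 k q) (b2 k q) p3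
        · exact ht (b4 k q) (b1 k q) p4
        · exact ha (b4 k q) (b1 k q) p4
        · exact ha (b3 k q) (b2 k q) p3)
    (fun q => by
      have l1 := tendsto_of_norm_sub_le_one_div fun k => hu k q
      have l2 := tendsto_of_norm_sub_le_one_div fun k => hv k q
      have l3 := tendsto_of_norm_sub_le_one_div fun k => hu' k q
      have l4 := tendsto_of_norm_sub_le_one_div fun k => hv' k q
      exact (((((traceCLM (Heis n)).continuous.tendsto _).comp l3).smul l2).sub
        ((((traceCLM (Heis n)).continuous.tendsto _).comp l4).smul l1)).add
        (tendsto_clm_apply l4 l1) |>.sub (tendsto_clm_apply l3 l2))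
  simp_rw [hk] at hlim
  exact (tendsto_nhds_unique tendsto_const_nhds hlim).symm

end Heis

namespace Heis
variable {n : ℕ}

/-! ### The divergence relative to the boundary -/

theorem HasC2Boundary.tangent_eq {Ω : Set (Heis n)} (hΩ : HasC2Boundary Ω) {p : Heis n}
    (hp : p ∈ frontier Ω) : tangent (frontier Ω) p = {v | metric p v (innerNormal Ω p) = 0} := by
  obtain ⟨f, Φ, l, e, h, hpΦ⟩ := hΩ.exists_isChart hp
  rw [h.tangent_eq hpΦ hp]
  ext v
  simp [h.metric_innerNormal hpΦ hp, (h.len_grad_pos hpΦ).ne']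

theorem HasC2Boundary.exists_isTangentONB {Ω : Set (Heis n)} (hΩ : HasC2Boundary Ω) {p : Heis n}
    (hp : p ∈ frontier Ω) : ∃ e, IsTangentONB (frontier Ω) p e := by
  set N := innerNormal Ω p with hN
  set H := (ℝ ∙ toEuclid p N)ᗮ with hH
  have hN0 : toEuclid p N ≠ 0 := fun h0 => by
    have := hΩ.len_innerNormal hp
    rw [len_eq_norm, ← hN, h0, norm_zero] at this
    exact zero_ne_one this
  have : Fact (Module.finrank ℝ (EuclideanSpace ℝ (Fin n ⊕ Fin n ⊕ Unit)) = 2 * n + 1) :=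
    ⟨by simp; ring⟩
  have hfr : Module.finrank ℝ H = 2 * n := Submodule.finrank_orthogonal_span_singleton hN0
  let b : OrthonormalBasis (Fin (2 * n)) ℝ H := (stdOrthonormalBasis ℝ H).reindex (finCongr hfr)
  refine ⟨fun i => (toEuclid p).symm (b i : EuclideanSpace ℝ (Fin n ⊕ Fin n ⊕ Unit)),
    fun i j => ?_, ?_⟩
  · rw [← inner_toEuclid, LinearEquiv.apply_symm_apply, LinearEquiv.apply_symm_apply,
      ← Submodule.coe_inner, orthonormal_iff_ite.1 b.orthonormal]
  · rw [hΩ.tangent_eq hp]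
    have h1 : Submodule.span ℝ (Set.range fun i => (b i : EuclideanSpace ℝ _)) = H := by
      have h2 := congrArg (Submodule.map H.subtype) b.toBasis.span_eq
      rw [Submodule.map_span, Submodule.map_top, Submodule.range_subtype, ← Set.range_comp] at h2
      have h3 : (fun i => (b i : EuclideanSpace ℝ _)) = H.subtype ∘ b.toBasis := by
        funext i
        simp
      rw [h3]
      exact h2
    have h3 : Submodule.span ℝ (Set.range fun i => (toEuclid p).symm
        (b i : EuclideanSpace ℝ (Fin n ⊕ Fin n ⊕ Unit))) =
        H.map ((toEuclid p).symm : EuclideanSpace ℝ _ →ₗ[ℝ] Heis n) := by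
      have h4 := congrArg (Submodule.map
        ((toEuclid p).symm : EuclideanSpace ℝ _ →ₗ[ℝ] Heis n)) h1
      rw [Submodule.map_span, ← Set.range_comp] at h4
      exact h4
    rw [h3]
    ext v
    simp only [SetLike.mem_coe, Submodule.mem_map, Set.mem_ofPred_eq]
    constructor
    · rintro ⟨w, hw, rfl⟩
      rw [metric_comm, ← inner_toEuclid]
      simpa using Submodule.mem_orthogonal_singleton_iff_inner_right.1 hw
    · intro hv
      refine ⟨toEuclid p v, Submodule.mem_orthogonal_singleton_iff_inner_right.2 ?_, by simp⟩
      rw [inner_toEuclid, metric_comm]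
      exact hv

theorem trace_covDeriv_univ (W : Heis n → Heis n) (p : Heis n) :
    LinearMap.trace ℝ (Heis n) (covDerivLin Set.univ W p) = divergence W p := by
  rw [trace_eq_sum_metric (covDerivLin Set.univ W p) p
    (Sum.elim (fun k : Fin n => X k p) (Sum.elim (fun k : Fin n => Y k p) fun _ : Unit => T p))
    (by
      rintro (i | i | i) (j | j | j) <;>
        simp [metric_X_X, metric_Y_Y, metric_X_Y, metric_X_T, metric_Y_T, metric_T_T,
          metric_comm p (Y _ p) (X _ p), metric_comm p (T p)])
    (by simp; ring)]
  simp [Fintype.sum_sum_type, divergence, covDerivLin, add_assoc]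

/-- Along a tangent direction, only the values along the hypersurface matter for the covariant
derivative. -/
theorem covDeriv_eq_of_tangent {S : Set (Heis n)} {p u : Heis n} (hp : p ∈ S)
    (hu : u ∈ tangent S p) {V W : Heis n → Heis n} (hW : DifferentiableAt ℝ W p)
    (h : ∀ᶠ q in 𝓝[S] p, V q = W q) : covDeriv S V p u = covDeriv Set.univ W p u := by
  have hpe : V p = W p := h.self_of_nhdsWithin hp
  have hG : HasFDerivWithinAt (fun q => coframe q (W q)) (fderiv ℝ (fun q => coframe q (W q)) p)
      S p := (fderiv_coframe W p u hW).1.hasFDerivAt.hasFDerivWithinAt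
  have hG' : HasFDerivWithinAt (fun q => coframe q (V q))
      (fderiv ℝ (fun q => coframe q (W q)) p) S p :=
    hG.congr_of_eventuallyEq (by filter_upwards [h] with q hq; rw [hq]) (by rw [hpe])
  obtain ⟨γ, h0, hγ, hd⟩ := hu
  have h1 := hG'.comp_hasDerivAt_of_eq (0 : ℝ) hd hγ h0.symm
  have h2 := hG'.differentiableWithinAt.hasFDerivWithinAt.comp_hasDerivAt_of_eq (0 : ℝ) hd hγ
    h0.symm
  rw [covDeriv_eq_frame, covDeriv_eq_frame, hpe, fderivWithin_univ, h2.unique h1]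

/-- If the horizontal unit normal extends to a horizontal field `W` with `|W| ≤ 1`, then its
divergence relative to the boundary is `div W`: the normal part `⟨D_N W, N⟩` of the divergence
vanishes, because `|W|` is maximal on the boundary and because the vertical component of `D_N W` is
`⟨W, J N⟩ = 0`. -/
theorem HasC2Boundary.surfaceDivergence_eq {Ω : Set (Heis n)} (hΩ : HasC2Boundary Ω) {p : Heis n}
    (hp : p ∈ frontier Ω) (hpos : 0 < len p (horProj p (innerNormal Ω p)))
    {W : Heis n → Heis n} (hW : ContDiff ℝ 1 W) (hWh : ∀ q, W q ∈ horizontal q)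
    (hW1 : ∀ q, len q (W q) ≤ 1) (h : ∀ᶠ q in 𝓝[frontier Ω] p, horNormal Ω q = W q) :
    surfaceDivergence (frontier Ω) (horNormal Ω) p = traceCLM (Heis n) (fderiv ℝ W p) := by
  classical
  have hex := hΩ.exists_isTangentONB hp
  have hWd := hW.differentiable one_ne_zero
  rw [surfaceDivergence, dif_pos hex]
  generalize hex.choose = e, hex.choose_spec = he
  set N := innerNormal Ω p with hN
  have hmem : ∀ i, e i ∈ tangent (frontier Ω) p := fun i => by
    rw [← he.2]; exact Submodule.subset_span ⟨i, rfl⟩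
  have heN : ∀ i, metric p (e i) N = 0 := fun i => by
    have := hmem i
    rw [hΩ.tangent_eq hp] at this
    exact this
  have hNN : metric p N N = 1 := by rw [metric_self, hΩ.len_innerNormal hp, one_pow]
  rw [← divergence_eq_trace (hWd p), ← trace_covDeriv_univ,
    trace_eq_sum_metric (covDerivLin Set.univ W p) p (Sum.elim e fun _ : Unit => N)
    (by
      rintro (i | i) (j | j)
      · simpa using he.1 i j
      · simpa using heN i
      · simpa [metric_comm p N] using heN j
      · simpa using hNN)
    (by simp), Fintype.sum_sum_type]
  have hsum : ∀ i, metric p (covDeriv (frontier Ω) (horNormal Ω) p (e i)) (e i) =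
      metric p (covDerivLin Set.univ W p (Sum.elim e (fun _ : Unit => N) (Sum.inl i)))
        (Sum.elim e (fun _ : Unit => N) (Sum.inl i)) := fun i => by
    rw [covDeriv_eq_of_tangent hp (hmem i) (hWd p) h]; rfl
  rw [Finset.sum_congr rfl fun i _ => hsum i]
  simp only [Finset.univ_unique, Finset.sum_singleton, Sum.elim_inr, left_eq_add]
  change metric p (covDeriv Set.univ W p N) N = 0
  set D := covDeriv Set.univ W p N with hD
  have hWp : W p = (len p (horProj p N))⁻¹ • horProj p N := (h.self_of_nhdsWithin hp).symm
  have hlen : len p (W p) = 1 := by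
    rw [hWp, len_smul, abs_of_pos (inv_pos.2 hpos), inv_mul_cancel₀ hpos.ne']
  -- the component along `W`
  have h1 : metric p D (W p) = 0 := by
    have hmax : IsLocalMax (fun q => metric q (W q) (W q)) p :=
      Eventually.of_forall fun q => by
        simp only
        rw [metric_self, metric_self, hlen]
        exact pow_le_pow_left₀ (len_nonneg _ _) (hW1 q) 2
    have h2 := metric_compatible W W p N (hWd p) (hWd p)
    rw [hmax.fderiv_eq_zero, metric_comm p (W p), ← hD] at h2
    simp only [zero_apply] at h2
    linarith
  -- the component along `T`
  have h3 : (coframe p D).2.2 = 0 := by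
    rw [hD, covDeriv_eq_frame, coframe_frame, fderivWithin_univ]
    have hz : (fderiv ℝ (fun q => coframe q (W q)) p N).2.2 = 0 := by
      have h4 := ((fderiv_coframe W p N (hWd p)).1.hasFDerivAt).snd.snd
      have h5 : (fun q => (coframe q (W q)).2.2) = fun _ => (0 : ℝ) :=
        funext fun q => mem_horizontal_iff.1 (hWh q)
      rw [h5] at h4
      have h6 := h4.unique (hasFDerivAt_const (0 : ℝ) p)
      exact congrArg (fun A : Heis n →L[ℝ] ℝ => A N) h6
    have hc : coframe p (W p) = (len p (horProj p N))⁻¹ • coframe p (horProj p N) := by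
      rw [hWp, coframe_smul]
    simp only [Prod.snd_add, hz, hc, coframe_horProj, Prod.smul_fst, Prod.smul_snd, Pi.smul_apply,
      smul_eq_mul, zero_add]
    exact Finset.sum_eq_zero fun j _ => by ring
  have hDh : D ∈ horizontal p := mem_horizontal_iff.2 h3
  rw [metric_horizontal_left hDh, show horProj p N = len p (horProj p N) • W p by
    rw [hWp, smul_smul, mul_inv_cancel₀ hpos.ne', one_smul], metric_smul_right, h1, mul_zero]

/-! ### An extension of the horizontal normal -/

theorem horizontal_smul_mem {p v : Heis n} (c : ℝ) (hv : v ∈ horizontal p) :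
    c • v ∈ horizontal p := (horizontal p).smul_mem c hv

theorem contDiffOn_metric {k : WithTop ℕ∞} {s : Set (Heis n)} {p v w : Heis n → Heis n}
    (hp : ContDiffOn ℝ k p s) (hv : ContDiffOn ℝ k v s) (hw : ContDiffOn ℝ k w s) :
    ContDiffOn ℝ k (fun x => metric (p x) (v x) (w x)) s := by
  have h := (contDiff_metric (n := n) (k := k)).comp_contDiffOn (hp.prodMk (hv.prodMk hw))
  refine h.congr fun x _ => ?_
  simp only [Function.comp_apply]

theorem continuousOn_len {s : Set (Heis n)} {v : Heis n → Heis n} (hv : ContinuousOn v s) :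
    ContinuousOn (fun q => len q (v q)) s := by
  have h := (continuous_len (n := n)).comp_continuousOn (continuousOn_id.prodMk hv)
  refine h.congr fun x _ => ?_
  simp only [Function.comp_apply, id]

/-- Near a compact part of the regular boundary, `-ν_H` extends to a test field `V`.  Away from it,
`V` is `-χ ν_H` on the boundary, for a cutoff function `χ`. -/
theorem HasC2Boundary.exists_extension {Ω : Set (Heis n)} (hΩ : HasC2Boundary Ω)
    {K : Set (Heis n)} (hK : IsCompact K) (hKS : K ⊆ frontier Ω)
    (hsing : Disjoint K (singularSet (frontier Ω))) :
    ∃ (V : Heis n → Heis n) (χ : Heis n → ℝ), ContDiff ℝ 1 V ∧ HasCompactSupport V ∧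
      (∀ q, V q ∈ horizontal q) ∧ (∀ q, len q (V q) ≤ χ q) ∧ ContDiff ℝ 1 χ ∧ (∀ q, χ q ≤ 1) ∧
      (∀ q ∈ frontier Ω, V q = -(χ q • horNormal Ω q)) ∧
      (∀ q ∈ frontier Ω, χ q ≠ 0 → 0 < len q (horProj q (innerNormal Ω q))) ∧
      ∀ᶠ q in 𝓝ˢ K, χ q = 1 := by
  classical
  have hloc : ∀ p, ∃ (O : Set (Heis n)) (w : Heis n → Heis n), p ∈ K → IsOpen O ∧ p ∈ O ∧
      ContDiffOn ℝ 1 w O ∧ (∀ q ∈ O, w q ∈ horizontal q) ∧ (∀ q ∈ O, len q (w q) = 1) ∧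
      (∀ q ∈ O ∩ frontier Ω, horNormal Ω q = w q) ∧
      ∀ q ∈ O ∩ frontier Ω, 0 < len q (horProj q (innerNormal Ω q)) := by
    intro p
    by_cases hp : p ∈ K
    swap
    · exact ⟨∅, 0, fun h => absurd h hp⟩
    obtain ⟨f, Φ, l, e, h, hpΦ⟩ := hΩ.exists_isChart (hKS hp)
    have hlc : ContinuousOn (fun q => len q (horGrad f q)) Φ.source :=
      continuousOn_len h.contDiffOn_horGrad.continuousOn
    refine ⟨Φ.source ∩ {q | 0 < len q (horGrad f q)},
      fun q => (len q (horGrad f q))⁻¹ • horGrad f q, fun _ =>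
      ⟨hlc.isOpen_inter_preimage Φ.open_source isOpen_Ioi, ⟨hpΦ, h.len_horGrad_pos hpΦ (hKS hp)
        (Set.disjoint_left.1 hsing hp)⟩, ?_, fun q hq => horizontal_smul_mem _ (horGrad_mem f q),
        fun q hq => ?_, fun q hq => h.horNormal_eq hq.1.1 hq.2, fun q hq => ?_⟩⟩
    · have hg := h.contDiffOn_horGrad.mono
        (Set.inter_subset_left : Φ.source ∩ {q | 0 < len q (horGrad f q)} ⊆ Φ.source)
      have hm : ContDiffOn ℝ 1 (fun q => metric q (horGrad f q) (horGrad f q))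
          (Φ.source ∩ {q | 0 < len q (horGrad f q)}) := by
        exact contDiffOn_metric contDiffOn_id hg hg
      refine ContDiffOn.smul (ContDiffOn.inv (hm.sqrt fun q hq => ?_) fun q hq => hq.2.ne') hg
      rw [metric_self]
      exact (pow_pos hq.2 2).ne'
    · rw [len_smul, abs_of_pos (inv_pos.2 hq.2), inv_mul_cancel₀ (ne_of_gt hq.2)]
    · rw [h.horProj_innerNormal hq.1.1 hq.2, len_smul,
        abs_of_pos (inv_pos.2 (h.len_grad_pos hq.1.1))]
      exact mul_pos (inv_pos.2 (h.len_grad_pos hq.1.1)) hq.1.2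
  choose O w hOw using hloc
  obtain ⟨s, ρ, hsK, hρ, hρc, hρs, hρ0, hρle, hρ1⟩ := exists_finite_partition hK O
    fun p hp => ⟨(hOw p hp).1, (hOw p hp).2.1⟩
  have hout : ∀ i ∈ s, ∀ q, q ∉ O i → ρ i q = 0 := fun i hi q hq =>
    image_eq_zero_of_notMem_tsupport fun h => hq (hρs i hi h)
  have hterm : ∀ i ∈ s, ContDiff ℝ 1 fun q => ρ i q • w i q := by
    intro i hi
    rw [contDiff_iff_contDiffAt]
    intro q
    by_cases hq : q ∈ tsupport (ρ i)
    · exact (hρ i).contDiffAt.smul ((hOw i (hsK i hi)).2.2.1.contDiffAt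
        ((hOw i (hsK i hi)).1.mem_nhds (hρs i hi hq)))
    · have : (fun q => ρ i q • w i q) =ᶠ[𝓝 q] fun _ => 0 := by
        filter_upwards [(isClosed_tsupport _).isOpen_compl.mem_nhds hq] with z hz
        rw [image_eq_zero_of_notMem_tsupport hz, zero_smul]
      exact contDiffAt_const.congr_of_eventuallyEq this
  refine ⟨fun q => -∑ i ∈ s, ρ i q • w i q, fun q => ∑ i ∈ s, ρ i q,
    (ContDiff.sum fun i hi => hterm i hi).neg, ?_, fun q => ?_, fun q => ?_,
    ContDiff.sum fun i _ => hρ i, hρle, fun q hq => ?_, fun q hq hne => ?_, hρ1⟩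
  · refine HasCompactSupport.intro (K := ⋃ i ∈ s, tsupport (ρ i))
      (s.isCompact_biUnion fun i _ => hρc i) fun q hq => ?_
    rw [Finset.sum_eq_zero, neg_zero]
    intro i hi
    rw [image_eq_zero_of_notMem_tsupport fun h => hq (Set.mem_biUnion hi h), zero_smul]
  · refine (horizontal q).neg_mem ((horizontal q).sum_mem fun i hi => ?_)
    by_cases hq : q ∈ O i
    · exact horizontal_smul_mem _ ((hOw i (hsK i hi)).2.2.2.1 q hq)
    · rw [hout i hi q hq, zero_smul]; exact zero_mem _
  · change len q (-∑ i ∈ s, ρ i q • w i q) ≤ _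
    rw [← neg_one_smul ℝ, len_smul, abs_neg, abs_one, one_mul]
    refine (len_sum_le _ _ _).trans (Finset.sum_le_sum fun i hi => ?_)
    rw [len_smul, abs_of_nonneg (hρ0 i q)]
    by_cases hq : q ∈ O i
    · rw [(hOw i (hsK i hi)).2.2.2.2.1 q hq, mul_one]
    · rw [hout i hi q hq, zero_mul]
  · change -∑ i ∈ s, ρ i q • w i q = _
    rw [Finset.sum_smul, neg_inj]
    refine Finset.sum_congr rfl fun i hi => ?_
    by_cases hqO : q ∈ O i
    · rw [(hOw i (hsK i hi)).2.2.2.2.2.1 q ⟨hqO, hq⟩]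
    · rw [hout i hi q hqO, zero_smul, zero_smul]
  · obtain ⟨i, hi, hne'⟩ := Finset.exists_ne_zero_of_sum_ne_zero hne
    refine (hOw i (hsK i hi)).2.2.2.2.2.2 q ⟨?_, hq⟩
    by_contra hqO
    exact hne' (hout i hi q hqO)

end Heis

/-! ### Differentiation of an integral at one point, and of a function between two others -/

/-- Differentiation under the integral sign at one point.  The measurability of the derivative
follows from the other hypotheses. -/
theorem hasDerivAt_integral_of_norm_sub_le {α : Type*} [MeasurableSpace α] {μ : Measure α}
    {F : ℝ → α → ℝ} {F' b : α → ℝ} {T : ℝ} (hT : 0 < T)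
    (hm : ∀ t, |t| ≤ T → AEStronglyMeasurable (F t) μ) (hi : Integrable (F 0) μ)
    (hb : Integrable b μ) (hF : ∀ᵐ a ∂μ, ∀ t, |t| ≤ T → |F t a - F 0 a| ≤ b a * |t|)
    (hd : ∀ᵐ a ∂μ, HasDerivAt (fun t => F t a) (F' a) 0) :
    HasDerivAt (fun t => ∫ a, F t a ∂μ) (∫ a, F' a ∂μ) 0 := by
  -- the derivative is measurable, as a limit of difference quotients
  have hF' : AEStronglyMeasurable F' μ := by
    let u : ℕ → ℝ := fun k => T * (1 / ((k : ℝ) + 1))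
    have hu0 : ∀ k, 0 < u k := fun k => mul_pos hT Nat.one_div_pos_of_nat
    have huT : ∀ k, |u k| ≤ T := fun k => by
      rw [abs_of_pos (hu0 k)]
      refine mul_le_of_le_one_right hT.le ?_
      rw [div_le_one (by positivity)]
      linarith [(Nat.cast_nonneg k : (0 : ℝ) ≤ k)]
    have hu : Tendsto u atTop (𝓝[≠] 0) := by
      refine tendsto_nhdsWithin_iff.2 ⟨?_, Eventually.of_forall fun k => (hu0 k).ne'⟩
      simpa [u] using (tendsto_one_div_add_atTop_nhds_zero_nat (𝕜 := ℝ)).const_mul T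
    refine aestronglyMeasurable_of_tendsto_ae atTop (f := fun k a => (u k)⁻¹ * (F (u k) a - F 0 a))
      (fun k => ((hm _ (huT k)).sub hi.aestronglyMeasurable).const_mul _) ?_
    filter_upwards [hd] with a ha
    have := ha.tendsto_slope_zero.comp hu
    simpa using! this
  have key := hasFDerivAt_integral_of_dominated_loc_of_lip' (𝕜 := ℝ) (x₀ := (0 : ℝ))
    (F' := fun a => ContinuousLinearMap.toSpanSingleton ℝ (F' a)) (F := F) (bound := b)
    (s := Metric.closedBall 0 T) (Metric.closedBall_mem_nhds _ hT)
    (fun t ht => hm t (by simpa using ht)) hi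
    ((ContinuousLinearMap.toSpanSingletonCLE (𝕜 := ℝ) (E := ℝ)).continuous.comp_aestronglyMeasurable
      hF')
    (by
      filter_upwards [hF] with a ha t ht
      simpa using ha t (by simpa using ht)) hb
    (by filter_upwards [hd] with a ha using ha.hasFDerivAt)
  have h2 := key.2.hasDerivAt
  rw [ContinuousLinearMap.integral_apply key.1] at h2
  simpa using h2

/-- A function squeezed between two functions which are differentiable at `0`, and equal to it
there, is differentiable at `0`. -/
theorem hasDerivAt_of_le_of_le {f g₁ g₂ : ℝ → ℝ} {d₁ d₂ : ℝ} (h₁ : HasDerivAt g₁ d₁ 0)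
    (h₂ : HasDerivAt g₂ d₂ 0) (h10 : g₁ 0 = f 0) (h20 : g₂ 0 = f 0)
    (hle : ∀ᶠ t in 𝓝 0, g₁ t ≤ f t ∧ f t ≤ g₂ t) : HasDerivAt f d₁ 0 := by
  have hmin : IsLocalMin (fun t => g₂ t - g₁ t) 0 := by
    filter_upwards [hle] with t ht
    rw [h10, h20, sub_self]
    exact sub_nonneg.2 (ht.1.trans ht.2)
  have hd : d₂ = d₁ := sub_eq_zero.1 (hmin.hasDerivAt_eq_zero (h₂.sub h₁))
  subst hd
  rw [hasDerivAt_iff_isLittleO] at h₁ h₂ ⊢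
  refine Asymptotics.IsBigO.trans_isLittleO (.of_bound 1 ?_) (h₁.norm_left.add h₂.norm_left)
  filter_upwards [hle] with t ht
  rw [one_mul, Real.norm_of_nonneg (add_nonneg (norm_nonneg _) (norm_nonneg _)), h10, h20]
  simp only [Real.norm_eq_abs]
  have h3 := neg_abs_le (g₁ t - f 0 - (t - 0) • d₂)
  have h4 := le_abs_self (g₂ t - f 0 - (t - 0) • d₂)
  have h5 := abs_nonneg (g₁ t - f 0 - (t - 0) • d₂)
  have h6 := abs_nonneg (g₂ t - f 0 - (t - 0) • d₂)
  exact abs_le.2 ⟨by linarith [ht.1], by linarith [ht.2]⟩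

namespace Heis
variable {n : ℕ}

/-! ### The largest flux of a horizontal field -/

/-- The horizontal left-invariant frame. -/
def horFrame : Fin n ⊕ Fin n → Heis n → Heis n := Sum.elim X Y

theorem contDiff_horFrame (i : Fin n ⊕ Fin n) : ContDiff ℝ 1 (horFrame i : Heis n → Heis n) := by
  rcases i with i | i
  · exact contDiff_X i
  · exact contDiff_Y i

/-- By the Cauchy-Schwarz inequality, the flux density of the image under a linear map of a
horizontal vector of length at most one is at most the Euclidean length of the vector of the flux
densities of the images of the horizontal frame. -/
theorem abs_metric_clm_le {p v : Heis n} (hv : v ∈ horizontal p) (hl : len p v ≤ 1)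
    (A : Heis n →L[ℝ] Heis n) (q w : Heis n) :
    |metric q (A v) w| ≤ Real.sqrt (∑ i, metric q (A (horFrame i p)) w ^ 2) := by
  set c : Fin n ⊕ Fin n → ℝ := Sum.elim (coframe p v).1 (coframe p v).2.1 with hc
  have hv0 := mem_horizontal_iff.1 hv
  have h1 : v = ∑ i, c i • horFrame i p := by
    conv_lhs => rw [← frame_coframe p v]
    rw [frame, hv0, zero_smul, add_zero, Fintype.sum_sum_type]
    rfl
  have h2 : ∑ i, c i ^ 2 ≤ 1 := by
    have h3 : metric p v v = ∑ i, c i ^ 2 := by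
      rw [metric, hv0, Fintype.sum_sum_type]
      simp [hc, sq]
    rw [← h3, metric_self]
    exact pow_le_one₀ (len_nonneg _ _) hl
  have h4 : metric q (A v) w = ∑ i, c i * metric q (A (horFrame i p)) w := by
    conv_lhs => rw [h1]
    rw [map_sum, metric_sum_left]
    exact Finset.sum_congr rfl fun i _ => by rw [map_smul, metric_smul_left]
  refine Real.abs_le_sqrt ?_
  rw [h4]
  refine (Finset.sum_mul_sq_le_sq_mul_sq _ _ _).trans ?_
  exact mul_le_of_le_one_left (Finset.sum_nonneg fun i _ => sq_nonneg _) h2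

theorem abs_metric_le_horProj {p v : Heis n} (hv : v ∈ horizontal p) (hl : len p v ≤ 1)
    (w : Heis n) : |metric p v w| ≤ len p (horProj p w) := by
  rw [metric_horizontal_left hv]
  exact (abs_metric_le _ _ _).trans (mul_le_of_le_one_left (len_nonneg _ _) hl)

theorem sqrt_sum_horFrame (q w : Heis n) :
    Real.sqrt (∑ i, metric q (horFrame i q) w ^ 2) = len q (horProj q w) := by
  rw [← Real.sqrt_sq (len_nonneg q (horProj q w)), len_horProj_sq, Fintype.sum_sum_type]
  rfl

/-! ### Perimeter as a real number -/

theorem IsTestField.le_toReal_perimeter {Ω : Set (Heis n)} (hfin : perimeter Ω ≠ ∞)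
    {V : Heis n → Heis n} (hV : IsTestField V) :
    ∫ p in Ω, traceCLM (Heis n) (fderiv ℝ V p) ≤ (perimeter Ω).toReal := by
  have h1 : ENNReal.ofReal (∫ p in Ω, divergence V p) ≤ perimeter Ω :=
    le_iSup₂ (f := fun (V : Heis n → Heis n) (_ : IsTestField V) =>
      ENNReal.ofReal (∫ p in Ω, divergence V p)) V hV
  simp_rw [divergence_eq_trace (hV.1.differentiable one_ne_zero _)] at h1
  exact (ENNReal.ofReal_le_iff_le_toReal hfin).1 h1

theorem isTestField_zero : IsTestField (0 : Heis n → Heis n) :=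
  ⟨contDiff_const, HasCompactSupport.zero, fun p => zero_mem _, fun p => by
    rw [Pi.zero_apply, len_eq_zero_iff.2 rfl]; exact zero_le_one⟩

theorem toReal_perimeter_le {Ω : Set (Heis n)} {c : ℝ}
    (h : ∀ V, IsTestField V → ∫ p in Ω, traceCLM (Heis n) (fderiv ℝ V p) ≤ c) :
    perimeter Ω ≠ ∞ ∧ (perimeter Ω).toReal ≤ c := by
  have h0 : 0 ≤ c := by
    have := h 0 isTestField_zero
    simpa using this
  have h1 : perimeter Ω ≤ ENNReal.ofReal c := by
    refine iSup₂_le fun V hV => ENNReal.ofReal_le_ofReal ?_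
    simp_rw [divergence_eq_trace (hV.1.differentiable one_ne_zero _)]
    exact h V hV
  exact ⟨(h1.trans_lt ENNReal.ofReal_lt_top).ne, ENNReal.toReal_le_of_le_ofReal h0 h1⟩

end Heis

/-! ### Fields transported by the flow -/

section Pull
variable {E : Type*} [NormedAddCommGroup E] [NormedSpace ℝ E] [FiniteDimensional ℝ E]
  {U : E → E} {φ : ℝ → E → E}

/-- The Piola transform of the field `V` under the diffeomorphism `φ`: the flux of the result
through a hypersurface is the flux of `V` through its image. -/
def pull (φ : E → E) (V : E → E) (q : E) : E := piola (fderiv ℝ φ q) (V (φ q))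

theorem IsFlowOf.apply_of_notMem (h : IsFlowOf U φ) {K : NNReal} (hK : LipschitzWith K U) {q : E}
    (hq : q ∉ tsupport U) (t : ℝ) : φ t q = q :=
  h.eq_of_eq_zero hK (image_eq_zero_of_notMem_tsupport hq) t

theorem IsFlowOf.apply_mem_tsupport (h : IsFlowOf U φ) {K : NNReal} (hK : LipschitzWith K U) {q : E}
    (hq : q ∈ tsupport U) (t : ℝ) : φ t q ∈ tsupport U := by
  by_contra hn
  have h1 := h.apply_of_notMem hK hn (-t)
  rw [h.neg_apply_apply hK] at h1
  exact hn (h1 ▸ hq)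

theorem IsFlowOf.pull_of_notMem (h : IsFlowOf U φ) {K : NNReal} (hK : LipschitzWith K U) {q : E}
    (hq : q ∉ tsupport U) (t : ℝ) (V : E → E) : pull (φ t) V q = V q := by
  have h1 : φ t =ᶠ[𝓝 q] id := by
    filter_upwards [(isClosed_tsupport U).isOpen_compl.mem_nhds hq] with z hz
    exact h.apply_of_notMem hK hz t
  rw [pull, h1.fderiv_eq, fderiv_id, h1.self_of_nhds]
  exact congrArg (fun A : E →L[ℝ] E => A (V q)) piola_one

theorem IsFlowOf.pull_zero (h : IsFlowOf U φ) (V : E → E) (q : E) : pull (φ 0) V q = V q := by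
  have h1 : φ 0 = id := funext h.zero
  rw [pull, h1, fderiv_id]
  exact congrArg (fun A : E →L[ℝ] E => A (V q)) piola_one

/-- The derivative at time `0` of the transported field is `div U • V + DV U - DU V`. -/
theorem IsFlowOf.hasDerivAt_pull (h : IsFlowOf U φ) {q : E}
    (hd : HasDerivAt (fun t => fderiv ℝ (φ t) q) (fderiv ℝ U q) 0) {V : E → E}
    (hV : DifferentiableAt ℝ V q) :
    HasDerivAt (fun t => pull (φ t) V q) (traceCLM E (fderiv ℝ U q) • V q - fderiv ℝ U q (V q)
      + fderiv ℝ V q (U q)) 0 := by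
  have h1 : fderiv ℝ (φ 0) q = 1 := by
    rw [show φ 0 = id from funext h.zero]; exact fderiv_id
  obtain ⟨D, hD, hDH⟩ := hasFDerivAt_piola (1 : (E →L[ℝ] E)ˣ)
  have h2 : HasDerivAt (fun t => piola (fderiv ℝ (φ t) q)) (D (fderiv ℝ U q)) 0 :=
    HasFDerivAt.comp_hasDerivAt_of_eq (0 : ℝ) hD hd (by rw [h1]; rfl)
  have h3 : HasDerivAt (fun t => V (φ t q)) (fderiv ℝ V q (U q)) 0 := by
    have h4 := h.hasDerivAt q 0
    rw [h.zero] at h4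
    exact HasFDerivAt.comp_hasDerivAt_of_eq (0 : ℝ) hV.hasFDerivAt h4 (h.zero q).symm
  have h5 := h2.clm_apply h3
  refine h5.congr_deriv ?_
  have hdet : ContinuousLinearMap.det (1 : E →L[ℝ] E) = 1 := LinearMap.det_id
  rw [h1, piola_one, hDH, h.zero]
  simp [hdet]

theorem IsFlowOf.exists_norm_pull_sub_le (h : IsFlowOf U φ) (hU : ContDiff ℝ 1 U)
    (hc : HasCompactSupport U) {V : E → E} (hV : ContDiff ℝ 1 V) :
    ∃ T > 0, ∃ C : ℝ, ∀ t, |t| ≤ T → ∀ q ∈ tsupport U, ‖pull (φ t) V q - V q‖ ≤ C * |t| := by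
  obtain ⟨T, hT, C, hC, hφ, -⟩ := h.contDiff_small hU hc
  obtain ⟨K, -, hK, -⟩ := exists_lipschitzWith_of_hasCompactSupport hU hc
  obtain ⟨CU, hCU⟩ := hc.exists_bound_of_continuous hU.continuous
  obtain ⟨Λ, s, hs, hΛ⟩ := (contDiffAt_piola (E := E) isUnit_one).exists_lipschitzOnWith
  obtain ⟨δ, hδ, hδs⟩ := Metric.mem_nhds_iff.1 hs
  obtain ⟨R, hR⟩ := hc.isBounded.subset_closedBall (0 : E)
  have hball : IsCompact (Metric.closedBall (0 : E) R) := isCompact_closedBall _ _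
  obtain ⟨M, hM⟩ := hball.exists_bound_of_continuousOn hV.continuous.continuousOn
  obtain ⟨M', hM'⟩ := hball.exists_bound_of_continuousOn
    (hV.continuous_fderiv one_ne_zero).continuousOn
  refine ⟨min T (δ / (2 * (C + 1))), lt_min hT (by positivity), Λ * C * M + M' * CU,
    fun t ht q hq => ?_⟩
  have ht1 : |t| ≤ T := ht.trans (min_le_left _ _)
  have ht2 : |t| ≤ δ / (2 * (C + 1)) := ht.trans (min_le_right _ _)
  have hA := (hφ t ht1).2 q
  have hq' : φ t q ∈ tsupport U := h.apply_mem_tsupport hK hq t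
  have hAs : fderiv ℝ (φ t) q ∈ s := by
    refine hδs ?_
    rw [Metric.mem_ball, dist_eq_norm]
    refine hA.trans_lt ?_
    calc C * |t| ≤ (C + 1) * (δ / (2 * (C + 1))) :=
          mul_le_mul (by linarith) ht2 (abs_nonneg _) (by linarith)
      _ = δ / 2 := by field_simp
      _ < δ := by linarith
  have h1 : ‖piola (fderiv ℝ (φ t) q) - 1‖ ≤ Λ * (C * |t|) := by
    have := hΛ.norm_sub_le hAs (mem_of_mem_nhds hs)
    rw [piola_one] at this
    exact this.trans (mul_le_mul_of_nonneg_left hA Λ.2)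
  have h2 : ‖V (φ t q) - V q‖ ≤ M' * (CU * |t|) := by
    refine ((convex_closedBall (0 : E) R).norm_image_sub_le_of_norm_fderiv_le (𝕜 := ℝ)
      (fun x _ => hV.differentiable one_ne_zero x) hM' (hR hq) (hR hq')).trans ?_
    exact mul_le_mul_of_nonneg_left (h.norm_sub_le hCU t q)
      ((norm_nonneg _).trans (hM' _ (hR hq)))
  have h3 : pull (φ t) V q - V q = (piola (fderiv ℝ (φ t) q) - 1) (V (φ t q))
      + (V (φ t q) - V q) := by
    simp [pull]
  calc ‖pull (φ t) V q - V q‖ ≤ Λ * (C * |t|) * M + M' * (CU * |t|) := by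
        rw [h3]
        refine (norm_add_le _ _).trans (add_le_add ?_ h2)
        refine (ContinuousLinearMap.le_opNorm _ _).trans ?_
        exact mul_le_mul h1 (hM _ (hR hq')) (norm_nonneg _) ((norm_nonneg _).trans h1)
    _ = (Λ * C * M + M' * CU) * |t| := by ring

end Pull

/-! ### The flux along the flow -/

theorem abs_sqrt_sum_sq_sub_le {ι : Type*} [Fintype ι] (a b : ι → ℝ) :
    |Real.sqrt (∑ i, a i ^ 2) - Real.sqrt (∑ i, b i ^ 2)| ≤ ∑ i, |a i - b i| := by
  have h := abs_norm_sub_norm_le (WithLp.toLp 2 a) (WithLp.toLp 2 b : EuclideanSpace ℝ ι)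
  rw [EuclideanSpace.norm_eq, EuclideanSpace.norm_eq] at h
  simp only [Real.norm_eq_abs, sq_abs] at h
  refine h.trans ?_
  rw [← WithLp.toLp_sub, EuclideanSpace.norm_eq]
  refine Real.sqrt_le_iff.2 ⟨Finset.sum_nonneg fun i _ => abs_nonneg _, ?_⟩
  exact Finset.sum_sq_le_sq_sum_of_nonneg fun i _ => abs_nonneg _

theorem eventually_abs_lt {T : ℝ} (hT : 0 < T) : ∀ᶠ t in 𝓝 (0 : ℝ), |t| < T := by
  filter_upwards [Metric.ball_mem_nhds (0 : ℝ) hT] with t ht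
  simpa using ht

namespace Heis
variable {n : ℕ} {Ω : Set (Heis n)} {U : Heis n → Heis n} {φ : ℝ → Heis n → Heis n}

/-- The flux density `v ↦ ⟨v, w⟩` as a continuous linear map. -/
def metricCLM (q w : Heis n) : Heis n →L[ℝ] ℝ :=
  LinearMap.toContinuousLinearMap
    { toFun := fun v => metric q v w
      map_add' := fun v v' => metric_add_left q v v' w
      map_smul' := fun c v => metric_smul_left q c v w }

theorem _root_.IsFlowOf.exists_contDiff (h : IsFlowOf U φ) (hU : ContDiff ℝ 1 U)
    (hc : HasCompactSupport U) : ∀ᶠ t in 𝓝 (0 : ℝ), ContDiff ℝ 1 (φ t) ∧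
      ∀ p, ‖fderiv ℝ (φ t) p - 1‖ ≤ 1 / 2 := by
  obtain ⟨T, hT, C, hC, hφ, -⟩ := h.contDiff_small hU hc
  have h1 := eventually_abs_lt hT
  have h2 : ∀ᶠ t in 𝓝 (0 : ℝ), C * |t| < 1 / 2 := by
    have : Tendsto (fun t : ℝ => C * |t|) (𝓝 0) (𝓝 (C * |0|)) :=
      (continuous_const.mul continuous_abs).tendsto _
    refine this.eventually_lt_const ?_
    simp
  filter_upwards [h1, h2] with t ht1 ht2
  exact ⟨(hφ t ht1.le).1, fun p => ((hφ t ht1.le).2 p).trans ht2.le⟩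

theorem continuous_pull {ψ : Heis n → Heis n} (hψ : ContDiff ℝ 1 ψ)
    (h1 : ∀ p, ‖fderiv ℝ ψ p - 1‖ ≤ 1 / 2) {V : Heis n → Heis n} (hV : Continuous V) :
    Continuous (pull ψ V) := by
  obtain ⟨C, -, hC⟩ := exists_bound_piola (E := Heis n)
  refine Continuous.clm_apply (continuous_iff_continuousAt.2 fun q => ?_) (hV.comp hψ.continuous)
  exact ContinuousAt.comp (f := fderiv ℝ ψ) (g := piola)
    (contDiffAt_piola (hC _ ((h1 q).trans (by norm_num))).1).continuousAt
    (hψ.continuous_fderiv one_ne_zero).continuousAt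

theorem _root_.IsFlowOf.hasCompactSupport_sub (h : IsFlowOf U φ) (hU : ContDiff ℝ 1 U)
    (hc : HasCompactSupport U) (t : ℝ) : HasCompactSupport fun q => φ t q - q := by
  obtain ⟨K, -, hK, -⟩ := exists_lipschitzWith_of_hasCompactSupport hU hc
  exact HasCompactSupport.intro hc fun q hq => by rw [h.apply_of_notMem hK hq, sub_self]

theorem _root_.IsFlowOf.hasCompactSupport_pull (h : IsFlowOf U φ) (hU : ContDiff ℝ 1 U)
    (hc : HasCompactSupport U) {V : Heis n → Heis n} (hV : HasCompactSupport V) (t : ℝ) :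
    HasCompactSupport (pull (φ t) V) := by
  obtain ⟨K, -, hK, -⟩ := exists_lipschitzWith_of_hasCompactSupport hU hc
  refine HasCompactSupport.intro (hc.union hV) fun q hq => ?_
  rw [h.pull_of_notMem hK fun h' => hq (Or.inl h')]
  exact image_eq_zero_of_notMem_tsupport fun h' => hq (Or.inr h')

theorem _root_.IsFlowOf.injective (h : IsFlowOf U φ) (hU : ContDiff ℝ 1 U)
    (hc : HasCompactSupport U) (t : ℝ) : Function.Injective (φ t) := by
  obtain ⟨K, -, hK, -⟩ := exists_lipschitzWith_of_hasCompactSupport hU hc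
  exact Function.LeftInverse.injective (h.neg_apply_apply hK t)

/-- The divergence theorem on the image of `Ω` under the flow. -/
theorem HasC2Boundary.setIntegral_image_flow (hΩ : HasC2Boundary Ω) (hm : MeasurableSet Ω)
    (h : IsFlowOf U φ) (hU : ContDiff ℝ 1 U) (hc : HasCompactSupport U) {t : ℝ}
    (hφ : ContDiff ℝ 1 (φ t)) (h1 : ∀ p, ‖fderiv ℝ (φ t) p - 1‖ ≤ 1 / 2)
    {V : Heis n → Heis n} (hV : ContDiff ℝ 1 V) (hVc : HasCompactSupport V) :
    ∫ p in φ t '' Ω, traceCLM (Heis n) (fderiv ℝ V p) =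
      -∫ q, metric q (pull (φ t) V q) (innerNormal Ω q) ∂(surfaceMeasure (frontier Ω)) := by
  rw [integral_image_eq_integral_abs_det_fderiv_smul volume hm
    (fun x _ => (hφ.differentiable one_ne_zero x).hasFDerivAt.hasFDerivWithinAt)
    (h.injective hU hc t).injOn]
  exact hΩ.setIntegral_transport hm hφ (h.hasCompactSupport_sub hU hc t) h1 hV hVc

theorem HasC2Boundary.integrable_const_indicator (hΩ : HasC2Boundary Ω) {K : Set (Heis n)}
    (hK : IsCompact K) (C : ℝ) :
    Integrable (K.indicator fun _ => C) (surfaceMeasure (frontier Ω)) := by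
  have := hΩ.isLocallyFiniteMeasure
  rw [integrable_indicator_iff hK.measurableSet]
  exact integrableOn_const hK.measure_lt_top.ne

theorem HasC2Boundary.exists_abs_metric_pull_sub_le (hΩ : HasC2Boundary Ω) (h : IsFlowOf U φ)
    (hU : ContDiff ℝ 1 U) (hc : HasCompactSupport U) {V : Heis n → Heis n}
    (hV : ContDiff ℝ 1 V) :
    ∃ C : ℝ, ∀ᶠ t in 𝓝 (0 : ℝ), ∀ q ∈ frontier Ω ∩ tsupport U,
      |metric q (pull (φ t) V q - V q) (innerNormal Ω q)| ≤ C * |t| := by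
  obtain ⟨T, hT, C, hC⟩ := h.exists_norm_pull_sub_le hU hc hV
  obtain ⟨C', hC', hlen⟩ := exists_len_le hc
  refine ⟨C' * C, ?_⟩
  have h1 := eventually_abs_lt hT
  filter_upwards [h1] with t ht q hq
  calc _ ≤ len q (pull (φ t) V q - V q) := hΩ.abs_metric_innerNormal_le hq.1 _
    _ ≤ C' * ‖pull (φ t) V q - V q‖ := hlen q hq.2 _
    _ ≤ C' * (C * |t|) := mul_le_mul_of_nonneg_left (hC t ht.le q hq.2) hC'
    _ = C' * C * |t| := by ring

theorem exists_pos_of_eventually_nhds_zero {P : ℝ → Prop} (h : ∀ᶠ t in 𝓝 (0 : ℝ), P t) :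
    ∃ T > 0, ∀ t, |t| ≤ T → P t := by
  obtain ⟨T, hT, h1⟩ := Metric.eventually_nhds_iff.1 h
  refine ⟨T / 2, by positivity, fun t ht => h1 ?_⟩
  rw [Real.dist_eq, sub_zero]
  linarith

/-- The derivative of the flux of a field through the moving boundary. -/
theorem HasC2Boundary.hasDerivAt_flux (hΩ : HasC2Boundary Ω) (h : IsFlowOf U φ)
    (hU : ContDiff ℝ 1 U) (hc : HasCompactSupport U) {V : Heis n → Heis n}
    (hV : ContDiff ℝ 1 V) :
    HasDerivAt (fun t => ∫ q, metric q (pull (φ t) V q - V q) (innerNormal Ω q)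
        ∂(surfaceMeasure (frontier Ω)))
      (∫ q, metric q (traceCLM (Heis n) (fderiv ℝ U q) • V q - fderiv ℝ U q (V q)
        + fderiv ℝ V q (U q)) (innerNormal Ω q) ∂(surfaceMeasure (frontier Ω))) 0 := by
  have hm : MeasurableSet (frontier Ω) := isClosed_frontier.measurableSet
  obtain ⟨K, -, hK, -⟩ := exists_lipschitzWith_of_hasCompactSupport hU hc
  obtain ⟨C, hC⟩ := hΩ.exists_abs_metric_pull_sub_le h hU hc hV
  obtain ⟨T₀, hT₀, C₀, hC₀, -, hd⟩ := h.contDiff_small hU hc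
  obtain ⟨T, hT, hTC⟩ := exists_pos_of_eventually_nhds_zero (hC.and (h.exists_contDiff hU hc))
  refine hasDerivAt_integral_of_norm_sub_le hT (b := (tsupport U).indicator fun _ => C)
    (fun t ht => ?_) ?_ (hΩ.integrable_const_indicator hc C) ?_ ?_
  · refine aestronglyMeasurable_surfaceMeasure hm (hΩ.continuousOn_metric_innerNormal ?_)
    exact ((continuous_pull (hTC t ht).2.1 (hTC t ht).2.2 hV.continuous).sub
      hV.continuous).continuousOn
  · simp only [h.pull_zero, sub_self, metric_zero_left]
    exact integrable_zero _ _ _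
  · filter_upwards [ae_mem_surfaceMeasure hm] with q hq t ht
    simp only [h.pull_zero, sub_self, metric_zero_left, sub_zero]
    by_cases hqU : q ∈ tsupport U
    · rw [Set.indicator_of_mem hqU]
      exact (hTC t ht).1 q ⟨hq, hqU⟩
    · rw [Set.indicator_of_notMem hqU, h.pull_of_notMem hK hqU, sub_self, metric_zero_left,
        abs_zero, zero_mul]
  · refine Eventually.of_forall fun q => ?_
    exact (metricCLM q (innerNormal Ω q)).hasFDerivAt.comp_hasDerivAt (0 : ℝ)
      ((h.hasDerivAt_pull (hd q) (hV.differentiable one_ne_zero q)).sub_const (V q))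

/-- The largest flux density which a horizontal field of length at most one can have after the
Piola transform. -/
def maxFlux (Ω : Set (Heis n)) (ψ : Heis n → Heis n) (q : Heis n) : ℝ :=
  Real.sqrt (∑ i, metric q (pull ψ (horFrame i) q) (innerNormal Ω q) ^ 2)

theorem abs_metric_pull_le_maxFlux {ψ V : Heis n → Heis n} (hV : ∀ q, V q ∈ horizontal q)
    (hV1 : ∀ q, len q (V q) ≤ 1) (q : Heis n) :
    |metric q (pull ψ V q) (innerNormal Ω q)| ≤ maxFlux Ω ψ q :=
  abs_metric_clm_le (hV _) (hV1 _) _ _ _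

theorem _root_.IsFlowOf.maxFlux_zero (h : IsFlowOf U φ) (q : Heis n) :
    maxFlux Ω (φ 0) q = len q (horProj q (innerNormal Ω q)) := by
  simp_rw [maxFlux, h.pull_zero]
  exact sqrt_sum_horFrame _ _

/-- The increment of the integral over `supp U` of the largest flux density is differentiable at
`0`. -/
theorem HasC2Boundary.exists_hasDerivAt_maxFlux (hΩ : HasC2Boundary Ω) (h : IsFlowOf U φ)
    (hU : ContDiff ℝ 1 U) (hc : HasCompactSupport U)
    (hpos : ∀ q ∈ frontier Ω ∩ tsupport U, 0 < len q (horProj q (innerNormal Ω q))) :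
    ∃ d, (∀ᶠ t in 𝓝 (0 : ℝ), Integrable ((tsupport U).indicator fun q => maxFlux Ω (φ t) q
        - len q (horProj q (innerNormal Ω q))) (surfaceMeasure (frontier Ω))) ∧
      HasDerivAt (fun t => ∫ q, (tsupport U).indicator (fun q => maxFlux Ω (φ t) q
        - len q (horProj q (innerNormal Ω q))) q ∂(surfaceMeasure (frontier Ω))) d 0 := by
  have hm : MeasurableSet (frontier Ω) := isClosed_frontier.measurableSet
  obtain ⟨K, -, hK, -⟩ := exists_lipschitzWith_of_hasCompactSupport hU hc
  obtain ⟨T₀, hT₀, C₀, hC₀, -, hd⟩ := h.contDiff_small hU hc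
  choose C hC using fun i => hΩ.exists_abs_metric_pull_sub_le h hU hc (contDiff_horFrame i)
  obtain ⟨T, hT, hTC⟩ := exists_pos_of_eventually_nhds_zero
    ((eventually_all.2 hC).and (h.exists_contDiff hU hc))
  set F : ℝ → Heis n → ℝ := fun t => (tsupport U).indicator fun q => maxFlux Ω (φ t) q
    - len q (horProj q (innerNormal Ω q)) with hF
  have hmeas : ∀ t, |t| ≤ T → AEStronglyMeasurable (F t) (surfaceMeasure (frontier Ω)) := by
    intro t ht
    refine AEStronglyMeasurable.indicator ?_ (isClosed_tsupport U).measurableSet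
    simp_rw [← h.maxFlux_zero (Ω := Ω)]
    have hcont : ∀ s, |s| ≤ T → ContinuousOn (maxFlux Ω (φ s)) (frontier Ω) := fun s hs =>
      (continuousOn_finsetSum _ fun i _ => (hΩ.continuousOn_metric_innerNormal
        (continuous_pull (hTC s hs).2.1 (hTC s hs).2.2
          (contDiff_horFrame i).continuous).continuousOn).pow 2).sqrt
    exact aestronglyMeasurable_surfaceMeasure hm ((hcont t ht).sub
      (hcont 0 (by rw [abs_zero]; exact hT.le)))
  have hF0 : F 0 = 0 := by
    funext q
    simp only [hF, h.maxFlux_zero, sub_self]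
    classical rw [Set.indicator_apply, ite_self, Pi.zero_apply]
  have hbd : ∀ᵐ q ∂(surfaceMeasure (frontier Ω)), ∀ t, |t| ≤ T →
      |F t q - F 0 q| ≤ (tsupport U).indicator (fun _ => ∑ i, C i) q * |t| := by
    filter_upwards [ae_mem_surfaceMeasure hm] with q hq t ht
    rw [hF0, Pi.zero_apply, sub_zero]
    by_cases hqU : q ∈ tsupport U
    · simp only [hF]
      rw [Set.indicator_of_mem hqU, Set.indicator_of_mem hqU, ← sqrt_sum_horFrame, maxFlux,
        Finset.sum_mul]
      refine (abs_sqrt_sum_sq_sub_le _ _).trans (Finset.sum_le_sum fun i _ => ?_)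
      rw [← metric_sub_left]
      exact (hTC t ht).1 i q ⟨hq, hqU⟩
    · simp only [hF]
      rw [Set.indicator_of_notMem hqU, Set.indicator_of_notMem hqU, abs_zero, zero_mul]
  have hbi := hΩ.integrable_const_indicator hc (∑ i, C i)
  refine ⟨_, ?_, hasDerivAt_integral_of_norm_sub_le hT hmeas (by
    change Integrable (F 0) _
    rw [hF0]
    exact integrable_zero _ _ _) hbi hbd (F' := fun q => deriv (fun t => F t q) 0) ?_⟩
  · filter_upwards [eventually_abs_lt hT] with t ht
    refine (hbi.mul_const |t|).mono' (hmeas t ht.le) ?_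
    filter_upwards [hbd] with q hq
    have := hq t ht.le
    rwa [hF0, Pi.zero_apply, sub_zero] at this
  · filter_upwards [ae_mem_surfaceMeasure hm] with q hq
    refine DifferentiableAt.hasDerivAt ?_
    by_cases hqU : q ∈ tsupport U
    · simp only [Set.indicator_of_mem hqU]
      refine DifferentiableAt.sub_const (DifferentiableAt.sqrt ?_ ?_) _
      · refine DifferentiableAt.fun_sum fun i _ => DifferentiableAt.pow ?_ 2
        exact ((metricCLM q (innerNormal Ω q)).hasFDerivAt.comp_hasDerivAt (0 : ℝ)
          (h.hasDerivAt_pull (hd q)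
            ((contDiff_horFrame i).differentiable one_ne_zero q))).differentiableAt
      · intro h0
        have h1 := h.maxFlux_zero (Ω := Ω) q
        rw [maxFlux, h0, Real.sqrt_zero] at h1
        exact (hpos q ⟨hq, hqU⟩).ne h1
    · simp only [Set.indicator_of_notMem hqU]
      exact differentiableAt_const _

end Heis

namespace Heis
variable {n : ℕ} {Ω : Set (Heis n)} {U : Heis n → Heis n} {φ : ℝ → Heis n → Heis n}

/-! ### The derivative of the perimeter for fields supported near the regular boundary -/

theorem metric_horProj_self (p v : Heis n) :
    metric p (horProj p v) v = len p (horProj p v) ^ 2 := by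
  rw [metric_horizontal_left (horProj_mem p v), metric_self]

theorem metric_horNormal (p : Heis n) :
    metric p (horNormal Ω p) (innerNormal Ω p) = len p (horProj p (innerNormal Ω p)) := by
  rw [horNormal, metric_smul_left, metric_horProj_self]
  rcases eq_or_ne (len p (horProj p (innerNormal Ω p))) 0 with h | h
  · rw [h]; simp
  · field_simp

/-- The perimeter is squeezed between two functions which are differentiable at `0`: below, by the
flux of a test field which follows `-ν_H` near `supp U`, and above, by replacing all test fields
near `supp U` by the largest possible flux density. -/
theorem HasC2Boundary.hasDerivAt_perimeter (hΩ : HasC2Boundary Ω) (hm : MeasurableSet Ω)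
    (hfin : perimeter Ω ≠ ∞) (h : IsFlowOf U φ) (hU : ContDiff ℝ 1 U) (hc : HasCompactSupport U)
    {V : Heis n → Heis n} {χ : Heis n → ℝ} (hV : ContDiff ℝ 1 V) (hVc : HasCompactSupport V)
    (hVh : ∀ q, V q ∈ horizontal q) (hVχ : ∀ q, len q (V q) ≤ χ q) (hχ : ContDiff ℝ 1 χ)
    (hχ1 : ∀ q, χ q ≤ 1) (hVS : ∀ q ∈ frontier Ω, V q = -(χ q • horNormal Ω q))
    (hpos : ∀ q ∈ frontier Ω, χ q ≠ 0 → 0 < len q (horProj q (innerNormal Ω q)))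
    (hχU : ∀ q ∈ tsupport U, χ q = 1) :
    (∀ᶠ t in 𝓝 (0 : ℝ), perimeter (φ t '' Ω) ≠ ∞) ∧
    HasDerivAt (fun t => (perimeter (φ t '' Ω)).toReal)
      (-∫ q, metric q (traceCLM (Heis n) (fderiv ℝ U q) • V q - fderiv ℝ U q (V q)
        + fderiv ℝ V q (U q)) (innerNormal Ω q) ∂(surfaceMeasure (frontier Ω))) 0 := by
  have hmS : MeasurableSet (frontier Ω) := isClosed_frontier.measurableSet
  obtain ⟨K, -, hK, -⟩ := exists_lipschitzWith_of_hasCompactSupport hU hc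
  have hφ0 : φ 0 '' Ω = Ω := by
    rw [show φ 0 = id from funext h.zero, Set.image_id]
  have hχ0 : ∀ q, 0 ≤ χ q := fun q => (len_nonneg _ _).trans (hVχ q)
  have hVN : ∀ q ∈ frontier Ω, metric q (V q) (innerNormal Ω q) =
      -(χ q * len q (horProj q (innerNormal Ω q))) := by
    intro q hq
    rw [hVS q hq, metric_neg_left, metric_smul_left, metric_horNormal]
  -- the test field that agrees with `V` near `supp U` and with a given one away from it
  let modif : (Heis n → Heis n) → Heis n → Heis n := fun W q => V q + (1 - χ q) • W q
  have hmod : ∀ W, IsTestField W → IsTestField (modif W) := by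
    rintro W ⟨hW, hWc, hWh, hW1⟩
    refine ⟨hV.add ((contDiff_const.sub hχ).smul hW),
      hVc.add (hWc.smul_left (f := fun q => 1 - χ q)),
      fun q => (horizontal q).add_mem (hVh q) (horizontal_smul_mem _ (hWh q)), fun q => ?_⟩
    have h1 := sub_nonneg.2 (hχ1 q)
    calc len q (modif W q) ≤ χ q + |1 - χ q| * len q (W q) := by
          refine (len_add_le _ _ _).trans (add_le_add (hVχ q) ?_)
          rw [len_smul]
      _ ≤ χ q + (1 - χ q) * 1 := by
          rw [abs_of_nonneg h1]
          exact add_le_add le_rfl (mul_le_mul_of_nonneg_left (hW1 q) h1)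
      _ = 1 := by ring
  have hmodU : ∀ W, ∀ q ∈ tsupport U, modif W q = V q := fun W q hq => by
    simp [modif, hχU q hq]
  have hmodN : ∀ W, IsTestField W → ∀ q ∈ frontier Ω,
      metric q (modif W q) (innerNormal Ω q) ≤ metric q (W q) (innerNormal Ω q) := by
    rintro W ⟨hW, hWc, hWh, hW1⟩ q hq
    have h1 := (abs_le.1 (abs_metric_le_horProj (hWh q) (hW1 q) (innerNormal Ω q))).1
    simp only [modif, metric_add_left, metric_smul_left, hVN q hq]
    nlinarith [mul_le_mul_of_nonneg_left h1 (hχ0 q)]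
  have hint : ∀ W, IsTestField W → Integrable (fun q => metric q (W q) (innerNormal Ω q))
      (surfaceMeasure (frontier Ω)) := fun W hW =>
    hΩ.integrable_metric hW.1.continuous hW.2.1
  obtain ⟨d, hGi, hG⟩ := hΩ.exists_hasDerivAt_maxFlux h hU hc fun q hq =>
    hpos q hq.1 (by rw [hχU q hq.2]; exact one_ne_zero)
  set G : ℝ → Heis n → ℝ := fun t => (tsupport U).indicator fun q => maxFlux Ω (φ t) q
    - len q (horProj q (innerNormal Ω q)) with hGdef
  have hev := h.exists_contDiff hU hc
  have hpi : ∀ t, ContDiff ℝ 1 (φ t) → (∀ p, ‖fderiv ℝ (φ t) p - 1‖ ≤ 1 / 2) → ∀ W,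
      IsTestField W → Integrable (fun q => metric q (pull (φ t) W q) (innerNormal Ω q))
        (surfaceMeasure (frontier Ω)) :=
    fun t h1 h2 W hW => hΩ.integrable_metric (continuous_pull h1 h2 hW.1.continuous)
      (h.hasCompactSupport_pull hU hc hW.2.1 t)
  have hVt : IsTestField V := ⟨hV, hVc, hVh, fun q => (hVχ q).trans (hχ1 q)⟩
  have hupper : ∀ᶠ t in 𝓝 (0 : ℝ), perimeter (φ t '' Ω) ≠ ∞ ∧
      (perimeter (φ t '' Ω)).toReal ≤
        (perimeter Ω).toReal + ∫ q, G t q ∂(surfaceMeasure (frontier Ω)) := by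
    filter_upwards [hev, hGi] with t ht hGt
    refine toReal_perimeter_le fun W hW => ?_
    rw [hΩ.setIntegral_image_flow hm h hU hc ht.1 ht.2 hW.1 hW.2.1]
    have h1 := (hmod W hW).le_toReal_perimeter hfin
    rw [hΩ.setIntegral_trace_fderiv hm (hmod W hW).1 (hmod W hW).2.1] at h1
    refine le_trans ?_ (add_le_add h1 le_rfl)
    have hi : Integrable (fun q => -metric q (modif W q) (innerNormal Ω q))
        (surfaceMeasure (frontier Ω)) := (hint _ (hmod W hW)).neg
    have hGt' : Integrable (fun q => G t q) (surfaceMeasure (frontier Ω)) := hGt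
    rw [← integral_neg, ← integral_neg, ← integral_add hi hGt']
    refine integral_mono_ae (hpi t ht.1 ht.2 W hW).neg (hi.add hGt') ?_
    filter_upwards [ae_mem_surfaceMeasure hmS] with q hq
    by_cases hqU : q ∈ tsupport U
    · have h2 := (abs_le.1 (abs_metric_pull_le_maxFlux (Ω := Ω) (ψ := φ t) hW.2.2.1 hW.2.2.2 q)).1
      simp only [hGdef, Set.indicator_of_mem hqU, hmodU W q hqU, hVN q hq, hχU q hqU]
      linarith
    · simp only [hGdef, Set.indicator_of_notMem hqU, h.pull_of_notMem hK hqU, add_zero]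
      exact neg_le_neg (hmodN W hW q hq)
  have hlower : ∀ᶠ t in 𝓝 (0 : ℝ), (perimeter Ω).toReal
      + -∫ q, metric q (pull (φ t) V q - V q) (innerNormal Ω q) ∂(surfaceMeasure (frontier Ω)) ≤
        (perimeter (φ t '' Ω)).toReal := by
    filter_upwards [hev, hupper] with t ht hPt
    rw [← le_sub_iff_add_le]
    refine (toReal_perimeter_le fun W hW => ?_).2
    rw [le_sub_iff_add_le]
    have h1 := (hmod W hW).le_toReal_perimeter hPt.1
    rw [hΩ.setIntegral_image_flow hm h hU hc ht.1 ht.2 (hmod W hW).1 (hmod W hW).2.1] at h1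
    refine le_trans ?_ h1
    have hi : Integrable (fun q => metric q (pull (φ t) V q - V q) (innerNormal Ω q))
        (surfaceMeasure (frontier Ω)) := by
      simp_rw [metric_sub_left]
      exact (hpi t ht.1 ht.2 V hVt).sub (hint V hVt)
    rw [hΩ.setIntegral_trace_fderiv hm hW.1 hW.2.1, ← neg_add, neg_le_neg_iff,
      ← integral_add (hint W hW) hi]
    refine integral_mono_ae (hpi t ht.1 ht.2 _ (hmod W hW)) ((hint W hW).add hi) ?_
    filter_upwards [ae_mem_surfaceMeasure hmS] with q hq
    by_cases hqU : q ∈ tsupport U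
    · have h2 : pull (φ t) (modif W) q = pull (φ t) V q := by
        rw [pull, hmodU W _ (h.apply_mem_tsupport hK hqU t)]; rfl
      have h3 := hmodN W hW q hq
      rw [hmodU W q hqU] at h3
      simp only [h2, metric_sub_left]
      linarith
    · simp only [h.pull_of_notMem hK hqU, sub_self, metric_zero_left, add_zero]
      exact hmodN W hW q hq
  refine ⟨hupper.mono fun t ht => ht.1, ?_⟩
  refine hasDerivAt_of_le_of_le
    (g₁ := fun t => (perimeter Ω).toReal +
      -∫ q, metric q (pull (φ t) V q - V q) (innerNormal Ω q) ∂(surfaceMeasure (frontier Ω)))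
    (g₂ := fun t => (perimeter Ω).toReal + ∫ q, G t q ∂(surfaceMeasure (frontier Ω)))
    ((hΩ.hasDerivAt_flux h hU hc hV).neg.const_add _) (hG.const_add _) ?_ ?_ ?_
  · simp [h.pull_zero, metric_zero_left, hφ0]
  · classical simp [hGdef, h.maxFlux_zero, hφ0, Set.indicator_apply]
  · filter_upwards [hupper, hlower] with t h1 h2 using ⟨h2, h1.2⟩

/-- By the divergence theorem, the first variation of the flux of `V` is the integral of `div V`
times the normal speed. -/
theorem HasC2Boundary.integral_variation (hΩ : HasC2Boundary Ω) (hm : MeasurableSet Ω)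
    (hU : ContDiff ℝ 1 U) (hc : HasCompactSupport U) {V : Heis n → Heis n} (hV : ContDiff ℝ 1 V)
    (hVc : HasCompactSupport V) :
    ∫ q, metric q (traceCLM (Heis n) (fderiv ℝ U q) • V q - fderiv ℝ U q (V q)
        + fderiv ℝ V q (U q)) (innerNormal Ω q) ∂(surfaceMeasure (frontier Ω)) =
      ∫ q, traceCLM (Heis n) (fderiv ℝ V q) * metric q (U q) (innerNormal Ω q)
        ∂(surfaceMeasure (frontier Ω)) := by
  have h1 := hΩ.integral_bracket hm hU hc hV hVc
  have hdU := hU.continuous_fderiv one_ne_zero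
  have hdV := hV.continuous_fderiv one_ne_zero
  have hcont : Continuous fun q => traceCLM (Heis n) (fderiv ℝ V q) • U q :=
    (continuous_trace_fderiv hV).smul hU.continuous
  have hi := hΩ.integrable_metric hcont
    (hc.smul_left (f := fun q => traceCLM (Heis n) (fderiv ℝ V q)))
  have hcont2 : Continuous fun q => traceCLM (Heis n) (fderiv ℝ U q) • V q
      - traceCLM (Heis n) (fderiv ℝ V q) • U q + fderiv ℝ V q (U q) - fderiv ℝ U q (V q) :=
    ((((continuous_trace_fderiv hU).smul hV.continuous).sub hcont).add
      (hdV.clm_apply hU.continuous)).sub (hdU.clm_apply hV.continuous)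
  have hi2 := hΩ.integrable_metric hcont2 (HasCompactSupport.intro (hc.union hVc) fun q hq => by
    simp [image_eq_zero_of_notMem_tsupport fun h' => hq (Or.inl h'),
      image_eq_zero_of_notMem_tsupport fun h' => hq (Or.inr h')])
  rw [← add_zero (∫ q, traceCLM (Heis n) (fderiv ℝ V q) * _ ∂_), ← h1]
  simp_rw [← metric_smul_left]
  rw [← integral_add hi hi2]
  refine integral_congr_ae (Eventually.of_forall fun q => ?_)
  simp only [← metric_add_left]
  congr 1
  abel

end Heis

/-! ### Localization of the field -/

section Localization
variable {E : Type*} [NormedAddCommGroup E] [NormedSpace ℝ E] [FiniteDimensional ℝ E]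

/-- If two fields agree near a compact set `K` and vanish on the rest of the boundary of `Ω`, then
their flows move `Ω` in the same way for small times: orbits that start near `K` agree, and the
other ones do not cross the boundary. -/
theorem IsFlowOf.eventually_image_eq {U U' : E → E} {φ φ' : ℝ → E → E} (h : IsFlowOf U φ)
    (h' : IsFlowOf U' φ') (hU : ContDiff ℝ 1 U) (hc : HasCompactSupport U) (hU' : ContDiff ℝ 1 U')
    (hc' : HasCompactSupport U') {Ω K : Set E} (hK : IsCompact K)
    (h0 : ∀ q ∈ frontier Ω, q ∉ K → U q = 0) (h0' : ∀ q ∈ frontier Ω, q ∉ K → U' q = 0)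
    (heq : ∀ᶠ q in 𝓝ˢ K, U q = U' q) : ∀ᶠ t in 𝓝 (0 : ℝ), φ t '' Ω = φ' t '' Ω := by
  obtain ⟨Λ, -, hΛ, -⟩ := exists_lipschitzWith_of_hasCompactSupport hU hc
  obtain ⟨Λ', -, hΛ', -⟩ := exists_lipschitzWith_of_hasCompactSupport hU' hc'
  obtain ⟨C, hC⟩ := hc.exists_bound_of_continuous hU.continuous
  obtain ⟨C', hC'⟩ := hc'.exists_bound_of_continuous hU'.continuous
  obtain ⟨O, hO, hKO, hOeq⟩ := mem_nhdsSet_iff_exists.1 heq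
  obtain ⟨δ, hδ, hδO⟩ := hK.exists_thickening_subset_open hO hKO
  set M := max C C' with hM
  have hM0 : 0 ≤ M := (norm_nonneg _).trans ((hC 0).trans (le_max_left _ _))
  set τ := δ / (2 * (M + 1)) with hτ
  have hτ0 : 0 < τ := by positivity
  have hMτ : ∀ s, |s| < τ → M * |s| < δ / 2 := by
    intro s hs
    calc M * |s| ≤ M * τ := mul_le_mul_of_nonneg_left hs.le hM0
      _ < (M + 1) * τ := by nlinarith
      _ = δ / 2 := by rw [hτ]; field_simp
  -- an orbit that starts far from `K` does not cross the boundary: the field vanishes at the points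
  -- of the boundary that it could reach, so that an orbit through such a point is constant
  have hfar : ∀ {W : E → E} {ψ : ℝ → E → E} {L : NNReal}, IsFlowOf W ψ → LipschitzWith L W →
      (∀ p, ‖W p‖ ≤ M) → (∀ q ∈ frontier Ω, q ∉ K → W q = 0) → ∀ q,
      q ∉ Metric.thickening (δ / 2) K → ∀ s, |s| < τ → (ψ s q ∈ Ω ↔ q ∈ Ω) := by
    intro W ψ L hψ hL hWM hW0 q hq s hs
    by_cases hcross : ∃ r ∈ Set.Ioo (-τ) τ, ψ r q ∈ frontier Ω
    · obtain ⟨r, hr, hrS⟩ := hcross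
      have hrK : ψ r q ∉ K := by
        intro hrK
        refine hq (Metric.mem_thickening_iff.2 ⟨_, hrK, ?_⟩)
        rw [dist_comm, dist_eq_norm]
        exact (hψ.norm_sub_le hWM r q).trans_lt (hMτ r (abs_lt.2 hr))
      have hz := hW0 _ hrS hrK
      have h1 := hψ.eq_of_eq_zero hL hz (-r)
      rw [hψ.neg_apply_apply hL] at h1
      rw [← h1] at hz
      rw [hψ.eq_of_eq_zero hL hz s]
    · push Not at hcross
      have hpre : IsPreconnected ((fun r => ψ r q) '' Set.Ioo (-τ) τ) :=
        isPreconnected_Ioo.image _ fun r _ => (hψ.hasDerivAt q r).continuousAt.continuousWithinAt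
      have hmem : ∀ r ∈ Set.Ioo (-τ) τ, ψ r q ∈ (fun r => ψ r q) '' Set.Ioo (-τ) τ :=
        fun r hr => ⟨r, hr, rfl⟩
      have hsI : s ∈ Set.Ioo (-τ) τ := abs_lt.1 hs
      have h0I : (0 : ℝ) ∈ Set.Ioo (-τ) τ := ⟨by linarith, hτ0⟩
      have h0q := hmem 0 h0I
      rw [hψ.zero] at h0q
      have key : ∀ a ∈ (fun r => ψ r q) '' Set.Ioo (-τ) τ, ∀ b ∈ (fun r => ψ r q) '' Set.Ioo (-τ) τ,
          a ∈ Ω → b ∈ Ω := by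
        intro a ha b hb haΩ
        by_contra hbΩ
        have hoff : ∀ z ∈ (fun r => ψ r q) '' Set.Ioo (-τ) τ, z ∉ frontier Ω := by
          rintro _ ⟨r, hr, rfl⟩
          exact hcross r hr
        obtain ⟨z, -, hz1, hz2⟩ := hpre (interior Ω) (closure Ω)ᶜ isOpen_interior
          isClosed_closure.isOpen_compl
          (fun z hz => by
            by_cases hzi : z ∈ interior Ω
            · exact Or.inl hzi
            · exact Or.inr fun hzc => hoff z hz ⟨hzc, hzi⟩)
          ⟨a, ha, by_contra fun hai => hoff a ha ⟨subset_closure haΩ, hai⟩⟩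
          ⟨b, hb, fun hbc => hoff b hb ⟨hbc, fun hbi => hbΩ (interior_subset hbi)⟩⟩
        exact hz2 (subset_closure (interior_subset hz1))
      exact ⟨key _ (hmem s hsI) _ h0q, key _ h0q _ (hmem s hsI)⟩
  have hboth : ∀ s, |s| < τ → ∀ q, (φ s q ∈ Ω ↔ φ' s q ∈ Ω) := by
    intro s hs q
    by_cases hq : q ∈ Metric.thickening (δ / 2) K
    · have hstay : ∀ r ∈ Set.Ioo (-τ) τ, U (φ r q) = U' (φ r q) := by
        intro r hr
        refine hOeq (hδO ?_)
        obtain ⟨z, hz, hzd⟩ := Metric.mem_thickening_iff.1 hq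
        refine Metric.mem_thickening_iff.2 ⟨z, hz, ?_⟩
        have h1 := (h.norm_sub_le (fun p => (hC p).trans (le_max_left C C')) r q).trans_lt
          (hMτ r (abs_lt.2 hr))
        rw [← dist_eq_norm] at h1
        linarith [dist_triangle (φ r q) q z]
      have := ODE_solution_unique_of_mem_Ioo (v := fun _ => U') (s := fun _ => Set.univ) (K := Λ')
        (a := -τ) (b := τ) (t₀ := 0) (f := fun r => φ r q) (g := fun r => φ' r q)
        (fun _ _ => hΛ'.lipschitzOnWith) ⟨by linarith, hτ0⟩
        (fun r hr => ⟨by simpa only [← hstay r hr] using h.hasDerivAt q r, trivial⟩)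
        (fun r _ => ⟨h'.hasDerivAt q r, trivial⟩) (by simp [h.zero, h'.zero])
      rw [show φ s q = φ' s q from this (abs_lt.1 hs)]
    · rw [hfar h hΛ (fun p => (hC p).trans (le_max_left C C')) h0 q hq s hs,
        hfar h' hΛ' (fun p => (hC' p).trans (le_max_right C C')) h0' q hq s hs]
  have himg : ∀ {W : E → E} {ψ : ℝ → E → E} {L : NNReal}, IsFlowOf W ψ → LipschitzWith L W →
      ∀ t q, q ∈ ψ t '' Ω ↔ ψ (-t) q ∈ Ω := by
    intro W ψ L hψ hL t q
    constructor
    · rintro ⟨p, hp, rfl⟩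
      rwa [hψ.neg_apply_apply hL]
    · exact fun hq => ⟨_, hq, hψ.apply_neg_apply hL t q⟩
  filter_upwards [eventually_abs_lt hτ0] with t ht
  ext q
  rw [himg h hΛ, himg h' hΛ', hboth (-t) (by rwa [abs_neg])]

end Localization

/-! ### The first variation of the perimeter -/

/-- A cutoff function which is `1` near `K` and has compact support in `O`. -/
theorem exists_cutoff {E : Type*} [NormedAddCommGroup E] [NormedSpace ℝ E] [FiniteDimensional ℝ E]
    [MeasurableSpace E] [BorelSpace E] {K O : Set E} (hK : IsCompact K) (hO : IsOpen O)
    (hKO : K ⊆ O) :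
    ∃ η : E → ℝ, ContDiff ℝ 1 η ∧ tsupport η ⊆ O ∧ ∀ᶠ q in 𝓝ˢ K, η q = 1 := by
  obtain ⟨s, ρ, -, hρ, -, hρs, -, -, hρ1⟩ := exists_finite_partition hK (fun _ => O)
    fun p hp => ⟨hO, hKO hp⟩
  refine ⟨fun q => ∑ i ∈ s, ρ i q, ContDiff.sum fun i _ => hρ i, ?_, hρ1⟩
  have h1 : IsClosed (⋃ i ∈ s, tsupport (ρ i)) :=
    s.finite_toSet.isClosed_biUnion fun i _ => isClosed_tsupport _
  refine (closure_minimal (fun q hq => ?_) h1).trans (Set.iUnion₂_subset hρs)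
  obtain ⟨i, hi, hne⟩ := Finset.exists_ne_zero_of_sum_ne_zero hq
  exact Set.mem_biUnion hi (subset_tsupport _ hne)

namespace Heis
variable {n : ℕ}

/-- The flow preserves measurability and finiteness of the volume. -/
theorem measurableSet_image_flow {Ω : Set (Heis n)} (hm : MeasurableSet Ω)
    (hv : volume Ω ≠ ∞) {U : Heis n → Heis n} {φ : ℝ → Heis n → Heis n} (h : IsFlowOf U φ)
    (hU : ContDiff ℝ 1 U) (hc : HasCompactSupport U) :
    ∀ᶠ t in 𝓝 (0 : ℝ), MeasurableSet (φ t '' Ω) ∧ volume (φ t '' Ω) ≠ ∞ := by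
  obtain ⟨C, -, hC⟩ := exists_bound_piola (E := Heis n)
  filter_upwards [h.exists_contDiff hU hc] with t ht
  have hd : ∀ x ∈ Ω, HasFDerivWithinAt (φ t) (fderiv ℝ (φ t) x) Ω x := fun x _ =>
    (ht.1.differentiable one_ne_zero x).hasFDerivAt.hasFDerivWithinAt
  refine ⟨measurable_image_of_fderivWithin hm hd (h.injective hU hc t).injOn, ?_⟩
  rw [← lintegral_abs_det_fderiv_eq_addHaar_image volume hm hd (h.injective hU hc t).injOn]
  refine (lt_of_le_of_lt (lintegral_mono fun x => ENNReal.ofReal_le_ofReal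
    (hC _ ((ht.2 x).trans (by norm_num))).2.1) ?_).ne
  rw [lintegral_const, Measure.restrict_apply_univ]
  exact ENNReal.mul_lt_top ENNReal.ofReal_lt_top hv.lt_top

end Heis

theorem mainTheorem3 (n : ℕ) (hn : 1 ≤ n) (Ω : Set (Heis n))
    (hfin : Heis.HasFinitePerimeter Ω) (hΩ : Heis.HasC2Boundary Ω)
    (U : Heis n → Heis n) (hU : ContDiff ℝ 1 U) (hUc : HasCompactSupport U)
    (hsing : Disjoint (closure {p ∈ frontier Ω | U p ≠ 0}) (Heis.singularSet (frontier Ω))) :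
    (∀ᶠ t in 𝓝 (0 : ℝ), Heis.HasFinitePerimeter (Heis.flow U t '' Ω)) ∧
    Integrable (fun p => Heis.metric p (U p) (Heis.innerNormal Ω p) *
        Heis.surfaceDivergence (frontier Ω) (Heis.horNormal Ω) p)
      (Heis.surfaceMeasure (frontier Ω)) ∧
    HasDerivAt (fun t : ℝ => (Heis.perimeter (Heis.flow U t '' Ω)).toReal)
      (∫ p, Heis.metric p (U p) (Heis.innerNormal Ω p) *
        Heis.surfaceDivergence (frontier Ω) (Heis.horNormal Ω) p
        ∂(Heis.surfaceMeasure (frontier Ω))) 0 := by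
  set K := closure {p ∈ frontier Ω | U p ≠ 0} with hKdef
  have hKc : IsCompact K := hUc.of_isClosed_subset isClosed_closure
    (closure_mono fun p hp => hp.2)
  have hKS : K ⊆ frontier Ω := closure_minimal (fun p hp => hp.1) isClosed_frontier
  have hUK : ∀ q ∈ frontier Ω, q ∉ K → U q = 0 := fun q hq hqK => by
    by_contra hne
    exact hqK (subset_closure ⟨hq, hne⟩)
  obtain ⟨V, χ, hV, hVc, hVh, hVχ, hχ, hχ1, hVS, hpos, hχK⟩ := hΩ.exists_extension hKc hKS hsing
  obtain ⟨O, hO, hKO, hOχ⟩ := mem_nhdsSet_iff_exists.1 hχK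
  obtain ⟨η, hη, hηO, hηK⟩ := exists_cutoff hKc hO hKO
  -- the field may be cut off away from `K`
  set U' : Heis n → Heis n := fun q => η q • U q with hU'def
  have hU' : ContDiff ℝ 1 U' := hη.smul hU
  have hUc' : HasCompactSupport U' := hUc.smul_left (f := η)
  have hU'O : tsupport U' ⊆ O := (tsupport_smul_subset_left η U).trans hηO
  have hUU' : ∀ q ∈ frontier Ω, U' q = U q := by
    intro q hq
    by_cases hqK : q ∈ K
    · rw [hU'def]; simp [hηK.self_of_nhdsSet q hqK]
    · rw [hU'def]; simp [hUK q hq hqK]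
  have hφ := Heis.isFlowOf_flow hU hUc
  have hφ' := Heis.isFlowOf_flow hU' hUc'
  have himg : ∀ᶠ t in 𝓝 (0 : ℝ), Heis.flow U t '' Ω = Heis.flow U' t '' Ω :=
    hφ.eventually_image_eq hφ' hU hUc hU' hUc' hKc hUK
      (fun q hq hqK => by rw [hUU' q hq, hUK q hq hqK])
      (by filter_upwards [hηK] with q hq; rw [hU'def]; simp [hq])
  obtain ⟨hP, hD⟩ := hΩ.hasDerivAt_perimeter hfin.1 hfin.2.2 hφ' hU' hUc' hV hVc hVh hVχ hχ hχ1
    hVS hpos fun q hq => hOχ (hU'O hq)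
  have hae : (fun q => -(traceCLM (Heis n) (fderiv ℝ V q) *
      Heis.metric q (U' q) (Heis.innerNormal Ω q))) =ᵐ[Heis.surfaceMeasure (frontier Ω)]
      fun q => Heis.metric q (U q) (Heis.innerNormal Ω q) *
        Heis.surfaceDivergence (frontier Ω) (Heis.horNormal Ω) q := by
    filter_upwards [Heis.ae_mem_surfaceMeasure isClosed_frontier.measurableSet] with q hq
    rw [hUU' q hq]
    by_cases hqU : U q = 0
    · rw [hqU, Heis.metric_zero_left, mul_zero, neg_zero, zero_mul]
    have hqK : q ∈ K := subset_closure ⟨hq, hqU⟩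
    have hdiv : Heis.surfaceDivergence (frontier Ω) (Heis.horNormal Ω) q =
        traceCLM (Heis n) (fderiv ℝ (fun q => -V q) q) := by
      refine hΩ.surfaceDivergence_eq hq (hpos q hq ?_) hV.neg
        (fun q => (Heis.horizontal q).neg_mem (hVh q)) (fun q => ?_) ?_
      · rw [hχK.self_of_nhdsSet q hqK]; exact one_ne_zero
      · rw [← neg_one_smul ℝ, Heis.len_smul, abs_neg, abs_one, one_mul]
        exact (hVχ q).trans (hχ1 q)
      · filter_upwards [self_mem_nhdsWithin, mem_nhdsWithin_of_mem_nhds (hO.mem_nhds (hKO hqK))]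
          with z hz hzO
        rw [hVS z hz, show χ z = 1 from hOχ hzO, one_smul, neg_neg]
    rw [hdiv, fderiv_fun_neg, map_neg]
    ring
  have hint : Integrable (fun q => -(traceCLM (Heis n) (fderiv ℝ V q) *
      Heis.metric q (U' q) (Heis.innerNormal Ω q))) (Heis.surfaceMeasure (frontier Ω)) := by
    simp_rw [← Heis.metric_smul_left]
    exact (hΩ.integrable_metric ((Heis.continuous_trace_fderiv hV).smul hU'.continuous)
      (hUc'.smul_left (f := fun q => traceCLM (Heis n) (fderiv ℝ V q)))).neg
  refine ⟨?_, hint.congr hae, ?_⟩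
  · filter_upwards [himg, hP, Heis.measurableSet_image_flow hfin.1 hfin.2.1 hφ hU hUc]
      with t h1 h2 h3
    exact ⟨h3.1, h3.2, by rw [h1]; exact h2⟩
  · rw [← integral_congr_ae hae, integral_neg,
      ← hΩ.integral_variation hfin.1 hU' hUc' hV hVc]
    refine hD.congr_of_eventuallyEq ?_
    filter_upwards [himg] with t ht
    rw [ht]

end
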